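/- **Languages and theories.** Let $L_Q$ be the three-sorted language with: a field sort $K$ (language of rings); a vector space sort $V$ (language of abelian groups); a sort $Q$; scalar multiplication $K\times V\to V$; predicates $\theta_n$ on $V^n$; functions $\pi_{n,i}:V^{n+1}\to K$ ($1\le i\le n$); and functions $\beta_V:V^2\to K$, $+_Q:Q\times V\to Q$, $-_Q:Q^2\to V$, $\beta_Q:Q\times V\to K$. A *quadratic geometry* (model of $T^0_Q$) is an $L_Q$-structure such that - $K$ is a field of characteristic $2$ and $V$ is a $K$-vector space; - $\theta_n$ is linear independence; $\pi_{n,i}(v_1,\dots,v_n,w)=\alpha_i$ if $v_1,\dots,v_n$ are linearly independent and $w=\sum_j\alpha_jv_j$, and it is $0$ otherwise; - $\beta_V$ is a non-degenerate alternating bilinear form, and each $\beta_Q(q,\cdot)$ is a quadratic form on $V$ with associated bilinear form $\beta_V$; - $+_Q$ is a regular action of $V$ on $Q$ with $\beta_Q(q+_Qv,w)=\beta_Q(q,w)+\beta_V(v,w)^2$, and $q-_Qq'$ is the unique $v$ with $q'+_Qv=q$. A *quadratic geometry with Witt defect* (model of $T^0_{Q,\omega}$, in the language $L_{Q,\omega}=L_Q\cup\{\omega\}$)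 carries in addition a function $\omega:Q\to K$ with values in $\{0,1\}$ such that $\omega(q_1)=\omega(q_2)$ if and only if $\beta_Q(q_1,q_1-_Qq_2)=x^2-x$ for some $x\in K$, and such that, if $\dim V$ is finite, $\omega(q)=0$ if and only if $(V,\beta_Q(q,\cdot))$ is an orthogonal direct sum of hyperbolic planes. $\mathrm{ACF}_2$ is the theory of algebraically closed fields of characteristic $2$. A field is *pseudo-finite* if it is infinite and every first-order sentence of the language of rings that is true in it is true in some finite field. $T_Q$ is the theory of quadratic geometries with $K\models\mathrm{ACF}_2$, $\dim V=\infty$ and $Q\neq\emptyset$. $T_{Q,\omega}$ is the theory of quadratic geometries with Witt defect with $\dim V=\infty$, $Q\ne\emptyset$, and $K$ a perfect pseudo-algebraically closed field whose absolute Galois group is isomorphic to $\mathbb Z_2$ (the 2-adic integers). **Statement.** A *back-and-forth system* between $M$ and $N$ is a non-empty set $I$ of isomorphisms $f:A\to B$ between substructures $A\subseteq M$, $B\subseteq N$ such that for all $f\in I$ and every element $c$ of $M$ (respectively $d$ of $N$), of any sort, some $g\in I$ extends $f$ and has $c$ in its domain (respectively $d$ in its range). (A) Let $M,N$ be both quadratic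 geometries, or both quadratic geometries with Witt defect, with $V(M),V(N)$ infinite dimensional, $Q(M),Q(N)$ non-empty, and $K(M),K(N)$ $\aleph_0$-saturated as fields. 1. Suppose $K(M),K(N)\models\mathrm{ACF}_2$ and, if the Witt defect is in the language, that the functions $\omega^M$ and $\omega^N$ (which are then constant) have the same value. Then the set of all isomorphisms between finitely generated substructures of $M$ and of $N$ is a back-and-forth system. 2. Suppose $K(M)$ and $K(N)$ are elementarily equivalent pseudo-finite fields. Then the set of those isomorphisms $f:A\to B$ between finitely generated substructures $A\subseteq M$, $B\subseteq N$ whose field part $K(A)\to K(B)$ is partial elementary (as a partial map from $K(M)$ to $K(N)$, for the language of rings) is a back-and-forth system. (B) Each of the following theories eliminates quantifiers down to the field sort, i.e. modulo the theory every formula is equivalent to a formula in the same free variables all of whose quantifiers range over $K$: $T_Q$; $T_{Q,\omega}$; the theory of quadratic geometries, and the theory of quadratic geometries with Witt defect, with $\dim V=\infty$, $Q\ne\emptyset$ and $K$ pseudo-finite (hence also each extension of these two, such as those fixing the complete theory of $K$); and, for each $\varepsilon\in\{0,1\}$, the theory of quadratic geometries with Witt defect with $\dim V=\infty$, $Q\neq\emptyset$,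 $K\models\mathrm{ACF}_2$ and $\omega$ constantly equal to $\varepsilon$. -/

import Mathlib

universe u v

namespace QuadraticGeometry

open FirstOrder

noncomputable section

/-! ### Linear algebra -/

/-- The coordinate function `π_{n,i}`: if `x 0, …, x (n-1)` are linearly independent and
`y = ∑ αᵢ xᵢ`, then the value is `αᵢ`; in all other cases it is `0`. -/
def coord (K : Type*) {V : Type*} [Field K] [AddCommGroup V] [Module K V] {n : ℕ}
    (x : Fin n → V) (y : V) (i : Fin n) : K :=
  open Classical in
  if h : LinearIndependent K x ∧ y ∈ Submodule.span K (Set.range x) then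
    h.1.repr ⟨y, h.2⟩ i
  else 0

/-- `(V, q)`, with associated bilinear form `β`, is an orthogonal direct sum of finitely many
hyperbolic planes: there is a basis of singular vectors `b (i, 0), b (i, 1)` (`i < n`) with
`β (b (i, 0)) (b (i, 1)) = 1` and with vectors from different pairs orthogonal. -/
def IsHyperbolic {K V : Type*} [Field K] [AddCommGroup V] [Module K V]
    (q : QuadraticForm K V) (β : LinearMap.BilinForm K V) : Prop :=
  ∃ (n : ℕ) (b : Module.Basis (Fin n × Fin 2) K V),
    (∀ i, q (b i) = 0) ∧ (∀ i, β (b (i, 0)) (b (i, 1)) = 1) ∧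
    ∀ i j, i.1 ≠ j.1 → β (b i) (b j) = 0

/-! ### Quadratic geometries -/

/-- `w = false`: quadratic geometries, that is, models of `T⁰_Q`, in the language `L_Q`.
`w = true`: quadratic geometries with Witt defect, that is, models of `T⁰_{Q,ω}`, in the
language `L_{Q,ω}`.  The independence predicates `θ_n` and the coordinate functions `π_{n,i}` of
these languages are determined by the vector space; they enter below as `LinearIndependent` and
`coord`.  As in the first-order axioms, the sort `Q` may be empty. -/
structure QuadGeom (w : Bool) where
  /-- The field sort. -/
  K : Type u
  /-- The vector space sort. -/
  V : Type u
  /-- The sort of quadratic forms. -/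
  Q : Type u
  [instField : Field K]
  [instCharP : CharP K 2]
  [instAddCommGroup : AddCommGroup V]
  [instModule : Module K V]
  /-- The bilinear form `β_V`. -/
  β : LinearMap.BilinForm K V
  β_alt : β.IsAlt
  β_nondegenerate : β.Nondegenerate
  /-- `form q` is the quadratic form `β_Q(q, ·)`. -/
  form : Q → QuadraticForm K V
  /-- The bilinear form associated with `form q` is `β_V`. -/
  form_polar : ∀ q x y, β x y = form q (x + y) - form q x - form q y
  /-- The action `+_Q` of `V` on `Q`. -/
  act : Q → V → Q
  act_zero : ∀ q, act q 0 = q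
  act_add : ∀ q x y, act q (x + y) = act (act q x) y
  /-- The action is regular. -/
  act_regular : ∀ q q', ∃! x, act q x = q'
  form_act : ∀ q x y, form (act q x) y = form q y + β x y ^ 2
  /-- The difference `-_Q`. -/
  diff : Q → Q → V
  act_diff : ∀ q q', act q' (diff q q') = q
  /-- The Witt defect function `ω`, present only when `w = true`. -/
  ω : w = true → Q → K
  ω_zero_or_one : ∀ h q, ω h q = 0 ∨ ω h q = 1
  ω_eq_iff : ∀ h q₁ q₂, ω h q₁ = ω h q₂ ↔ ∃ x : K, form q₁ (diff q₁ q₂) = x ^ 2 - x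
  /-- On finite-dimensional spaces `ω` is the Witt defect. -/
  ω_of_finiteDimensional : ∀ h, FiniteDimensional K V →
    ∀ q, ω h q = 0 ↔ IsHyperbolic (form q) β

attribute [instance] QuadGeom.instField QuadGeom.instCharP QuadGeom.instAddCommGroup
  QuadGeom.instModule

variable {w : Bool}

/-! ### Substructures and isomorphisms between them -/

/-- Substructures of a quadratic geometry: subsets of the three sorts that are closed under all
functions of the language. -/
structure Substructure (M : QuadGeom.{u} w) where
  K : Subring M.K
  V : AddSubgroup M.V
  Q : Set M.Q
  smul_mem : ∀ a ∈ K, ∀ x ∈ V, a • x ∈ V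
  coord_mem : ∀ (n : ℕ) (x : Fin n → M.V) (y : M.V) (i : Fin n),
    (∀ j, x j ∈ V) → y ∈ V → coord M.K x y i ∈ K
  β_mem : ∀ x ∈ V, ∀ y ∈ V, M.β x y ∈ K
  form_mem : ∀ q ∈ Q, ∀ x ∈ V, M.form q x ∈ K
  act_mem : ∀ q ∈ Q, ∀ x ∈ V, M.act q x ∈ Q
  diff_mem : ∀ q ∈ Q, ∀ q' ∈ Q, M.diff q q' ∈ V
  ω_mem : ∀ h, ∀ q ∈ Q, M.ω h q ∈ K

/-- `A` is generated by finitely many elements: it is the least substructure that contains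
certain finite subsets of its three sorts. -/
def Substructure.FG {M : QuadGeom.{u} w} (A : Substructure M) : Prop :=
  ∃ (s : Set M.K) (t : Set M.V) (r : Set M.Q), s.Finite ∧ t.Finite ∧ r.Finite ∧
    (s ⊆ A.K ∧ t ⊆ A.V ∧ r ⊆ A.Q) ∧
    ∀ B : Substructure M, s ⊆ B.K → t ⊆ B.V → r ⊆ B.Q → A.K ≤ B.K ∧ A.V ≤ B.V ∧ A.Q ⊆ B.Q

/-- Isomorphisms from a substructure `dom` of `M` to a substructure `cod` of `N`: bijections of
the three sorts that respect all functions and predicates of the language. -/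
structure PartialIso (M : QuadGeom.{u} w) (N : QuadGeom.{v} w) where
  dom : Substructure M
  cod : Substructure N
  toK : dom.K ≃+* cod.K
  toV : dom.V ≃+ cod.V
  toQ : dom.Q ≃ cod.Q
  map_smul : ∀ (a : dom.K) (x : dom.V),
    (toV ⟨(a : M.K) • (x : M.V), dom.smul_mem _ a.2 _ x.2⟩ : N.V) = (toK a : N.K) • (toV x : N.V)
  map_indep : ∀ (n : ℕ) (x : Fin n → dom.V),
    LinearIndependent M.K (fun i => (x i : M.V)) ↔
      LinearIndependent N.K (fun i => (toV (x i) : N.V))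
  map_coord : ∀ (n : ℕ) (x : Fin n → dom.V) (y : dom.V) (i : Fin n),
    (toK ⟨coord M.K (fun j => (x j : M.V)) y i,
        dom.coord_mem n _ _ i (fun j => (x j).2) y.2⟩ : N.K) =
      coord N.K (fun j => (toV (x j) : N.V)) (toV y) i
  map_β : ∀ x y : dom.V,
    (toK ⟨M.β x y, dom.β_mem _ x.2 _ y.2⟩ : N.K) = N.β (toV x) (toV y)
  map_form : ∀ (q : dom.Q) (x : dom.V),
    (toK ⟨M.form q x, dom.form_mem _ q.2 _ x.2⟩ : N.K) = N.form (toQ q) (toV x)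
  map_act : ∀ (q : dom.Q) (x : dom.V),
    (toQ ⟨M.act q x, dom.act_mem _ q.2 _ x.2⟩ : N.Q) = N.act (toQ q) (toV x)
  map_diff : ∀ q q' : dom.Q,
    (toV ⟨M.diff q q', dom.diff_mem _ q.2 _ q'.2⟩ : N.V) = N.diff (toQ q) (toQ q')
  map_ω : ∀ (h : w = true) (q : dom.Q),
    (toK ⟨M.ω h q, dom.ω_mem h _ q.2⟩ : N.K) = N.ω h (toQ q)

/-- `g` extends `f`. -/
def PartialIso.Extends {M : QuadGeom.{u} w} {N : QuadGeom.{v} w} (g f : PartialIso M N) : Prop :=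
  (∀ a : f.dom.K, ∃ h : (a : M.K) ∈ g.dom.K, (g.toK ⟨a, h⟩ : N.K) = f.toK a) ∧
  (∀ x : f.dom.V, ∃ h : (x : M.V) ∈ g.dom.V, (g.toV ⟨x, h⟩ : N.V) = f.toV x) ∧
  (∀ q : f.dom.Q, ∃ h : (q : M.Q) ∈ g.dom.Q, (g.toQ ⟨q, h⟩ : N.Q) = f.toQ q)

/-- A nonempty set of isomorphisms between substructures is a back-and-forth system if each of
its members can be extended, within the set, to have any prescribed element of `M` in its domain,
and to have any prescribed element of `N` in its range. -/
def IsBackAndForth {M : QuadGeom.{u} w} {N : QuadGeom.{v} w} (I : Set (PartialIso M N)) : Prop :=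
  I.Nonempty ∧ ∀ f ∈ I,
    ((∀ a : M.K, ∃ g ∈ I, g.Extends f ∧ a ∈ g.dom.K) ∧
      (∀ x : M.V, ∃ g ∈ I, g.Extends f ∧ x ∈ g.dom.V) ∧
      (∀ q : M.Q, ∃ g ∈ I, g.Extends f ∧ q ∈ g.dom.Q)) ∧
    ((∀ b : N.K, ∃ g ∈ I, g.Extends f ∧ b ∈ g.cod.K) ∧
      (∀ y : N.V, ∃ g ∈ I, g.Extends f ∧ y ∈ g.cod.V) ∧
      (∀ q : N.Q, ∃ g ∈ I, g.Extends f ∧ q ∈ g.cod.Q))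

/-! ### First-order logic of fields -/

/-- Truth of a first-order formula in the language of rings, in the ring `K`, under the
assignment `a`. -/
def RingSat (K : Type*) [Ring K] {α : Type*} (φ : Language.ring.Formula α) (a : α → K) : Prop :=
  letI := Ring.compatibleRingOfRing K
  φ.Realize a

/-- Elementary equivalence of rings. -/
def RingElemEquiv (K L : Type*) [Ring K] [Ring L] : Prop :=
  letI := Ring.compatibleRingOfRing K
  letI := Ring.compatibleRingOfRing L
  Language.ring.ElementarilyEquivalent K L

/-- `ℵ₀`-saturation: every set of formulas in one variable, with parameters from a finite tuple,
that is finitely satisfiable in `K` is realized in `K`. -/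
def RingAleph0Saturated (K : Type*) [Ring K] : Prop :=
  ∀ (n : ℕ) (a : Fin n → K) (p : Set (Language.ring.Formula (Fin n ⊕ Unit))),
    (∀ p₀ ⊆ p, p₀.Finite → ∃ c : K, ∀ φ ∈ p₀, RingSat K φ (Sum.elim a fun _ => c)) →
    ∃ c : K, ∀ φ ∈ p, RingSat K φ (Sum.elim a fun _ => c)

/-- Pseudo-finite fields: infinite fields in which only such sentences hold as also hold in some
finite field. -/
def IsPseudoFinite (K : Type*) [Field K] : Prop :=
  Infinite K ∧ ∀ φ : Language.ring.Formula Empty, RingSat K φ Empty.elim →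
    ∃ (F : Type) (_ : Field F), Finite F ∧ RingSat F φ Empty.elim

/-- Pseudo-algebraically closed fields: every (affine) absolutely irreducible variety over `K`
has a `K`-rational point. -/
def IsPAC (K : Type*) [Field K] : Prop :=
  ∀ (n : ℕ) (I : Ideal (MvPolynomial (Fin n) K)),
    (I.map (MvPolynomial.map (algebraMap K (AlgebraicClosure K)))).IsPrime →
    ∃ x : Fin n → K, ∀ p ∈ I, MvPolynomial.eval x p = 0

/-- The field part of `f` is partial elementary: it preserves the truth in `M.K` and `N.K` of all
first-order formulas in the language of rings. -/
def PartialIso.IsElementaryOnField {M : QuadGeom.{u} w} {N : QuadGeom.{v} w}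
    (f : PartialIso M N) : Prop :=
  ∀ (n : ℕ) (φ : Language.ring.Formula (Fin n)) (a : Fin n → f.dom.K),
    RingSat M.K φ (fun i => (a i : M.K)) ↔ RingSat N.K φ (fun i => (f.toK (a i) : N.K))

/-! ### First-order formulas about quadratic geometries -/

mutual

/-- Terms of sort `K` of `L_Q` (`w = false`) or `L_{Q,ω}` (`w = true`), in `k` variables of sort
`K`, `l` variables of sort `V` and `m` variables of sort `Q`. -/
inductive KTerm (w : Bool) (k l m : ℕ) : Type
  | var : Fin k → KTerm w k l m
  | zero : KTerm w k l m
  | one : KTerm w k l m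
  | add : KTerm w k l m → KTerm w k l m → KTerm w k l m
  | neg : KTerm w k l m → KTerm w k l m
  | mul : KTerm w k l m → KTerm w k l m → KTerm w k l m
  | coord (n : ℕ) (x : Fin n → VTerm w k l m) (y : VTerm w k l m) (i : Fin n) : KTerm w k l m
  | β : VTerm w k l m → VTerm w k l m → KTerm w k l m
  | form : QTerm w k l m → VTerm w k l m → KTerm w k l m
  | ω : w = true → QTerm w k l m → KTerm w k l m

/-- Terms of sort `V`. -/
inductive VTerm (w : Bool) (k l m : ℕ) : Type
  | var : Fin l → VTerm w k l m
  | zero : VTerm w k l m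
  | add : VTerm w k l m → VTerm w k l m → VTerm w k l m
  | neg : VTerm w k l m → VTerm w k l m
  | smul : KTerm w k l m → VTerm w k l m → VTerm w k l m
  | diff : QTerm w k l m → QTerm w k l m → VTerm w k l m

/-- Terms of sort `Q`. -/
inductive QTerm (w : Bool) (k l m : ℕ) : Type
  | var : Fin m → QTerm w k l m
  | act : QTerm w k l m → VTerm w k l m → QTerm w k l m

end

/-- First-order formulas of `L_Q` or `L_{Q,ω}` with free variables among `k` variables of sort
`K`, `l` of sort `V` and `m` of sort `Q`.  The atomic formulas are equations in each sort and the
independence predicates `θ_n`.  A quantifier binds the last variable of its sort. -/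
inductive Fml (w : Bool) : ℕ → ℕ → ℕ → Type
  | falsum {k l m : ℕ} : Fml w k l m
  | eqK {k l m : ℕ} : KTerm w k l m → KTerm w k l m → Fml w k l m
  | eqV {k l m : ℕ} : VTerm w k l m → VTerm w k l m → Fml w k l m
  | eqQ {k l m : ℕ} : QTerm w k l m → QTerm w k l m → Fml w k l m
  | indep {k l m : ℕ} (n : ℕ) : (Fin n → VTerm w k l m) → Fml w k l m
  | imp {k l m : ℕ} : Fml w k l m → Fml w k l m → Fml w k l m
  | allK {k l m : ℕ} : Fml w (k + 1) l m → Fml w k l m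
  | allV {k l m : ℕ} : Fml w k (l + 1) m → Fml w k l m
  | allQ {k l m : ℕ} : Fml w k l (m + 1) → Fml w k l m

mutual

/-- The value of a term of sort `K`. -/
def KTerm.eval (M : QuadGeom.{u} w) {k l m : ℕ} (a : Fin k → M.K) (b : Fin l → M.V)
    (c : Fin m → M.Q) : KTerm w k l m → M.K
  | .var i => a i
  | .zero => 0
  | .one => 1
  | .add t t' => t.eval M a b c + t'.eval M a b c
  | .neg t => -t.eval M a b c
  | .mul t t' => t.eval M a b c * t'.eval M a b c
  | .coord _ x y i =>
      QuadraticGeometry.coord M.K (fun j => (x j).eval M a b c) (y.eval M a b c) i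
  | .β t t' => M.β (t.eval M a b c) (t'.eval M a b c)
  | .form t t' => M.form (t.eval M a b c) (t'.eval M a b c)
  | .ω h t => M.ω h (t.eval M a b c)

/-- The value of a term of sort `V`. -/
def VTerm.eval (M : QuadGeom.{u} w) {k l m : ℕ} (a : Fin k → M.K) (b : Fin l → M.V)
    (c : Fin m → M.Q) : VTerm w k l m → M.V
  | .var i => b i
  | .zero => 0
  | .add t t' => t.eval M a b c + t'.eval M a b c
  | .neg t => -t.eval M a b c
  | .smul t t' => t.eval M a b c • t'.eval M a b c
  | .diff t t' => M.diff (t.eval M a b c) (t'.eval M a b c)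

/-- The value of a term of sort `Q`. -/
def QTerm.eval (M : QuadGeom.{u} w) {k l m : ℕ} (a : Fin k → M.K) (b : Fin l → M.V)
    (c : Fin m → M.Q) : QTerm w k l m → M.Q
  | .var i => c i
  | .act t t' => M.act (t.eval M a b c) (t'.eval M a b c)

end

/-- Truth of a formula in `M` under an assignment of the free variables. -/
def Fml.Sat (M : QuadGeom.{u} w) : {k l m : ℕ} → Fml w k l m →
    (Fin k → M.K) → (Fin l → M.V) → (Fin m → M.Q) → Prop
  | _, _, _, .falsum, _, _, _ => False
  | _, _, _, .eqK t t', a, b, c => t.eval M a b c = t'.eval M a b c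
  | _, _, _, .eqV t t', a, b, c => t.eval M a b c = t'.eval M a b c
  | _, _, _, .eqQ t t', a, b, c => t.eval M a b c = t'.eval M a b c
  | _, _, _, .indep _ x, a, b, c => LinearIndependent M.K (fun j => (x j).eval M a b c)
  | _, _, _, .imp φ ψ, a, b, c => φ.Sat M a b c → ψ.Sat M a b c
  | _, _, _, .allK φ, a, b, c => ∀ z : M.K, φ.Sat M (Fin.snoc (α := fun _ => M.K) a z) b c
  | _, _, _, .allV φ, a, b, c => ∀ z : M.V, φ.Sat M a (Fin.snoc (α := fun _ => M.V) b z) c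
  | _, _, _, .allQ φ, a, b, c => ∀ z : M.Q, φ.Sat M a b (Fin.snoc (α := fun _ => M.Q) c z)

/-- All quantifiers of the formula range over the field sort. -/
def Fml.OnlyFieldQuantifiers : {k l m : ℕ} → Fml w k l m → Prop
  | _, _, _, .falsum => True
  | _, _, _, .eqK _ _ => True
  | _, _, _, .eqV _ _ => True
  | _, _, _, .eqQ _ _ => True
  | _, _, _, .indep _ _ => True
  | _, _, _, .imp φ ψ => φ.OnlyFieldQuantifiers ∧ ψ.OnlyFieldQuantifiers
  | _, _, _, .allK φ => φ.OnlyFieldQuantifiers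
  | _, _, _, .allV _ => False
  | _, _, _, .allQ _ => False

/-- The theory whose models are the quadratic geometries satisfying `T` eliminates quantifiers
down to the field sort: modulo the theory, every formula is equivalent to one, in the same free
variables, all of whose quantifiers range over the field sort. -/
def EliminatesToField (T : QuadGeom.{u} w → Prop) : Prop :=
  ∀ (k l m : ℕ) (φ : Fml w k l m), ∃ ψ : Fml w k l m, ψ.OnlyFieldQuantifiers ∧
    ∀ M : QuadGeom.{u} w, T M → ∀ (a : Fin k → M.K) (b : Fin l → M.V) (c : Fin m → M.Q),
      φ.Sat M a b c ↔ ψ.Sat M a b c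

/-! ### The theories -/

/-- The vector space is infinite-dimensional. -/
def QuadGeom.IsInfiniteDimensional (M : QuadGeom.{u} w) : Prop :=
  ¬ FiniteDimensional M.K M.V

/-- Models of `T_Q`: quadratic geometries with at least one quadratic form, of infinite dimension
and over an algebraically closed field. -/
def IsModelTQ (M : QuadGeom.{u} false) : Prop :=
  M.IsInfiniteDimensional ∧ Nonempty M.Q ∧ IsAlgClosed M.K

/-- Models of `T_{Q,ω}`: quadratic geometries with Witt defect, with at least one quadratic form
and of infinite dimension, over a perfect pseudo-algebraically closed field whose absolute Galois
group is isomorphic, as a topological group, to the additive group of 2-adic integers. -/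
def IsModelTQω (M : QuadGeom.{u} true) : Prop :=
  M.IsInfiniteDimensional ∧ Nonempty M.Q ∧ PerfectField M.K ∧ IsPAC M.K ∧
    Nonempty (Field.absoluteGaloisGroup M.K ≃ₜ* Multiplicative ℤ_[2])

end

end QuadraticGeometry

open QuadraticGeometry

/-! Both parts of the theorem come from a single translation. A *frame* is a finite linearly
independent family `e` of vectors together with one quadratic form `q` of the geometry. Relative to
a frame, a tuple of scalars, of vectors in the span of `e`, and of forms that are translates of `q`
by vectors of this span is described by finitely many scalars (`FrameVar`, `Represents`): the
scalars themselves, the coefficients of the vectors, the coefficients of the translating vectors,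
the Gram matrix of `e`, the values `q (e i)` and the Witt defect of `q`. The values of terms at the
tuple are given by polynomial expressions and coordinates in these scalars, so that atomic formulas
about the tuple become formulas of the language of rings (`KTerm.graph`, `VTerm.graph`,
`QTerm.graph`).

The translation extends to quantifiers over vectors and over forms because, in infinite dimension
and over a field in which every element is a square (`QuadGeom.IsRich`), all one-point extensions
of a frame are realized: nondegeneracy supplies a vector with prescribed products with `e`, there
is room to correct it by a vector that gives it a prescribed value under `q` and to choose it
outside the span (`QuadGeom.IsRich.exists_notMem_span`), and translating `q` by vectors whose
products with `e` are the appropriate square roots changes the values `q (e i)` arbitrarily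
(`QuadGeom.IsRich.exists_form_eq`). A quantifier over the sort of vectors or of forms thus turns
into quantifiers over coefficients and over products and values, that is, over scalars
(`Fml.toRing`, `Fml.sat_iff_ringSat`). No compactness argument is involved.

*Elimination of quantifiers.* Every tuple has a frame consisting of some of its vectors and of
differences of its forms, and the describing scalars are values of terms at the tuple; substituting
these terms into the ring formula gives a formula with quantifiers over the field sort only
(`eliminatesToField_of_isRich`). If the tuple contains no form, a form with prescribed values and
prescribed Witt defect is added to the frame, which is possible once the value of the Witt defect
that is used is attained in all models.

*Back-and-forth.* Two tuples with frames whose describing scalars have the same type in the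
language of rings satisfy the same formulas, so that the substructures they generate are isomorphic
(`PartialIso.ofSameType`). Saturation of the fields extends such a pair of describing tuples by the
scalars of one more element, and the realization lemmas turn these scalars into an element
(`isBackAndForth_of_isRich`).

It remains to look at the classes of fields. The forms `q` and `q` translated by `x` have the same
Witt defect if and only if `q x` has the shape `y ^ 2 - y`. In a pseudo-finite field, and in a
perfect field whose absolute Galois group is the group of 2-adic integers, some element is not of
this shape, so that the value `0` of the Witt defect is attained
(`IsPseudoFinite.exists_ne_sq_sub`, `exists_ne_sq_sub_of_galois`). Over an algebraically closed
field the Witt defect is constant. Finally, between `ℵ₀`-saturated algebraically closed fields any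
isomorphism of subrings is elementary: tuples satisfying the same polynomial equations correspond
in a back-and-forth system, by extending an embedding over an algebraic element, or by saturation
if the new element is transcendental (`SameEquations.exists_unit`). -/

namespace QuadraticGeometry

open FirstOrder
open FirstOrder.Language (Term Formula BoundedFormula)

noncomputable section

variable {w : Bool}

/-! ### Realizing prescribed values -/

section LinearAlgebra

variable {K V : Type*} [Field K] [AddCommGroup V] [Module K V]

/-- Over a nondegenerate form every functional on a finite-dimensional subspace is represented by
a vector. -/
theorem exists_forall_bilin_eq {β : LinearMap.BilinForm K V} (hβ : β.Nondegenerate)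
    (U : Submodule K V) [FiniteDimensional K U] (l : Module.Dual K U) :
    ∃ x, ∀ y : U, β x y = l y := by
  let F : V →ₗ[K] Module.Dual K U := (Submodule.dualRestrict U).comp β
  have hF : LinearMap.range F = ⊤ := by
    have h0 : (LinearMap.range F).dualCoannihilator = ⊥ := by
      rw [eq_bot_iff]
      intro y hy
      rw [Submodule.mem_dualCoannihilator] at hy
      have h1 : ∀ x, β x y = 0 := fun x => hy (F x) ⟨x, rfl⟩
      have h2 : (y : V) = 0 := hβ.2 _ h1
      simpa using h2
    have h1 := Subspace.dualCoannihilator_dualAnnihilator_eq (W := LinearMap.range F)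
    rw [h0, Submodule.dualAnnihilator_bot] at h1
    exact h1.symm
  obtain ⟨x, hx⟩ : l ∈ LinearMap.range F := hF ▸ Submodule.mem_top
  exact ⟨x, fun y => by rw [← hx]; rfl⟩

theorem exists_bilin_eq {β : LinearMap.BilinForm K V} (hβ : β.Nondegenerate)
    {ι : Type*} [Finite ι] {e : ι → V} (he : LinearIndependent K e) (α : ι → K) :
    ∃ x, ∀ i, β x (e i) = α i := by
  have := FiniteDimensional.span_of_finite K (Set.finite_range e)
  obtain ⟨x, hx⟩ := exists_forall_bilin_eq hβ (Submodule.span K (Set.range e))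
    ((Module.Basis.span he).constr K α)
  refine ⟨x, fun i => ?_⟩
  have := hx (Module.Basis.span he i)
  rwa [Module.Basis.constr_basis, Module.Basis.span_apply] at this

/-- In infinite dimension the orthogonal complement of a finite-dimensional subspace `U` is not
contained in `U`, since it has finite codimension. -/
theorem exists_notMem_bilin_eq_zero {β : LinearMap.BilinForm K V}
    (hV : ¬ FiniteDimensional K V) (U : Submodule K V) [FiniteDimensional K U] :
    ∃ x ∉ U, ∀ y ∈ U, β x y = 0 := by
  by_contra! h
  let F : V →ₗ[K] Module.Dual K U := (Submodule.dualRestrict U).comp β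
  have hker : LinearMap.ker F ≤ U := by
    intro x hx
    by_contra hxU
    obtain ⟨y, hy, hne⟩ := h x hxU
    exact hne (LinearMap.congr_fun (LinearMap.mem_ker.1 hx) ⟨y, hy⟩)
  have : FiniteDimensional K (LinearMap.ker F) := Submodule.finiteDimensional_of_le hker
  have : Module.Finite K (V ⧸ LinearMap.ker F) :=
    Module.Finite.equiv (LinearMap.quotKerEquivRange F).symm
  exact hV (Module.Finite.of_submodule_quotient (LinearMap.ker F))

end LinearAlgebra

namespace QuadGeom

variable (M : QuadGeom.{u} w)

theorem form_add (q : M.Q) (x y : M.V) :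
    M.form q (x + y) = M.form q x + M.form q y + M.β x y := by
  rw [M.form_polar q]; ring

theorem form_smul (q : M.Q) (a : M.K) (x : M.V) : M.form q (a • x) = a * a * M.form q x :=
  QuadraticMap.map_smul ..

theorem β_self (x : M.V) : M.β x x = 0 := M.β_alt x

theorem β_symm (x y : M.V) : M.β x y = M.β y x := by
  rw [← LinearMap.IsAlt.neg M.β_alt y x, CharTwo.neg_eq]

theorem diff_act (q : M.Q) (x : M.V) : M.diff (M.act q x) q = x := by
  obtain ⟨y, -, hy⟩ := M.act_regular q (M.act q x)
  exact (hy _ (M.act_diff _ _)).trans (hy x rfl).symm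

/-- The value of the Witt defect at `q`, with the value `0` when the Witt defect is not part of
the language. -/
def wittValue (q : M.Q) : M.K :=
  if h : w = true then M.ω h q else 0

variable {M}

theorem wittValue_eq (h : w = true) (q : M.Q) : M.wittValue q = M.ω h q := dif_pos h

theorem wittValue_zero_or_one (q : M.Q) : M.wittValue q = 0 ∨ M.wittValue q = 1 := by
  by_cases h : w = true
  · rw [wittValue_eq h]; exact M.ω_zero_or_one h q
  · left; exact dif_neg h

/-- Translating a form by `x` changes its Witt defect by the class of `q x` modulo elements of
the shape `y ^ 2 - y`. -/
theorem ω_act_eq_iff (h : w = true) (q : M.Q) (x : M.V) :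
    M.ω h (M.act q x) = M.ω h q ↔ ∃ y : M.K, M.form q x = y ^ 2 - y := by
  rw [M.ω_eq_iff, M.diff_act, M.form_act, M.β_self]
  simp

/-- The scalars have square roots and the space is infinite-dimensional: what the geometric part of
the argument uses. -/
structure IsRich (M : QuadGeom.{u} w) : Prop where
  infinite : M.IsInfiniteDimensional
  sqrt : ∀ x : M.K, ∃ y, y ^ 2 = x

/-- A vector with prescribed products with an independent family and a prescribed value under `q`.
Adding to a vector with the right products a vector orthogonal to everything in sight changes its
value only. -/
theorem IsRich.exists_bilin_form_eq (hM : M.IsRich) (q : M.Q) {ι : Type*} [Finite ι] {e : ι → M.V}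
    (he : LinearIndependent M.K e) (α : ι → M.K) (γ : M.K) :
    ∃ x, (∀ i, M.β x (e i) = α i) ∧ M.form q x = γ := by
  obtain ⟨v, hv⟩ := exists_bilin_eq M.β_nondegenerate he α
  let U := Submodule.span M.K (Set.range e ∪ {v})
  have : FiniteDimensional M.K U := FiniteDimensional.span_of_finite M.K
    ((Set.finite_range e).union (Set.finite_singleton v))
  have heU : ∀ i, e i ∈ U := fun i => Submodule.subset_span (Or.inl ⟨i, rfl⟩)
  have hvU : v ∈ U := Submodule.subset_span (Or.inr rfl)
  -- It suffices to correct `v` by a vector orthogonal to `U` on which `q` takes a given value.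
  suffices ∃ x, (∀ y ∈ U, M.β x y = 0) ∧ M.form q x = γ - M.form q v by
    obtain ⟨x, hx, hq⟩ := this
    refine ⟨x + v, fun i => ?_, ?_⟩
    · rw [map_add, LinearMap.add_apply, hx _ (heU i), hv, zero_add]
    · rw [M.form_add, hq, hx v hvU]; ring
  generalize γ - M.form q v = δ
  obtain ⟨x, hxU, hx⟩ := exists_notMem_bilin_eq_zero (β := M.β) hM.infinite U
  by_cases hqx : M.form q x = 0
  · -- For singular `x`, a hyperbolic partner `y` of `x` in the complement of `U` takes care of `δ`.
    have hb := (Module.Basis.ofVectorSpace M.K U).linearIndependent.map' U.subtype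
      (Submodule.ker_subtype U)
    have hx' : x ∉ Submodule.span M.K
        (Set.range (U.subtype ∘ Module.Basis.ofVectorSpace M.K U)) := by
      rw [Set.range_comp, Submodule.span_image, Module.Basis.span_eq]
      simpa using hxU
    obtain ⟨y, hy⟩ := exists_bilin_eq M.β_nondegenerate (linearIndependent_option'.2 ⟨hb, hx'⟩)
      (fun o => o.elim 1 fun _ => 0)
    have hyU : ∀ z ∈ U, M.β y z = 0 := by
      intro z hz
      have hle : U ≤ LinearMap.ker (M.β y) := by
        conv_lhs => rw [← Submodule.map_subtype_top U,
          ← (Module.Basis.ofVectorSpace M.K U).span_eq, ← Submodule.span_image, ← Set.range_comp]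
        rw [Submodule.span_le]
        rintro _ ⟨i, rfl⟩
        exact hy (some i)
      exact hle hz
    have hyx : M.β y x = 1 := hy none
    refine ⟨y + (δ - M.form q y) • x, fun z hz => ?_, ?_⟩
    · simp [hx z hz, hyU z hz]
    · rw [M.form_add, M.form_smul, hqx, map_smul, hyx]
      simp
  · obtain ⟨c, hc⟩ := hM.sqrt (δ / M.form q x)
    refine ⟨c • x, fun y hy => by simp [hx y hy], ?_⟩
    rw [M.form_smul, ← pow_two, hc, div_mul_cancel₀ _ hqx]

/-- Every one-point extension of the data of an independent family is realized by a vector outside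
its span. -/
theorem IsRich.exists_notMem_span (hM : M.IsRich) (q : M.Q) {ι : Type*} [Finite ι] {e : ι → M.V}
    (he : LinearIndependent M.K e) (α : ι → M.K) (γ : M.K) :
    ∃ x ∉ Submodule.span M.K (Set.range e), (∀ i, M.β x (e i) = α i) ∧ M.form q x = γ := by
  have := FiniteDimensional.span_of_finite M.K (Set.finite_range e)
  obtain ⟨u, huU, hu⟩ := exists_notMem_bilin_eq_zero (β := M.β) hM.infinite
    (Submodule.span M.K (Set.range e))
  -- The vector `u` is orthogonal to the span of `e`, so no `x` in this span has `β x u = 1`.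
  obtain ⟨x, hx, hq⟩ := hM.exists_bilin_form_eq q (linearIndependent_option'.2 ⟨he, huU⟩)
    (fun o => o.elim 1 α) γ
  refine ⟨x, fun hxU => ?_, fun i => hx (some i), hq⟩
  have h1 : M.β x u = 1 := hx none
  rw [M.β_symm, hu x hxU] at h1
  exact zero_ne_one h1

/-- A quadratic form with the given values on an independent family, of the same Witt defect as a
given form. -/
theorem IsRich.exists_form_eq (hM : M.IsRich) (q : M.Q) {ι : Type*} [Finite ι] {e : ι → M.V}
    (he : LinearIndependent M.K e) (γ : ι → M.K) :
    ∃ q', (∀ i, M.form q' (e i) = γ i) ∧ M.wittValue q' = M.wittValue q := by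
  choose r hr using fun i => hM.sqrt (γ i - M.form q (e i))
  obtain ⟨x, hx, hq⟩ := hM.exists_bilin_form_eq q he r 0
  refine ⟨M.act q x, fun i => ?_, ?_⟩
  · rw [M.form_act, hx, hr]; ring
  · by_cases h : w = true
    · rw [wittValue_eq h, wittValue_eq h, ω_act_eq_iff]
      exact ⟨0, by simpa using hq⟩
    · simp [wittValue, h]

/-- If some scalar does not have the shape `y ^ 2 - y`, both values of the Witt defect are attained:
translating by a vector on which `q` takes such a value changes the Witt defect. -/
theorem IsRich.exists_wittValue_eq (hM : M.IsRich) (hQ : Nonempty M.Q)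
    (hK : ∃ c : M.K, ∀ y, c ≠ y ^ 2 - y) : ∃ q, M.wittValue q = 0 := by
  obtain ⟨q⟩ := hQ
  by_cases h : w = true
  · obtain ⟨c, hc⟩ := hK
    obtain ⟨x, -, hx⟩ := hM.exists_bilin_form_eq q (e := (Empty.elim : Empty → M.V))
      linearIndependent_empty_type Empty.elim c
    have hne : M.ω h (M.act q x) ≠ M.ω h q := by
      rw [Ne, ω_act_eq_iff, hx]
      rintro ⟨y, hy⟩
      exact hc y hy
    rcases M.ω_zero_or_one h q with h0 | h1
    · exact ⟨q, by rwa [wittValue_eq h]⟩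
    · refine ⟨M.act q x, ?_⟩
      rw [wittValue_eq h]
      exact (M.ω_zero_or_one h _).resolve_right (h1 ▸ hne)
  · exact ⟨q, dif_neg h⟩

end QuadGeom

/-! ### Frames and the scalars that describe tuples relative to them -/

/-- Names for the scalars that describe, relative to a family of vectors `e i` (`i : ι`) and a
quadratic form `q`, a tuple of `k` scalars, `l` vectors and `m` quadratic forms. -/
inductive FrameVar (ι : Type) (k l m : ℕ) : Type
  /-- The `i`-th scalar of the tuple. -/
  | scal (i : Fin k)
  /-- The coefficient at `e i` of the `j`-th vector of the tuple. -/
  | vec (j : Fin l) (i : ι)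
  /-- The coefficient at `e i` of the vector that translates `q` to the `j`-th form of the tuple. -/
  | frm (j : Fin m) (i : ι)
  /-- The value `β (e i) (e j)`. -/
  | gram (i j : ι)
  /-- The value `q (e i)`. -/
  | val (i : ι)
  /-- The Witt defect of `q`. -/
  | witt

namespace FrameVar

variable {ι : Type} {k l m : ℕ} {X Y : Type*}

instance [Finite ι] : Finite (FrameVar ι k l m) :=
  Finite.of_surjective
    (α := Fin k ⊕ (Fin l × ι) ⊕ (Fin m × ι) ⊕ (ι × ι) ⊕ ι ⊕ Unit)
    (fun
      | .inl i => scal i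
      | .inr (.inl p) => vec p.1 p.2
      | .inr (.inr (.inl p)) => frm p.1 p.2
      | .inr (.inr (.inr (.inl p))) => gram p.1 p.2
      | .inr (.inr (.inr (.inr (.inl i)))) => val i
      | .inr (.inr (.inr (.inr (.inr _)))) => witt)
    (fun
      | scal i => ⟨.inl i, rfl⟩
      | vec j i => ⟨.inr (.inl (j, i)), rfl⟩
      | frm j i => ⟨.inr (.inr (.inl (j, i))), rfl⟩
      | gram i j => ⟨.inr (.inr (.inr (.inl (i, j)))), rfl⟩
      | val i => ⟨.inr (.inr (.inr (.inr (.inl i)))), rfl⟩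
      | witt => ⟨.inr (.inr (.inr (.inr (.inr ())))), rfl⟩)

/-- Append a scalar to the tuple. -/
def pushK (D : FrameVar ι k l m → X) (z : X) : FrameVar ι (k + 1) l m → X
  | scal i => Fin.snoc (α := fun _ => X) (fun i => D (scal i)) z i
  | vec j i => D (vec j i)
  | frm j i => D (frm j i)
  | gram i j => D (gram i j)
  | val i => D (val i)
  | witt => D witt

/-- Append to the tuple a vector with coefficients `z`. -/
def pushV (D : FrameVar ι k l m → X) (z : ι → X) : FrameVar ι k (l + 1) m → X
  | scal i => D (scal i)
  | vec j i => Fin.snoc (α := fun _ => ι → X) (fun j i => D (vec j i)) z j i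
  | frm j i => D (frm j i)
  | gram i j => D (gram i j)
  | val i => D (val i)
  | witt => D witt

/-- Append to the tuple the translate of `q` by a vector with coefficients `z`. -/
def pushQ (D : FrameVar ι k l m → X) (z : ι → X) : FrameVar ι k l (m + 1) → X
  | scal i => D (scal i)
  | vec j i => D (vec j i)
  | frm j i => Fin.snoc (α := fun _ => ι → X) (fun j i => D (frm j i)) z j i
  | gram i j => D (gram i j)
  | val i => D (val i)
  | witt => D witt

/-- Add to the frame a vector `x` with `β x (e i) = α i` and `q x = γ`. -/
def pushFrame [Zero X] (D : FrameVar ι k l m → X) (α : ι → X) (γ : X) :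
    FrameVar (Option ι) k l m → X
  | scal i => D (scal i)
  | vec _ none => 0
  | vec j (some i) => D (vec j i)
  | frm _ none => 0
  | frm j (some i) => D (frm j i)
  | gram none none => 0
  | gram none (some j) => α j
  | gram (some i) none => α i
  | gram (some i) (some j) => D (gram i j)
  | val none => γ
  | val (some i) => D (val i)
  | witt => D witt

/-- The coefficients of the vector last added to a frame. -/
def newRow (ι : Type) (X : Type*) [Zero X] [One X] : Option ι → X
  | none => 1
  | some _ => 0

theorem map_pushK (f : X → Y) (D : FrameVar ι k l m → X) (z : X) :
    (fun y => f (pushK D z y)) = pushK (fun y => f (D y)) (f z) := by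
  funext y
  cases y <;> try rfl
  rename_i i
  refine Fin.lastCases ?_ (fun i => ?_) i <;> simp [pushK]

theorem map_pushV (f : X → Y) (D : FrameVar ι k l m → X) (z : ι → X) :
    (fun y => f (pushV D z y)) = pushV (fun y => f (D y)) (fun i => f (z i)) := by
  funext y
  cases y <;> try rfl
  rename_i j i
  refine Fin.lastCases ?_ (fun j => ?_) j <;> simp [pushV]

theorem map_pushQ (f : X → Y) (D : FrameVar ι k l m → X) (z : ι → X) :
    (fun y => f (pushQ D z y)) = pushQ (fun y => f (D y)) (fun i => f (z i)) := by
  funext y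
  cases y <;> try rfl
  rename_i j i
  refine Fin.lastCases ?_ (fun j => ?_) j <;> simp [pushQ]

theorem map_pushFrame [Zero X] [Zero Y] (f : X → Y) (hf : f 0 = 0) (D : FrameVar ι k l m → X)
    (α : ι → X) (γ : X) :
    (fun y => f (pushFrame D α γ y)) =
      pushFrame (fun y => f (D y)) (fun i => f (α i)) (f γ) := by
  funext y
  rcases y with _ | ⟨_, _ | _⟩ | ⟨_, _ | _⟩ | ⟨_ | _, _ | _⟩ | ⟨_ | _⟩ | _ <;>
    first | rfl | exact hf

theorem map_newRow [Zero X] [Zero Y] [One X] [One Y] (f : X → Y) (hf : f 0 = 0) (hf' : f 1 = 1) :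
    (fun y => f (newRow ι X y)) = newRow ι Y := by
  funext y
  cases y
  exacts [hf', hf]

end FrameVar

open FrameVar

/-- The linearly independent family `e` and the form `q` are a frame relative to which the tuple
`a, b, c` is described by the scalars `D`. -/
structure Represents (M : QuadGeom.{u} w) {ι : Type} [Fintype ι] {k l m : ℕ} (e : ι → M.V)
    (q : M.Q) (D : FrameVar ι k l m → M.K) (a : Fin k → M.K) (b : Fin l → M.V)
    (c : Fin m → M.Q) : Prop where
  indep : LinearIndependent M.K e
  gram : ∀ i j, M.β (e i) (e j) = D (.gram i j)
  val : ∀ i, M.form q (e i) = D (.val i)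
  witt : M.wittValue q = D .witt
  scal : ∀ i, a i = D (.scal i)
  vec : ∀ j, b j = ∑ i, D (.vec j i) • e i
  frm : ∀ j, c j = M.act q (∑ i, D (.frm j i) • e i)

namespace Represents

variable {M : QuadGeom.{u} w} {ι : Type} [Fintype ι] {k l m : ℕ} {e : ι → M.V}
  {q : M.Q} {D : FrameVar ι k l m → M.K} {a : Fin k → M.K} {b : Fin l → M.V} {c : Fin m → M.Q}

theorem pushK (h : Represents M e q D a b c) (z : M.K) :
    Represents M e q (pushK D z) (Fin.snoc (α := fun _ => M.K) a z) b c where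
  __ := h
  scal i := by
    refine Fin.lastCases ?_ (fun i => ?_) i
    · simp [FrameVar.pushK]
    · simp [FrameVar.pushK, h.scal]

theorem pushV (h : Represents M e q D a b c) (z : ι → M.K) :
    Represents M e q (pushV D z) a (Fin.snoc (α := fun _ => M.V) b (∑ i, z i • e i)) c where
  __ := h
  vec j := by
    refine Fin.lastCases ?_ (fun j => ?_) j
    · simp [FrameVar.pushV]
    · simp [FrameVar.pushV, h.vec]

theorem pushQ (h : Represents M e q D a b c) (z : ι → M.K) :
    Represents M e q (pushQ D z) a b
      (Fin.snoc (α := fun _ => M.Q) c (M.act q (∑ i, z i • e i))) where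
  __ := h
  frm j := by
    refine Fin.lastCases ?_ (fun j => ?_) j
    · simp [FrameVar.pushQ]
    · simp [FrameVar.pushQ, h.frm]

theorem pushFrame (h : Represents M e q D a b c) {x : M.V}
    (hx : x ∉ Submodule.span M.K (Set.range e)) {α : ι → M.K} {γ : M.K}
    (hα : ∀ i, M.β x (e i) = α i) (hγ : M.form q x = γ) :
    Represents M (fun o : Option ι => o.elim x e) q (pushFrame D α γ) a b c where
  indep := by
    have := linearIndependent_option'.2 ⟨h.indep, hx⟩
    convert this using 2 with o
    cases o <;> rfl
  gram i j := by
    rcases i with _ | i <;> rcases j with _ | j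
    · exact M.β_self x
    · exact hα j
    · exact (M.β_symm _ _).trans (hα i)
    · exact h.gram i j
  val i := by
    rcases i with _ | i
    exacts [hγ, h.val i]
  witt := h.witt
  scal := h.scal
  vec j := by simp [Fintype.sum_option, FrameVar.pushFrame, h.vec]
  frm j := by simp [Fintype.sum_option, FrameVar.pushFrame, h.frm]

end Represents

theorem sum_newRow_smul {K V : Type*} [Field K] [AddCommGroup V] [Module K V] {ι : Type}
    [Fintype ι] (e : ι → V) (x : V) :
    ∑ o, newRow ι K o • (fun o : Option ι => o.elim x e) o = x := by
  simp [Fintype.sum_option, newRow]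

/-! ### Coordinates -/

section Coord

variable {K V : Type*} [Field K] [AddCommGroup V] [Module K V] {n : ℕ}

theorem coord_eq_of_eq_sum {x : Fin n → V} (hx : LinearIndependent K x) {y : V} {c : Fin n → K}
    (hy : y = ∑ j, c j • x j) (i : Fin n) : coord K x y i = c i := by
  have hmem : y ∈ Submodule.span K (Set.range x) :=
    hy ▸ Submodule.sum_mem _ fun j _ => Submodule.smul_mem _ _ (Submodule.subset_span ⟨j, rfl⟩)
  rw [coord, dif_pos ⟨hx, hmem⟩, hx.repr_eq (l := Finsupp.equivFunOnFinite.symm c)]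
  · rfl
  · refine Eq.trans ?_ hy.symm
    simp [Finsupp.linearCombination_apply, Finsupp.sum_fintype]

theorem sum_coord_smul {x : Fin n → V} (hx : LinearIndependent K x) {y : V}
    (hy : y ∈ Submodule.span K (Set.range x)) :
    ∑ i, coord K x y i • x i = y := by
  obtain ⟨c, rfl⟩ := (Submodule.mem_span_range_iff_exists_fun K).1 hy
  exact Finset.sum_congr rfl fun i _ => by rw [coord_eq_of_eq_sum hx rfl]

theorem coord_eq_zero {x : Fin n → V} {y : V}
    (h : ¬ (LinearIndependent K x ∧ y ∈ Submodule.span K (Set.range x))) (i : Fin n) :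
    coord K x y i = 0 :=
  dif_neg h

end Coord

/-! ### Formulas for the values of terms -/

/-- Terms of the language of rings. -/
abbrev RTerm (α : Type*) := Language.ring.Term α

/-- Formulas of the language of rings. -/
abbrev RFml (α : Type*) := Language.ring.Formula α

namespace RTerm

variable {α β ι : Type}

/-- Regard a term as a term in more variables. -/
def up (β : Type) (t : RTerm α) : RTerm (α ⊕ β) := Term.relabel Sum.inl t

/-- One of the additional variables, as a term. -/
def new (α : Type) (i : β) : RTerm (α ⊕ β) := Term.var (Sum.inr i)

/-- The sum of the terms `t i`, for `i` in a list. -/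
def listSum (t : ι → RTerm α) : List ι → RTerm α
  | [] => 0
  | i :: s => t i + listSum t s

/-- The sum of the terms `t i`, for `i` in a finite type. -/
def sum [Fintype ι] (t : ι → RTerm α) : RTerm α := listSum t Finset.univ.toList

/-- The value of the quadratic form with values `D (val i)` and polar values `D (gram i j)` at the
vector with coefficients `x i`, where `i` runs through a list. -/
def listForm {k l m : ℕ} (D : FrameVar ι k l m → RTerm α) (x : ι → RTerm α) : List ι → RTerm α
  | [] => 0
  | i :: s => x i * x i * D (val i) + listForm D x s +
      listSum (fun j => x i * x j * D (gram i j)) s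

/-- The value of the bilinear form of a frame at two vectors given by coefficients. -/
def bilin [Fintype ι] {k l m : ℕ} (D : FrameVar ι k l m → RTerm α) (x y : ι → RTerm α) :
    RTerm α :=
  sum fun i => sum fun j => x i * y j * D (gram i j)

/-- The value of the quadratic form of a frame at a vector given by coefficients. -/
def quad [Fintype ι] {k l m : ℕ} (D : FrameVar ι k l m → RTerm α) (x : ι → RTerm α) : RTerm α :=
  listForm D x Finset.univ.toList

variable {K : Type*} [Field K] [Ring.CompatibleRing K]

@[simp]
theorem realize_up (t : RTerm α) (v : α → K) (x : β → K) :
    (up β t).realize (Sum.elim v x) = t.realize v := by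
  simp [up]

@[simp]
theorem realize_new (i : β) (v : α → K) (x : β → K) :
    (new α i).realize (Sum.elim v x) = x i := by
  simp [new]

theorem realize_listSum (t : ι → RTerm α) (v : α → K) (s : List ι) :
    (listSum t s).realize v = (s.map fun i => (t i).realize v).sum := by
  induction s with
  | nil => simp [listSum]
  | cons i s ih => simp [listSum, ih]

@[simp]
theorem realize_sum [Fintype ι] (t : ι → RTerm α) (v : α → K) :
    (sum t).realize v = ∑ i, (t i).realize v := by
  rw [sum, realize_listSum, Finset.sum_map_toList]

end RTerm

namespace RFml

variable {α ι : Type} {n : ℕ}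

/-- Linear independence of `n` vectors given by coefficients. -/
def indep [Fintype ι] (x : Fin n → ι → RTerm α) : RFml α :=
  Formula.iAlls (Fin n)
    ((Formula.iInf fun i => Term.equal
        (RTerm.sum fun j => RTerm.new α j * RTerm.up _ (x j i)) 0) ⟹
      Formula.iInf fun j => Term.equal (RTerm.new α j) 0)

/-- The vector `y` is the linear combination of the vectors `x j` with coefficients `c j`. -/
def combination (x : Fin n → ι → RTerm α) (y : ι → RTerm α)
    [Finite ι] (c : Fin n → RTerm α) : RFml α :=
  Formula.iInf fun i => Term.equal (y i) (RTerm.sum fun j => c j * x j i)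

/-- The scalar `z` is the value `π_{n,i}(x; y)`, for vectors given by coefficients. -/
def coord [Fintype ι] (x : Fin n → ι → RTerm α) (y : ι → RTerm α) (i : Fin n) (z : RTerm α) :
    RFml α :=
  (indep x ⊓ Formula.iExs (Fin n)
      (combination (fun j i => (x j i).up _) (fun i => (y i).up _) (RTerm.new α) ⊓
        Term.equal (z.up _) (RTerm.new α i))) ⊔
    (∼(indep x ⊓ Formula.iExs (Fin n)
      (combination (fun j i => (x j i).up _) (fun i => (y i).up _) (RTerm.new α))) ⊓
        Term.equal z 0)

/-- The scalar `t` is of the form `y ^ 2 - y`. -/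
def artinSchreier (t : RTerm α) : RFml α :=
  Formula.iExs Unit
    (Term.equal (t.up Unit) (RTerm.new α () * RTerm.new α () + -RTerm.new α ()))

variable {K V : Type*} [Field K] [Ring.CompatibleRing K] [AddCommGroup V] [Module K V]

theorem realize_indep [Fintype ι] {e : ι → V} (he : LinearIndependent K e)
    (x : Fin n → ι → RTerm α) (v : α → K) :
    (indep x).Realize v ↔ LinearIndependent K fun j => ∑ i, (x j i).realize v • e i := by
  rw [Fintype.linearIndependent_iff]
  have h : ∀ c : Fin n → K, ∑ j, c j • ∑ i, (x j i).realize v • e i = 0 ↔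
      ∀ i, ∑ j, c j * (x j i).realize v = 0 := by
    intro c
    simp only [Finset.smul_sum, smul_smul]
    rw [Finset.sum_comm]
    simp only [← Finset.sum_smul]
    exact ⟨fun h => Fintype.linearIndependent_iff.1 he _ h, fun h => by simp [h]⟩
  simp [indep, h, Formula.realize_iAlls, Formula.realize_iInf]

theorem realize_combination [Fintype ι] {e : ι → V} (he : LinearIndependent K e)
    (x : Fin n → ι → RTerm α) (y : ι → RTerm α) (c : Fin n → RTerm α) (v : α → K) :
    (combination x y c).Realize v ↔ ∑ i, (y i).realize v • e i =
      ∑ j, (c j).realize v • ∑ i, (x j i).realize v • e i := by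
  simp only [Finset.smul_sum, smul_smul]
  rw [Finset.sum_comm]
  simp only [← Finset.sum_smul]
  simp only [combination, Formula.realize_iInf, Formula.realize_equal,
    RTerm.realize_sum, Ring.realize_mul]
  constructor
  · intro h; simp [h]
  · intro h i
    rw [← sub_eq_zero] at h ⊢
    rw [← Finset.sum_sub_distrib] at h
    simp only [← sub_smul] at h
    exact Fintype.linearIndependent_iff.1 he _ h i

theorem realize_coord [Fintype ι] {e : ι → V} (he : LinearIndependent K e)
    (x : Fin n → ι → RTerm α) (y : ι → RTerm α) (i : Fin n) (z : RTerm α) (v : α → K) :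
    (coord x y i z).Realize v ↔ z.realize v = QuadraticGeometry.coord K
      (fun j => ∑ i, (x j i).realize v • e i) (∑ i, (y i).realize v • e i) i := by
  simp only [coord, Formula.realize_sup, Formula.realize_inf,
    Formula.realize_not, realize_indep he, Formula.realize_iExs,
    realize_combination he, RTerm.realize_up, RTerm.realize_new, Formula.realize_equal,
    Ring.realize_zero]
  set X := fun j => ∑ i, (x j i).realize v • e i
  set Y := ∑ i, (y i).realize v • e i
  have hspan : (∃ c : Fin n → K, Y = ∑ j, c j • X j) ↔ Y ∈ Submodule.span K (Set.range X) := by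
    rw [Submodule.mem_span_range_iff_exists_fun]
    simp only [eq_comm]
  rw [hspan]
  by_cases h : LinearIndependent K X ∧ Y ∈ Submodule.span K (Set.range X)
  · obtain ⟨c, hc⟩ := hspan.2 h.2
    rw [coord_eq_of_eq_sum h.1 hc]
    constructor
    · rintro (⟨-, c', hc', hz⟩ | h')
      · rw [hz, ← coord_eq_of_eq_sum h.1 hc, ← coord_eq_of_eq_sum h.1 hc']
      · exact absurd h h'.1
    · exact fun hz => Or.inl ⟨h.1, c, hc, hz⟩
  · rw [coord_eq_zero h]
    constructor
    · rintro (⟨h1, c, hc, -⟩ | h')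
      · exact absurd ⟨h1, hspan.1 ⟨c, hc⟩⟩ h
      · exact h'.2
    · exact fun hz => Or.inr ⟨h, hz⟩

theorem realize_artinSchreier (t : RTerm α) (v : α → K) :
    (artinSchreier t).Realize v ↔ ∃ y : K, t.realize v = y ^ 2 - y := by
  simp only [artinSchreier, Formula.realize_iExs, Formula.realize_equal,
    RTerm.realize_up, Ring.realize_add, Ring.realize_mul, Ring.realize_neg, RTerm.realize_new]
  exact ⟨fun ⟨y, h⟩ => ⟨y (), by rw [h]; ring⟩, fun ⟨y, h⟩ => ⟨fun _ => y, by rw [h]; ring⟩⟩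

end RFml

namespace RTerm

variable {α ι : Type} [Fintype ι] {k l m : ℕ} {M : QuadGeom.{u} w} [Ring.CompatibleRing M.K]
  {e : ι → M.V} {q : M.Q} {E : FrameVar ι k l m → RTerm α} {v : α → M.K}
  {a : Fin k → M.K} {b : Fin l → M.V} {c : Fin m → M.Q}

theorem realize_bilin (h : Represents M e q (fun y => (E y).realize v) a b c)
    (x y : ι → RTerm α) : (bilin E x y).realize v =
      M.β (∑ i, (x i).realize v • e i) (∑ i, (y i).realize v • e i) := by
  simp only [bilin, realize_sum, Ring.realize_mul, ← h.gram, map_sum, LinearMap.sum_apply,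
    map_smul, LinearMap.smul_apply, smul_eq_mul]
  rw [Finset.sum_comm]
  simp only [Finset.mul_sum]
  exact Finset.sum_congr rfl fun _ _ => Finset.sum_congr rfl fun _ _ => by ring

theorem realize_quad (h : Represents M e q (fun y => (E y).realize v) a b c)
    (x : ι → RTerm α) : (quad E x).realize v = M.form q (∑ i, (x i).realize v • e i) := by
  rw [quad, ← Finset.sum_map_toList]
  induction (Finset.univ : Finset ι).toList with
  | nil => simp [listForm]
  | cons i s ih =>
    have hs : M.β ((x i).realize v • e i) (s.map fun i => (x i).realize v • e i).sum =
        (listSum (fun j => x i * x j * E (gram i j)) s).realize v := by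
      rw [realize_listSum, map_list_sum, List.map_map]
      congr 2
      funext j
      simp [← h.gram, mul_assoc]
    rw [List.map_cons, List.sum_cons, M.form_add, M.form_smul, hs, ← ih, h.val]
    simp [listForm]

end RTerm

/-! ### Translation of formulas into the language of rings -/

/-- Equality of two vectors given by coefficients. -/
def RFml.eqVec {α ι : Type} [Finite ι] (x y : ι → RTerm α) : RFml α :=
  Formula.iInf fun i => Term.equal (x i) (y i)

section Graph

variable {k l m : ℕ} {ι : Type} [Fintype ι]

mutual

/-- The formula saying that `z` is the value of a term of sort `K`, where the tuple assigned to
the variables is described by `E`. -/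
def KTerm.graph : KTerm w k l m → ∀ {α : Type}, (FrameVar ι k l m → RTerm α) → RTerm α → RFml α
  | .var i, _, E, z => Term.equal z (E (.scal i))
  | .zero, _, _, z => Term.equal z 0
  | .one, _, _, z => Term.equal z 1
  | .add t t', _, E, z => Formula.iExs Bool
      (t.graph (fun y => (E y).up Bool) (.new _ true) ⊓
        t'.graph (fun y => (E y).up Bool) (.new _ false) ⊓
        Term.equal (z.up Bool) (RTerm.new _ true + RTerm.new _ false))
  | .neg t, _, E, z => t.graph E (-z)
  | .mul t t', _, E, z => Formula.iExs Bool
      (t.graph (fun y => (E y).up Bool) (.new _ true) ⊓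
        t'.graph (fun y => (E y).up Bool) (.new _ false) ⊓
        Term.equal (z.up Bool) (RTerm.new _ true * RTerm.new _ false))
  | .coord n x y i, _, E, z => Formula.iExs (Option (Fin n) × ι)
      ((Formula.iInf fun j : Fin n =>
          (x j).graph (fun y => (E y).up _) fun i' => .new _ (some j, i')) ⊓
        y.graph (fun y => (E y).up _) (fun i' => .new _ (none, i')) ⊓
        RFml.coord (fun j i' => .new _ (some j, i')) (fun i' => .new _ (none, i')) i (z.up _))
  | .β t t', _, E, z => Formula.iExs (Bool × ι)
      (t.graph (fun y => (E y).up _) (fun i => .new _ (true, i)) ⊓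
        t'.graph (fun y => (E y).up _) (fun i => .new _ (false, i)) ⊓
        Term.equal (z.up _) (RTerm.bilin (fun y => (E y).up _)
          (fun i => .new _ (true, i)) (fun i => .new _ (false, i))))
  -- The translate of `q` by `x` takes at `y` the value `q y + β x y * β x y`.
  | .form t t', _, E, z => Formula.iExs (Bool × ι)
      (t.graph (fun y => (E y).up _) (fun i => .new _ (true, i)) ⊓
        t'.graph (fun y => (E y).up _) (fun i => .new _ (false, i)) ⊓
        Term.equal (z.up _)
          (RTerm.quad (fun y => (E y).up _) (fun i => .new _ (false, i)) +
            RTerm.bilin (fun y => (E y).up _)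
              (fun i => .new _ (true, i)) (fun i => .new _ (false, i)) *
            RTerm.bilin (fun y => (E y).up _)
              (fun i => .new _ (true, i)) (fun i => .new _ (false, i))))
  -- `ω` agrees with its value at the form of the frame if and only if that form takes a value of
  -- the shape `y ^ 2 - y` at the translating vector; otherwise it is the other one of `0` and `1`.
  | .ω _ t, _, E, z => Formula.iExs ι
      (t.graph (fun y => (E y).up _) (.new _) ⊓
        ((RFml.artinSchreier (RTerm.quad (fun y => (E y).up _) (.new _)) ⊓
            Term.equal (z.up _) ((E .witt).up _)) ⊔
          (∼(RFml.artinSchreier (RTerm.quad (fun y => (E y).up _) (.new _))) ⊓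
            Term.equal (z.up _) ((E .witt).up _ + 1))))

/-- The formula saying that `z` are the coefficients of the value of a term of sort `V`. -/
def VTerm.graph : VTerm w k l m → ∀ {α : Type}, (FrameVar ι k l m → RTerm α) → (ι → RTerm α) →
    RFml α
  | .var j, _, E, z => RFml.eqVec z fun i => E (.vec j i)
  | .zero, _, _, z => RFml.eqVec z fun _ => 0
  | .add t t', _, E, z => Formula.iExs (Bool × ι)
      (t.graph (fun y => (E y).up _) (fun i => .new _ (true, i)) ⊓
        t'.graph (fun y => (E y).up _) (fun i => .new _ (false, i)) ⊓
        RFml.eqVec (fun i => (z i).up _) fun i => .new _ (true, i) + .new _ (false, i))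
  | .neg t, _, E, z => t.graph E fun i => -z i
  | .smul t t', _, E, z => Formula.iExs (Option ι)
      (t.graph (fun y => (E y).up _) (.new _ none) ⊓
        t'.graph (fun y => (E y).up _) (fun i => .new _ (some i)) ⊓
        RFml.eqVec (fun i => (z i).up _) fun i => .new _ none * .new _ (some i))
  | .diff t t', _, E, z => Formula.iExs (Bool × ι)
      (t.graph (fun y => (E y).up _) (fun i => .new _ (true, i)) ⊓
        t'.graph (fun y => (E y).up _) (fun i => .new _ (false, i)) ⊓
        RFml.eqVec (fun i => (z i).up _) fun i => .new _ (true, i) + -.new _ (false, i))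

/-- The formula saying that the value of a term of sort `Q` is the translate of the form of the
frame by the vector with coefficients `z`. -/
def QTerm.graph : QTerm w k l m → ∀ {α : Type}, (FrameVar ι k l m → RTerm α) → (ι → RTerm α) →
    RFml α
  | .var j, _, E, z => RFml.eqVec z fun i => E (.frm j i)
  | .act t t', _, E, z => Formula.iExs (Bool × ι)
      (t.graph (fun y => (E y).up _) (fun i => .new _ (true, i)) ⊓
        t'.graph (fun y => (E y).up _) (fun i => .new _ (false, i)) ⊓
        RFml.eqVec (fun i => (z i).up _) fun i => .new _ (true, i) + .new _ (false, i))

end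

end Graph

theorem QuadGeom.act_injective {M : QuadGeom.{u} w} {q : M.Q} {x y : M.V} :
    M.act q x = M.act q y ↔ x = y :=
  ⟨fun h => by rw [← M.diff_act q x, h, M.diff_act], fun h => h ▸ rfl⟩

theorem QuadGeom.diff_act_act {M : QuadGeom.{u} w} (q : M.Q) (x y : M.V) :
    M.diff (M.act q x) (M.act q y) = x - y := by
  have h := M.act_diff (M.act q x) (M.act q y)
  rw [← M.act_add, QuadGeom.act_injective] at h
  rw [eq_sub_iff_add_eq, add_comm, h]

namespace Represents

variable {M : QuadGeom.{u} w} {ι : Type} [Fintype ι] {k l m : ℕ} {e : ι → M.V}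
  {q : M.Q} {D : FrameVar ι k l m → M.K} {a : Fin k → M.K} {b : Fin l → M.V} {c : Fin m → M.Q}

theorem sum_smul_inj (h : Represents M e q D a b c) {x y : ι → M.K} :
    ∑ i, x i • e i = ∑ i, y i • e i ↔ ∀ i, x i = y i := by
  constructor
  · intro hxy i
    rw [← sub_eq_zero, ← Finset.sum_sub_distrib] at hxy
    simp only [← sub_smul] at hxy
    exact sub_eq_zero.1 (Fintype.linearIndependent_iff.1 h.indep _ hxy i)
  · intro hxy; simp [hxy]

mutual

/-- The values of terms of sort `V` lie in the span of the frame. -/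
theorem exists_vterm_eq (h : Represents M e q D a b c) :
    ∀ t : VTerm w k l m, ∃ z : ι → M.K, ∑ i, z i • e i = t.eval M a b c
  | .var j => ⟨fun i => D (.vec j i), (h.vec j).symm⟩
  | .zero => ⟨0, by simp [VTerm.eval]⟩
  | .add t t' => by
    obtain ⟨z, hz⟩ := exists_vterm_eq h t
    obtain ⟨z', hz'⟩ := exists_vterm_eq h t'
    exact ⟨fun i => z i + z' i, by simp [VTerm.eval, add_smul, Finset.sum_add_distrib, hz, hz']⟩
  | .neg t => by
    obtain ⟨z, hz⟩ := exists_vterm_eq h t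
    exact ⟨fun i => -z i, by simp [VTerm.eval, hz]⟩
  | .smul t t' => by
    obtain ⟨z, hz⟩ := exists_vterm_eq h t'
    exact ⟨fun i => t.eval M a b c * z i, by simp [VTerm.eval, mul_smul, ← Finset.smul_sum, hz]⟩
  | .diff t t' => by
    obtain ⟨z, hz⟩ := exists_qterm_eq h t
    obtain ⟨z', hz'⟩ := exists_qterm_eq h t'
    refine ⟨fun i => z i - z' i, ?_⟩
    simp [VTerm.eval, ← hz, ← hz', M.diff_act_act, sub_smul, Finset.sum_sub_distrib]

/-- The values of terms of sort `Q` are translates of the form of the frame by vectors in its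
span. -/
theorem exists_qterm_eq (h : Represents M e q D a b c) :
    ∀ t : QTerm w k l m, ∃ z : ι → M.K, M.act q (∑ i, z i • e i) = t.eval M a b c
  | .var j => ⟨fun i => D (.frm j i), (h.frm j).symm⟩
  | .act t t' => by
    obtain ⟨z, hz⟩ := exists_qterm_eq h t
    obtain ⟨z', hz'⟩ := exists_vterm_eq h t'
    refine ⟨fun i => z i + z' i, ?_⟩
    simp [QTerm.eval, ← hz, ← hz', M.act_add, add_smul, Finset.sum_add_distrib]

end

variable [Ring.CompatibleRing M.K]

theorem realize_eqVec {α : Type} {v : α → M.K} (h : Represents M e q D a b c)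
    {x y : ι → RTerm α} : (RFml.eqVec x y).Realize v ↔
      ∑ i, (x i).realize v • e i = ∑ i, (y i).realize v • e i := by
  simp [RFml.eqVec, h.sum_smul_inj, Formula.realize_iInf]

end Represents

section Realize

variable {M : QuadGeom.{u} w} [Ring.CompatibleRing M.K] {ι : Type} [Fintype ι] {k l m : ℕ}
  {e : ι → M.V} {q : M.Q} {a : Fin k → M.K} {b : Fin l → M.V} {c : Fin m → M.Q}

theorem Represents.up {α β : Type} {E : FrameVar ι k l m → RTerm α} {v : α → M.K}
    (h : Represents M e q (fun y => (E y).realize v) a b c) (x : β → M.K) :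
    Represents M e q (fun y => ((E y).up β).realize (Sum.elim v x)) a b c := by
  simpa using h

mutual

theorem KTerm.realize_graph : ∀ (t : KTerm w k l m) {α : Type} {E : FrameVar ι k l m → RTerm α}
    {v : α → M.K} (_ : Represents M e q (fun y => (E y).realize v) a b c) (z : RTerm α),
    (t.graph E z).Realize v ↔ z.realize v = t.eval M a b c
  | .var i, _, E, v, h, z => by
    simp [KTerm.graph, KTerm.eval, h.scal]
  | .zero, _, E, v, h, z => by
    simp [KTerm.graph, KTerm.eval]
  | .one, _, E, v, h, z => by
    simp [KTerm.graph, KTerm.eval]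
  | .add t t', _, E, v, h, z => by
    simp only [KTerm.graph, KTerm.eval, Formula.realize_iExs, Formula.realize_inf,
      t.realize_graph (h.up _), t'.realize_graph (h.up _), Formula.realize_equal,
      RTerm.realize_up, RTerm.realize_new, Ring.realize_add]
    exact ⟨fun ⟨x, ⟨h1, h2⟩, h3⟩ => by rw [h3, h1, h2],
      fun hz => ⟨fun s => bif s then t.eval M a b c else t'.eval M a b c, ⟨rfl, rfl⟩, hz⟩⟩
  | .neg t, _, E, v, h, z => by
    simp [KTerm.graph, KTerm.eval, t.realize_graph h, neg_eq_iff_eq_neg]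
  | .mul t t', _, E, v, h, z => by
    simp only [KTerm.graph, KTerm.eval, Formula.realize_iExs, Formula.realize_inf,
      t.realize_graph (h.up _), t'.realize_graph (h.up _), Formula.realize_equal,
      RTerm.realize_up, RTerm.realize_new, Ring.realize_mul]
    exact ⟨fun ⟨x, ⟨h1, h2⟩, h3⟩ => by rw [h3, h1, h2],
      fun hz => ⟨fun s => bif s then t.eval M a b c else t'.eval M a b c, ⟨rfl, rfl⟩, hz⟩⟩
  | .coord n x y i, _, E, v, h, z => by
    simp only [KTerm.graph, KTerm.eval, Formula.realize_iExs, Formula.realize_inf,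
      Formula.realize_iInf, fun j X => (x j).realize_graph (h.up (β := Option (Fin n) × ι) X),
      y.realize_graph (h.up _), RFml.realize_coord h.indep, RTerm.realize_up, RTerm.realize_new]
    constructor
    · rintro ⟨X, ⟨hx, hy⟩, hz⟩
      simpa only [hx, hy] using hz
    · intro hz
      choose X hX using fun j => h.exists_vterm_eq (x j)
      obtain ⟨Y, hY⟩ := h.exists_vterm_eq y
      refine ⟨fun p => p.1.elim (Y p.2) fun j => X j p.2, ⟨hX, hY⟩, ?_⟩
      simpa only [Option.elim, hX, hY] using hz
  | .β t t', _, E, v, h, z => by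
    simp only [KTerm.graph, KTerm.eval, Formula.realize_iExs, Formula.realize_inf,
      t.realize_graph (h.up _), t'.realize_graph (h.up _), Formula.realize_equal,
      RTerm.realize_bilin (h.up _), RTerm.realize_up, RTerm.realize_new]
    constructor
    · rintro ⟨X, ⟨hx, hy⟩, hz⟩
      rw [hz, hx, hy]
    · intro hz
      obtain ⟨X, hX⟩ := h.exists_vterm_eq t
      obtain ⟨Y, hY⟩ := h.exists_vterm_eq t'
      refine ⟨fun p => bif p.1 then X p.2 else Y p.2, ⟨hX, hY⟩, ?_⟩
      simpa only [cond, hX, hY] using hz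
  | .form t t', _, E, v, h, z => by
    simp only [KTerm.graph, KTerm.eval, Formula.realize_iExs, Formula.realize_inf,
      t.realize_graph (h.up _), t'.realize_graph (h.up _), Formula.realize_equal,
      RTerm.realize_bilin (h.up _), RTerm.realize_quad (h.up _), RTerm.realize_up,
      RTerm.realize_new, Ring.realize_add, Ring.realize_mul]
    constructor
    · rintro ⟨X, ⟨hx, hy⟩, hz⟩
      rw [hz, hy, ← hx, M.form_act, pow_two]
    · intro hz
      obtain ⟨X, hX⟩ := h.exists_qterm_eq t
      obtain ⟨Y, hY⟩ := h.exists_vterm_eq t'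
      refine ⟨fun p => bif p.1 then X p.2 else Y p.2, ⟨hX, hY⟩, ?_⟩
      rw [← hX, M.form_act, pow_two] at hz
      simpa only [cond, hY] using hz
  | .ω hw t, _, E, v, h, z => by
    simp only [KTerm.graph, KTerm.eval, Formula.realize_iExs, Formula.realize_inf,
      Formula.realize_sup, Formula.realize_not, RFml.realize_artinSchreier,
      t.realize_graph (h.up _), Formula.realize_equal,
      RTerm.realize_quad (h.up _), RTerm.realize_up,
      RTerm.realize_new, Ring.realize_add, Ring.realize_one]
    rw [← h.witt, QuadGeom.wittValue_eq hw]
    -- A value of `ω` different from `ω q` must be `ω q + 1`, in characteristic two.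
    have key : ∀ X : M.V, ((∃ y, M.form q X = y ^ 2 - y) ∧ z.realize v = M.ω hw q ∨
        (¬ ∃ y, M.form q X = y ^ 2 - y) ∧ z.realize v = M.ω hw q + 1) ↔
        z.realize v = M.ω hw (M.act q X) := by
      intro X
      rw [← QuadGeom.ω_act_eq_iff hw]
      by_cases hX : M.ω hw (M.act q X) = M.ω hw q
      · simp [hX]
      · have : M.ω hw (M.act q X) = M.ω hw q + 1 := by
          rcases M.ω_zero_or_one hw q with h0 | h0 <;>
            rcases M.ω_zero_or_one hw (M.act q X) with h1 | h1
          · exact absurd (h1.trans h0.symm) hX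
          · rw [h0, h1, zero_add]
          · rw [h0, h1, CharTwo.add_self_eq_zero]
          · exact absurd (h1.trans h0.symm) hX
        simp [this]
    simp only [key]
    constructor
    · rintro ⟨X, hX, hz⟩
      rwa [← hX]
    · intro hz
      obtain ⟨X, hX⟩ := h.exists_qterm_eq t
      exact ⟨X, hX, by rwa [hX]⟩

theorem VTerm.realize_graph : ∀ (t : VTerm w k l m) {α : Type} {E : FrameVar ι k l m → RTerm α}
    {v : α → M.K} (_ : Represents M e q (fun y => (E y).realize v) a b c) (z : ι → RTerm α),
    (t.graph E z).Realize v ↔ ∑ i, (z i).realize v • e i = t.eval M a b c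
  | .var j, _, E, v, h, z => by
    simp [VTerm.graph, VTerm.eval, h.realize_eqVec, h.vec]
  | .zero, _, E, v, h, z => by
    simp [VTerm.graph, VTerm.eval, h.realize_eqVec]
  | .add t t', _, E, v, h, z => by
    simp only [VTerm.graph, VTerm.eval, Formula.realize_iExs, Formula.realize_inf,
      t.realize_graph (h.up _), t'.realize_graph (h.up _), h.realize_eqVec,
      RTerm.realize_up, RTerm.realize_new, Ring.realize_add, add_smul, Finset.sum_add_distrib]
    constructor
    · rintro ⟨X, ⟨hx, hy⟩, hz⟩
      rw [hz, hx, hy]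
    · intro hz
      obtain ⟨X, hX⟩ := h.exists_vterm_eq t
      obtain ⟨Y, hY⟩ := h.exists_vterm_eq t'
      refine ⟨fun p => bif p.1 then X p.2 else Y p.2, ⟨hX, hY⟩, ?_⟩
      simpa only [cond, hX, hY] using hz
  | .neg t, _, E, v, h, z => by
    simp [VTerm.graph, VTerm.eval, t.realize_graph h, neg_eq_iff_eq_neg]
  | .smul t t', _, E, v, h, z => by
    simp only [VTerm.graph, VTerm.eval, Formula.realize_iExs, Formula.realize_inf,
      t.realize_graph (h.up _), t'.realize_graph (h.up _), h.realize_eqVec,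
      RTerm.realize_up, RTerm.realize_new, Ring.realize_mul, mul_smul, ← Finset.smul_sum]
    constructor
    · rintro ⟨X, ⟨hx, hy⟩, hz⟩
      rw [hz, hx, hy]
    · intro hz
      obtain ⟨Y, hY⟩ := h.exists_vterm_eq t'
      refine ⟨fun o => o.elim (t.eval M a b c) Y, ⟨rfl, hY⟩, ?_⟩
      simpa only [Option.elim, hY] using hz
  | .diff t t', _, E, v, h, z => by
    simp only [VTerm.graph, VTerm.eval, Formula.realize_iExs, Formula.realize_inf,
      t.realize_graph (h.up _), t'.realize_graph (h.up _), h.realize_eqVec,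
      RTerm.realize_up, RTerm.realize_new, Ring.realize_add, Ring.realize_neg, ← sub_eq_add_neg,
      sub_smul, Finset.sum_sub_distrib]
    constructor
    · rintro ⟨X, ⟨hx, hy⟩, hz⟩
      rw [hz, ← hx, ← hy, M.diff_act_act]
    · intro hz
      obtain ⟨X, hX⟩ := h.exists_qterm_eq t
      obtain ⟨Y, hY⟩ := h.exists_qterm_eq t'
      refine ⟨fun p => bif p.1 then X p.2 else Y p.2, ⟨hX, hY⟩, ?_⟩
      rwa [← hX, ← hY, M.diff_act_act] at hz

theorem QTerm.realize_graph : ∀ (t : QTerm w k l m) {α : Type} {E : FrameVar ι k l m → RTerm α}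
    {v : α → M.K} (_ : Represents M e q (fun y => (E y).realize v) a b c) (z : ι → RTerm α),
    (t.graph E z).Realize v ↔ M.act q (∑ i, (z i).realize v • e i) = t.eval M a b c
  | .var j, _, E, v, h, z => by
    simp only [QTerm.graph, QTerm.eval, h.realize_eqVec, h.frm, QuadGeom.act_injective]
  | .act t t', _, E, v, h, z => by
    simp only [QTerm.graph, QTerm.eval, Formula.realize_iExs, Formula.realize_inf,
      t.realize_graph (h.up _), t'.realize_graph (h.up _), h.realize_eqVec,
      RTerm.realize_up, RTerm.realize_new, Ring.realize_add, add_smul, Finset.sum_add_distrib]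
    constructor
    · rintro ⟨X, ⟨hx, hy⟩, hz⟩
      rw [hz, ← hx, ← hy, M.act_add]
    · intro hz
      obtain ⟨X, hX⟩ := h.exists_qterm_eq t
      obtain ⟨Y, hY⟩ := h.exists_vterm_eq t'
      refine ⟨fun p => bif p.1 then X p.2 else Y p.2, ⟨hX, hY⟩, ?_⟩
      rwa [← hX, ← hY, ← M.act_add, QuadGeom.act_injective] at hz

end

end Realize

/-- The translation of a formula about a tuple into a formula about the scalars `E` that describe
the tuple relative to a frame.  A quantifier over vectors splits into one over the coefficients of
vectors in the span of the frame and one over the data of a vector that extends the frame; likewise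
for quadratic forms. -/
def Fml.toRing : {k l m : ℕ} → Fml w k l m → ∀ {ι : Type} [Fintype ι] {α : Type},
    (FrameVar ι k l m → RTerm α) → RFml α
  | _, _, _, .falsum, _, _, _, _ => ⊥
  | _, _, _, .eqK t t', _, _, _, E => Formula.iExs Unit
      (t.graph (fun y => (E y).up _) (.new _ ()) ⊓ t'.graph (fun y => (E y).up _) (.new _ ()))
  | _, _, _, .eqV t t', ι, _, _, E => Formula.iExs ι
      (t.graph (fun y => (E y).up _) (.new _) ⊓ t'.graph (fun y => (E y).up _) (.new _))
  | _, _, _, .eqQ t t', ι, _, _, E => Formula.iExs ι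
      (t.graph (fun y => (E y).up _) (.new _) ⊓ t'.graph (fun y => (E y).up _) (.new _))
  | _, _, _, .indep n x, ι, _, _, E => Formula.iExs (Fin n × ι)
      ((Formula.iInf fun j => (x j).graph (fun y => (E y).up _) fun i => .new _ (j, i)) ⊓
        RFml.indep fun j i => .new _ (j, i))
  | _, _, _, .imp φ ψ, _, _, _, E => φ.toRing E ⟹ ψ.toRing E
  | _, _, _, .allK φ, _, _, _, E => Formula.iAlls Unit
      (φ.toRing (pushK (fun y => (E y).up _) (.new _ ())))
  | _, _, _, .allV φ, ι, _, _, E =>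
      Formula.iAlls ι (φ.toRing (pushV (fun y => (E y).up _) (.new _))) ⊓
      Formula.iAlls (Option ι) (φ.toRing (pushV (pushFrame (fun y => (E y).up _)
        (fun i => .new _ (some i)) (.new _ none)) (newRow _ _)))
  | _, _, _, .allQ φ, ι, _, _, E =>
      Formula.iAlls ι (φ.toRing (pushQ (fun y => (E y).up _) (.new _))) ⊓
      Formula.iAlls (Option ι) (φ.toRing (pushQ (pushFrame (fun y => (E y).up _)
        (fun i => .new _ (some i)) (.new _ none)) (newRow _ _)))

/-- A property holds for all vectors if it holds for those in the span of a frame and for one vector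
of every possible type outside the span. -/
theorem QuadGeom.IsRich.forall_vec_iff {M : QuadGeom.{u} w} (hM : M.IsRich) {ι : Type} [Fintype ι]
    {e : ι → M.V} (he : LinearIndependent M.K e) (q : M.Q) {P : M.V → Prop}
    {P₁ : (ι → M.K) → Prop} {P₂ : (ι → M.K) → M.K → Prop}
    (h₁ : ∀ z, P₁ z ↔ P (∑ i, z i • e i))
    (h₂ : ∀ x ∉ Submodule.span M.K (Set.range e),
      (P₂ (fun i => M.β x (e i)) (M.form q x) ↔ P x)) :
    (∀ x, P x) ↔ (∀ z, P₁ z) ∧ ∀ α γ, P₂ α γ := by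
  constructor
  · refine fun h => ⟨fun z => (h₁ z).2 (h _), fun α γ => ?_⟩
    obtain ⟨x, hx, hα, hγ⟩ := hM.exists_notMem_span q he α γ
    obtain rfl : (fun i => M.β x (e i)) = α := funext hα
    subst hγ
    exact (h₂ x hx).2 (h x)
  · rintro ⟨h, h'⟩ x
    by_cases hx : x ∈ Submodule.span M.K (Set.range e)
    · obtain ⟨z, rfl⟩ := (Submodule.mem_span_range_iff_exists_fun M.K).1 hx
      exact (h₁ z).1 (h z)
    · exact (h₂ x hx).1 (h' _ _)

theorem QuadGeom.forall_form_iff {M : QuadGeom.{u} w} (q : M.Q) {P : M.Q → Prop} :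
    (∀ q', P q') ↔ ∀ x, P (M.act q x) :=
  ⟨fun h _ => h _, fun h q' => M.act_diff q' q ▸ h _⟩

theorem forall_option_iff {ι X : Type*} {P : (ι → X) → X → Prop} :
    (∀ z : Option ι → X, P (fun i => z (some i)) (z none)) ↔ ∀ α γ, P α γ :=
  ⟨fun h α γ => h fun o => o.elim γ α, fun h _ => h _ _⟩

section

variable {M : QuadGeom.{u} w}

/-- The data of a tuple with a new vector relative to the frame extended by this vector. -/
theorem Represents.pushV_newRow {ι : Type} [Fintype ι] {k l m : ℕ} {e : ι → M.V} {q : M.Q}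
    {D : FrameVar ι k l m → M.K} {a : Fin k → M.K} {b : Fin l → M.V} {c : Fin m → M.Q}
    (h : Represents M e q D a b c) {x : M.V} (hx : x ∉ Submodule.span M.K (Set.range e)) :
    Represents M (fun o : Option ι => o.elim x e) q
      (FrameVar.pushV (FrameVar.pushFrame D (fun i => M.β x (e i)) (M.form q x))
        (newRow ι M.K)) a (Fin.snoc (α := fun _ => M.V) b x) c := by
  have := (h.pushFrame hx (fun _ => rfl) rfl).pushV (newRow ι M.K)
  rwa [sum_newRow_smul] at this

theorem Represents.pushQ_newRow {ι : Type} [Fintype ι] {k l m : ℕ} {e : ι → M.V} {q : M.Q}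
    {D : FrameVar ι k l m → M.K} {a : Fin k → M.K} {b : Fin l → M.V} {c : Fin m → M.Q}
    (h : Represents M e q D a b c) {x : M.V} (hx : x ∉ Submodule.span M.K (Set.range e)) :
    Represents M (fun o : Option ι => o.elim x e) q
      (FrameVar.pushQ (FrameVar.pushFrame D (fun i => M.β x (e i)) (M.form q x))
        (newRow ι M.K)) a b (Fin.snoc (α := fun _ => M.Q) c (M.act q x)) := by
  have := (h.pushFrame hx (fun _ => rfl) rfl).pushQ (newRow ι M.K)
  rwa [sum_newRow_smul] at this

variable [Ring.CompatibleRing M.K]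

theorem FrameVar.realize_pushK {ι α : Type} {k l m : ℕ}
    (E : FrameVar ι k l m → RTerm α) (z : RTerm α) (v : α → M.K) :
    (fun y => (FrameVar.pushK E z y).realize v) =
      FrameVar.pushK (fun y => (E y).realize v) (z.realize v) :=
  map_pushK (fun t => t.realize v) E z

theorem FrameVar.realize_pushV {ι α : Type} {k l m : ℕ}
    (E : FrameVar ι k l m → RTerm α) (z : ι → RTerm α) (v : α → M.K) :
    (fun y => (FrameVar.pushV E z y).realize v) =
      FrameVar.pushV (fun y => (E y).realize v) (fun i => (z i).realize v) :=
  map_pushV (fun t => t.realize v) E z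

theorem FrameVar.realize_pushQ {ι α : Type} {k l m : ℕ}
    (E : FrameVar ι k l m → RTerm α) (z : ι → RTerm α) (v : α → M.K) :
    (fun y => (FrameVar.pushQ E z y).realize v) =
      FrameVar.pushQ (fun y => (E y).realize v) (fun i => (z i).realize v) :=
  map_pushQ (fun t => t.realize v) E z

theorem FrameVar.realize_pushFrame {ι α : Type} {k l m : ℕ}
    (E : FrameVar ι k l m → RTerm α) (z : ι → RTerm α) (γ : RTerm α) (v : α → M.K) :
    (fun y => (FrameVar.pushFrame E z γ y).realize v) =
      FrameVar.pushFrame (fun y => (E y).realize v) (fun i => (z i).realize v) (γ.realize v) :=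
  map_pushFrame (fun t => t.realize v) (Ring.realize_zero v) E z γ

theorem FrameVar.realize_newRow {ι α : Type} (v : α → M.K) :
    (fun y => (newRow ι (RTerm α) y).realize v) = newRow ι M.K :=
  map_newRow (fun t : RTerm α => t.realize v) (Ring.realize_zero v) (Ring.realize_one v)

/-- The translation is correct relative to every frame of the tuple, by induction on the formula:
the realization of one-point extensions makes the quantifiers over vectors and forms correspond to
quantifiers over scalars. -/
theorem Fml.realize_toRing (hM : M.IsRich) : ∀ {k l m : ℕ} (φ : Fml w k l m) {ι : Type}
    [Fintype ι] {α : Type} {E : FrameVar ι k l m → RTerm α} {v : α → M.K} {e : ι → M.V} {q : M.Q}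
    {a : Fin k → M.K} {b : Fin l → M.V} {c : Fin m → M.Q}
    (_ : Represents M e q (fun y => (E y).realize v) a b c),
    (φ.toRing E).Realize v ↔ φ.Sat M a b c
  | _, _, _, .falsum, _, _, _, _, _, _, _, _, _, _, h => by
    simp [Fml.toRing, Fml.Sat, Formula.Realize]
  | _, _, _, .eqK t t', _, _, _, _, _, _, _, _, _, _, h => by
    simp only [Fml.toRing, Fml.Sat, Formula.realize_iExs, Formula.realize_inf,
      t.realize_graph (h.up _), t'.realize_graph (h.up _), RTerm.realize_new]
    exact ⟨fun ⟨z, h1, h2⟩ => h1.symm.trans h2, fun h1 => ⟨fun _ => _, rfl, h1⟩⟩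
  | _, _, _, .eqV t t', _, _, _, _, _, _, _, _, _, _, h => by
    simp only [Fml.toRing, Fml.Sat, Formula.realize_iExs, Formula.realize_inf,
      t.realize_graph (h.up _), t'.realize_graph (h.up _), RTerm.realize_new]
    obtain ⟨z, hz⟩ := h.exists_vterm_eq t
    exact ⟨fun ⟨z, h1, h2⟩ => h1.symm.trans h2, fun h1 => ⟨z, hz, hz.trans h1⟩⟩
  | _, _, _, .eqQ t t', _, _, _, _, _, _, _, _, _, _, h => by
    simp only [Fml.toRing, Fml.Sat, Formula.realize_iExs, Formula.realize_inf,
      t.realize_graph (h.up _), t'.realize_graph (h.up _), RTerm.realize_new]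
    obtain ⟨z, hz⟩ := h.exists_qterm_eq t
    exact ⟨fun ⟨z, h1, h2⟩ => h1.symm.trans h2, fun h1 => ⟨z, hz, hz.trans h1⟩⟩
  | _, _, _, .indep n x, ι, _, _, _, _, _, _, _, _, _, h => by
    simp only [Fml.toRing, Fml.Sat, Formula.realize_iExs, Formula.realize_inf,
      Formula.realize_iInf, fun j X => (x j).realize_graph (h.up (β := Fin n × ι) X),
      RTerm.realize_new, RFml.realize_indep h.indep]
    constructor
    · rintro ⟨X, hx, hi⟩
      simpa only [hx] using hi
    · intro hi
      choose X hX using fun j => h.exists_vterm_eq (x j)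
      exact ⟨fun p => X p.1 p.2, hX, by simpa only [hX] using hi⟩
  | _, _, _, .imp φ ψ, _, _, _, _, _, _, _, _, _, _, h => by
    simp only [Fml.toRing, Fml.Sat, Formula.realize_imp, φ.realize_toRing hM h,
      ψ.realize_toRing hM h]
  | _, _, _, .allK φ, _, _, _, E, v, _, _, a, _, _, h => by
    have hφ : ∀ z : Unit → M.K, (φ.toRing (FrameVar.pushK (fun y => (E y).up _)
        (.new _ ()))).Realize (Sum.elim v z) ↔
          φ.Sat M (Fin.snoc (α := fun _ => M.K) a (z ())) _ _ :=
      fun z => φ.realize_toRing hM (by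
        simpa only [FrameVar.realize_pushK, RTerm.realize_new] using (h.up z).pushK (z ()))
    simp only [Fml.toRing, Fml.Sat, Formula.realize_iAlls, hφ]
    exact ⟨fun h z => h fun _ => z, fun h z => h _⟩
  | _, _, _, .allV φ, _, _, _, E, v, e, q, _, b, _, h => by
    have h₁ : ∀ z, (φ.toRing (FrameVar.pushV (fun y => (E y).up _) (.new _))).Realize
        (Sum.elim v z) ↔ φ.Sat M _ (Fin.snoc (α := fun _ => M.V) b (∑ i, z i • e i)) _ :=
      fun z => φ.realize_toRing hM (by
        simpa only [FrameVar.realize_pushV, RTerm.realize_new] using (h.up z).pushV z)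
    simp only [Fml.toRing, Fml.Sat, Formula.realize_iAlls, Formula.realize_inf]
    rw [hM.forall_vec_iff h.indep q h₁ (P₂ := fun α γ => (φ.toRing (FrameVar.pushV
        (FrameVar.pushFrame (fun y => (E y).up _) (fun i => .new _ (some i)) (.new _ none))
        (newRow _ _))).Realize (Sum.elim v fun o => o.elim γ α)), ← forall_option_iff]
    · refine and_congr Iff.rfl (forall_congr' fun z => ?_)
      have : (fun o : Option _ => o.elim (z none) fun i => z (some i)) = z := by
        funext o; cases o <;> rfl
      rw [this]
    · intro x hx
      refine φ.realize_toRing hM (e := fun o => o.elim x e) (q := q) ?_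
      simp only [FrameVar.realize_pushV, FrameVar.realize_pushFrame, FrameVar.realize_newRow,
        RTerm.realize_new]
      exact (h.up _).pushV_newRow hx
  | _, _, _, .allQ φ, _, _, _, E, v, e, q, _, _, c, h => by
    have h₁ : ∀ z, (φ.toRing (FrameVar.pushQ (fun y => (E y).up _) (.new _))).Realize
        (Sum.elim v z) ↔ φ.Sat M _ _
          (Fin.snoc (α := fun _ => M.Q) c (M.act q (∑ i, z i • e i))) :=
      fun z => φ.realize_toRing hM (by
        simpa only [FrameVar.realize_pushQ, RTerm.realize_new] using (h.up z).pushQ z)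
    simp only [Fml.toRing, Fml.Sat, Formula.realize_iAlls, Formula.realize_inf]
    rw [QuadGeom.forall_form_iff q, hM.forall_vec_iff h.indep q h₁
      (P₂ := fun α γ => (φ.toRing (FrameVar.pushQ
        (FrameVar.pushFrame (fun y => (E y).up _) (fun i => .new _ (some i)) (.new _ none))
        (newRow _ _))).Realize (Sum.elim v fun o => o.elim γ α)), ← forall_option_iff]
    · refine and_congr Iff.rfl (forall_congr' fun z => ?_)
      have : (fun o : Option _ => o.elim (z none) fun i => z (some i)) = z := by
        funext o; cases o <;> rfl
      rw [this]
    · intro x hx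
      refine φ.realize_toRing hM (e := fun o => o.elim x e) (q := q) ?_
      simp only [FrameVar.realize_pushQ, FrameVar.realize_pushFrame, FrameVar.realize_newRow,
        RTerm.realize_new]
      exact (h.up _).pushQ_newRow hx

end

/-! ### Formulas of the language of rings as formulas about quadratic geometries -/

section Lift

variable {k l m : ℕ}

mutual

/-- Regard a term as a term in one more variable of sort `K`. -/
def KTerm.lift : KTerm w k l m → KTerm w (k + 1) l m
  | .var i => .var i.castSucc
  | .zero => .zero
  | .one => .one
  | .add t t' => .add t.lift t'.lift
  | .neg t => .neg t.lift
  | .mul t t' => .mul t.lift t'.lift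
  | .coord n x y i => .coord n (fun j => (x j).lift) y.lift i
  | .β t t' => .β t.lift t'.lift
  | .form t t' => .form t.lift t'.lift
  | .ω h t => .ω h t.lift

/-- Regard a term as a term in one more variable of sort `K`. -/
def VTerm.lift : VTerm w k l m → VTerm w (k + 1) l m
  | .var i => .var i
  | .zero => .zero
  | .add t t' => .add t.lift t'.lift
  | .neg t => .neg t.lift
  | .smul t t' => .smul t.lift t'.lift
  | .diff t t' => .diff t.lift t'.lift

/-- Regard a term as a term in one more variable of sort `K`. -/
def QTerm.lift : QTerm w k l m → QTerm w (k + 1) l m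
  | .var i => .var i
  | .act t t' => .act t.lift t'.lift

end

variable {M : QuadGeom.{u} w} {a : Fin k → M.K} {b : Fin l → M.V} {c : Fin m → M.Q}

mutual

theorem KTerm.eval_lift (z : M.K) : ∀ t : KTerm w k l m,
    t.lift.eval M (Fin.snoc (α := fun _ => M.K) a z) b c = t.eval M a b c
  | .var i => by simp [KTerm.lift, KTerm.eval]
  | .zero => rfl
  | .one => rfl
  | .add t t' => by simp [KTerm.lift, KTerm.eval, t.eval_lift z, t'.eval_lift z]
  | .neg t => by simp [KTerm.lift, KTerm.eval, t.eval_lift z]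
  | .mul t t' => by simp [KTerm.lift, KTerm.eval, t.eval_lift z, t'.eval_lift z]
  | .coord n x y i => by
    simp [KTerm.lift, KTerm.eval, fun j => (x j).eval_lift z, y.eval_lift z]
  | .β t t' => by simp [KTerm.lift, KTerm.eval, t.eval_lift z, t'.eval_lift z]
  | .form t t' => by simp [KTerm.lift, KTerm.eval, t.eval_lift z, t'.eval_lift z]
  | .ω h t => by simp [KTerm.lift, KTerm.eval, t.eval_lift z]

theorem VTerm.eval_lift (z : M.K) : ∀ t : VTerm w k l m,
    t.lift.eval M (Fin.snoc (α := fun _ => M.K) a z) b c = t.eval M a b c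
  | .var i => rfl
  | .zero => rfl
  | .add t t' => by simp [VTerm.lift, VTerm.eval, t.eval_lift z, t'.eval_lift z]
  | .neg t => by simp [VTerm.lift, VTerm.eval, t.eval_lift z]
  | .smul t t' => by simp [VTerm.lift, VTerm.eval, t.eval_lift z, t'.eval_lift z]
  | .diff t t' => by simp [VTerm.lift, VTerm.eval, t.eval_lift z, t'.eval_lift z]

theorem QTerm.eval_lift (z : M.K) : ∀ t : QTerm w k l m,
    t.lift.eval M (Fin.snoc (α := fun _ => M.K) a z) b c = t.eval M a b c
  | .var i => rfl
  | .act t t' => by simp [QTerm.lift, QTerm.eval, t.eval_lift z, t'.eval_lift z]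

end

instance : Zero (KTerm w k l m) := ⟨.zero⟩
instance : One (KTerm w k l m) := ⟨.one⟩
instance : Add (KTerm w k l m) := ⟨.add⟩
instance : Neg (KTerm w k l m) := ⟨.neg⟩
instance : Mul (KTerm w k l m) := ⟨.mul⟩
instance : Ring.CompatibleRing (KTerm w k l m) := Ring.compatibleRingOfRing _

/-- Evaluation of terms of sort `K` is a homomorphism for the language of rings. -/
def KTerm.evalHom (M : QuadGeom.{u} w) [Ring.CompatibleRing M.K] (a : Fin k → M.K)
    (b : Fin l → M.V) (c : Fin m → M.Q) : Language.ring.Hom (KTerm w k l m) M.K where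
  toFun t := t.eval M a b c
  map_fun' f x := by
    cases f
    · exact (Ring.CompatibleRing.funMap_add fun i => (x i).eval M a b c).symm
    · exact (Ring.CompatibleRing.funMap_mul fun i => (x i).eval M a b c).symm
    · exact (Ring.CompatibleRing.funMap_neg fun i => (x i).eval M a b c).symm
    · exact (Ring.CompatibleRing.funMap_zero fun i => (x i).eval M a b c).symm
    · exact (Ring.CompatibleRing.funMap_one fun i => (x i).eval M a b c).symm
  map_rel' r := nomatch r

/-- Substitute terms of sort `K` for the variables of a formula of the language of rings.  The
result has quantifiers over the field sort only. -/
def Fml.ofRing {α : Type} : ∀ {n : ℕ}, Language.ring.BoundedFormula α n → ∀ {k : ℕ},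
    (α ⊕ Fin n → KTerm w k l m) → Fml w k l m
  | _, .falsum, _, _ => .falsum
  | _, .equal t t', _, τ => .eqK (t.realize τ) (t'.realize τ)
  | _, .rel r _, _, _ => nomatch r
  | _, .imp φ ψ, _, τ => .imp (ofRing φ τ) (ofRing ψ τ)
  | _, .all φ, k, τ => .allK (ofRing φ (Sum.elim (fun i => (τ (.inl i)).lift)
      (Fin.snoc (α := fun _ => KTerm w (k + 1) l m) (fun i => (τ (.inr i)).lift)
        (.var (Fin.last k)))))

theorem Fml.onlyFieldQuantifiers_ofRing {α : Type} : ∀ {n : ℕ}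
    (φ : Language.ring.BoundedFormula α n) {k : ℕ} (τ : α ⊕ Fin n → KTerm w k l m),
    (ofRing φ τ).OnlyFieldQuantifiers
  | _, .falsum, _, _ => trivial
  | _, .equal _ _, _, _ => trivial
  | _, .rel r _, _, _ => nomatch r
  | _, .imp φ ψ, _, _ => ⟨onlyFieldQuantifiers_ofRing φ _, onlyFieldQuantifiers_ofRing ψ _⟩
  | _, .all φ, _, _ => onlyFieldQuantifiers_ofRing φ _

theorem Fml.sat_ofRing [Ring.CompatibleRing M.K] {α : Type} : ∀ {n : ℕ}
    (φ : Language.ring.BoundedFormula α n) {k : ℕ} (τ : α ⊕ Fin n → KTerm w k l m)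
    {a : Fin k → M.K}, (ofRing φ τ).Sat M a b c ↔ φ.Realize
      (fun i => (τ (.inl i)).eval M a b c) (fun i => (τ (.inr i)).eval M a b c)
  | _, .falsum, _, _, _ => Iff.rfl
  | _, .equal t t', _, τ, a => by
    have h : (fun i => (τ i).eval M a b c) = Sum.elim (fun i => (τ (.inl i)).eval M a b c)
        (fun i => (τ (.inr i)).eval M a b c) := by
      funext i; cases i <;> rfl
    have ht : ∀ t : RTerm (α ⊕ Fin _), (t.realize τ).eval M a b c =
        t.realize (fun i => (τ i).eval M a b c) := fun t =>
      (Language.HomClass.realize_term (KTerm.evalHom M a b c)).symm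
    simp only [ofRing, Fml.Sat, BoundedFormula.Realize, ht, h]
  | _, .rel r _, _, _, _ => nomatch r
  | _, .imp φ ψ, _, τ, _ => imp_congr (sat_ofRing φ τ) (sat_ofRing ψ τ)
  | _, .all φ, k, τ, a => by
    refine forall_congr' fun z => ?_
    rw [sat_ofRing φ]
    have : (fun i => (Fin.snoc (α := fun _ => KTerm w (k + 1) l m) (fun i => (τ (.inr i)).lift)
        (.var (Fin.last k)) i).eval M (Fin.snoc (α := fun _ => M.K) a z) b c) =
        Fin.snoc (α := fun _ => M.K) (fun i => (τ (.inr i)).eval M a b c) z := by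
      funext i
      refine Fin.lastCases ?_ (fun i => ?_) i
      · simp [KTerm.eval]
      · simp [KTerm.eval_lift]
    simp only [Sum.elim_inl, Sum.elim_inr, KTerm.eval_lift, this]

theorem Fml.sat_ofRing_iff_ringSat {α : Type} (φ : RFml α) (τ : α → KTerm w k l m) :
    (ofRing φ (Sum.elim τ Fin.elim0)).Sat M a b c ↔
      RingSat M.K φ fun i => (τ i).eval M a b c := by
  let := Ring.compatibleRingOfRing M.K
  refine (Fml.sat_ofRing φ _).trans ?_
  exact iff_of_eq (congrArg (BoundedFormula.Realize φ _) (funext fun i => i.elim0))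

end Lift

/-! ### Frames given by terms -/

section Base

variable {k l m : ℕ}

/-- Terms whose values, together with the first form of the tuple, generate the vectors and the
forms of the tuple. -/
def spanTerm : Fin l ⊕ Fin m → VTerm w k l m
  | .inl j => .var j
  | .inr j => .diff (.var j) (.var ⟨0, j.pos⟩)

/-- The family of the terms `spanTerm j` for `j` in `S`. -/
def frameTerm (S : Finset (Fin l ⊕ Fin m)) (i : Fin S.card) : VTerm w k l m :=
  spanTerm (S.equivFin.symm i).1

/-- Terms for the scalars that describe the tuple relative to the family `frameTerm S` and its first
quadratic form.  If the tuple contains no quadratic form, the scalars are those relative to a form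
that vanishes on the family and has Witt defect `0` or `1`, according to `s`. -/
def dataTerm (s : Bool) (S : Finset (Fin l ⊕ Fin m)) :
    FrameVar (Fin S.card) k l m → KTerm w k l m
  | .scal i => .var i
  | .vec j i => .coord _ (frameTerm S) (spanTerm (.inl j)) i
  | .frm j i => .coord _ (frameTerm S) (spanTerm (.inr j)) i
  | .gram i j => .β (frameTerm S i) (frameTerm S j)
  | .val i => if h : 0 < m then .form (.var ⟨0, h⟩) (frameTerm S i) else .zero
  | .witt => if h : 0 < m then if hw : w = true then .ω hw (.var ⟨0, h⟩) else .zero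
      else bif s then .one else .zero

/-- The values of the terms `frameTerm S` are linearly independent and span the values of all terms
`spanTerm j`. -/
def IsBase (M : QuadGeom.{u} w) (a : Fin k → M.K) (b : Fin l → M.V) (c : Fin m → M.Q)
    (S : Finset (Fin l ⊕ Fin m)) : Prop :=
  LinearIndependent M.K (fun i => (frameTerm S i).eval M a b c) ∧
    ∀ j, ¬ LinearIndependent M.K (Fin.snoc (α := fun _ => M.V)
      (fun i => (frameTerm S i).eval M a b c) ((spanTerm j).eval M a b c))

variable {M : QuadGeom.{u} w} {a : Fin k → M.K} {b : Fin l → M.V} {c : Fin m → M.Q}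

theorem IsBase.mem_span {S : Finset (Fin l ⊕ Fin m)} (h : IsBase M a b c S) (j : Fin l ⊕ Fin m) :
    (spanTerm j).eval M a b c ∈
      Submodule.span M.K (Set.range fun i => (frameTerm S i).eval M a b c) := by
  by_contra hj
  exact h.2 j (linearIndependent_finSnoc.2 ⟨h.1, hj⟩)

/-- Being a base is expressed by independence predicates applied to terms. -/
theorem isBase_iff_linearIndependent (S : Finset (Fin l ⊕ Fin m)) : IsBase M a b c S ↔
    LinearIndependent M.K (fun i => (frameTerm S i).eval M a b c) ∧
      ∀ j, ¬ LinearIndependent M.K (fun i => (Fin.snoc (α := fun _ => VTerm w k l m)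
        (frameTerm S) (spanTerm j) i).eval M a b c) := by
  have h : ∀ j : Fin l ⊕ Fin m, (fun i => (Fin.snoc (α := fun _ => VTerm w k l m)
      (frameTerm S) (spanTerm j) i).eval M a b c) = Fin.snoc (α := fun _ => M.V)
      (fun i => (frameTerm S i).eval M a b c) ((spanTerm j).eval M a b c) := by
    intro j
    funext i
    refine Fin.lastCases ?_ (fun i => ?_) i <;> simp
  simp only [IsBase, h]

theorem exists_isBase (M : QuadGeom.{u} w) (a : Fin k → M.K) (b : Fin l → M.V)
    (c : Fin m → M.Q) : ∃ S, IsBase M a b c S := by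
  classical
  obtain ⟨s, -, -, hspan, hs⟩ := exists_linearIndepOn_extension
    (v := fun j : Fin l ⊕ Fin m => (spanTerm j).eval M a b c)
    (linearIndepOn_empty M.K _) (Set.empty_subset Set.univ)
  have hf := Set.toFinite s
  have hrange : Set.range (fun i => (frameTerm (k := k) hf.toFinset i).eval M a b c) =
      (fun j : Fin l ⊕ Fin m => (spanTerm j).eval M a b c) '' s := by
    ext x
    constructor
    · rintro ⟨i, rfl⟩
      exact ⟨_, hf.mem_toFinset.1 (hf.toFinset.equivFin.symm i).2, rfl⟩
    · rintro ⟨j, hj, rfl⟩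
      exact ⟨hf.toFinset.equivFin ⟨j, hf.mem_toFinset.2 hj⟩, by simp [frameTerm]⟩
  refine ⟨hf.toFinset, ?_, fun j hj => ?_⟩
  · refine LinearIndependent.comp hs
      (fun i => ⟨(hf.toFinset.equivFin.symm i).1,
        hf.mem_toFinset.1 (hf.toFinset.equivFin.symm i).2⟩)
      fun i i' h => ?_
    simpa [Subtype.ext_iff] using h
  · refine (linearIndependent_finSnoc.1 hj).2 ?_
    rw [hrange]
    exact hspan ⟨j, trivial, rfl⟩

/-- The tuple has a frame, described by the terms `dataTerm s S`. -/
theorem IsBase.exists_represents (hM : M.IsRich) {s : Bool}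
    (hs : ∃ q, M.wittValue q = bif s then 1 else 0)
    {S : Finset (Fin l ⊕ Fin m)} (h : IsBase M a b c S) :
    ∃ q, Represents M (fun i => (frameTerm S i).eval M a b c) q
      (fun y => (dataTerm s S y).eval M a b c) a b c := by
  have hq : ∃ q, (∀ i, M.form q ((frameTerm S i).eval M a b c) =
      (dataTerm s S (.val i)).eval M a b c) ∧
      M.wittValue q = (dataTerm s S .witt).eval M a b c ∧ ∀ h : 0 < m, c ⟨0, h⟩ = q := by
    by_cases hm : 0 < m
    · refine ⟨c ⟨0, hm⟩, fun i => ?_, ?_, fun _ => rfl⟩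
      · simp [dataTerm, hm, KTerm.eval, QTerm.eval]
      · by_cases hw : w = true
        · simp [dataTerm, hm, KTerm.eval, QTerm.eval, hw, QuadGeom.wittValue_eq]
        · simp [dataTerm, hm, KTerm.eval, hw, QuadGeom.wittValue]
    · obtain ⟨q, hq⟩ := hs
      obtain ⟨q', hval, hwitt⟩ := hM.exists_form_eq q h.1 0
      refine ⟨q', fun i => ?_, ?_, fun h => absurd h hm⟩
      · simp [dataTerm, hm, KTerm.eval, hval]
      · rw [hwitt, hq]
        cases s <;> simp [dataTerm, hm, KTerm.eval]
  obtain ⟨q, hval, hwitt, hc⟩ := hq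
  refine ⟨q, h.1, fun _ _ => rfl, hval, hwitt, fun _ => rfl, fun j => ?_, fun j => ?_⟩
  · exact (sum_coord_smul h.1 (h.mem_span (.inl j))).symm
  · have := sum_coord_smul h.1 (h.mem_span (.inr j))
    refine Eq.trans ?_ (congrArg (M.act q) this.symm)
    simp only [spanTerm, VTerm.eval, QTerm.eval, hc]
    exact (M.act_diff _ _).symm

end Base

/-! ### Elimination of quantifiers -/

/-- Modulo the theory of the geometries satisfying `T`, the relation `R` is defined by a formula
with quantifiers over the field sort only. -/
def IsFieldDefinable (T : QuadGeom.{u} w → Prop) {k l m : ℕ}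
    (R : ∀ M : QuadGeom.{u} w, (Fin k → M.K) → (Fin l → M.V) → (Fin m → M.Q) → Prop) : Prop :=
  ∃ ψ : Fml w k l m, ψ.OnlyFieldQuantifiers ∧ ∀ M, T M → ∀ a b c, R M a b c ↔ ψ.Sat M a b c

namespace IsFieldDefinable

variable {T : QuadGeom.{u} w → Prop} {k l m : ℕ}
  {R R' : ∀ M : QuadGeom.{u} w, (Fin k → M.K) → (Fin l → M.V) → (Fin m → M.Q) → Prop}

theorem false : IsFieldDefinable T fun (M : QuadGeom.{u} w) (_ : Fin k → M.K) (_ : Fin l → M.V)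
    (_ : Fin m → M.Q) => False :=
  ⟨.falsum, trivial, fun _ _ _ _ _ => Iff.rfl⟩

theorem imp (h : IsFieldDefinable T R) (h' : IsFieldDefinable T R') :
    IsFieldDefinable T fun M a b c => R M a b c → R' M a b c := by
  obtain ⟨ψ, hψ, h⟩ := h
  obtain ⟨ψ', hψ', h'⟩ := h'
  exact ⟨.imp ψ ψ', ⟨hψ, hψ'⟩, fun M hM a b c => imp_congr (h M hM a b c) (h' M hM a b c)⟩

theorem congr (h : IsFieldDefinable T R) (h' : ∀ M, T M → ∀ a b c, R' M a b c ↔ R M a b c) :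
    IsFieldDefinable T R' := by
  obtain ⟨ψ, hψ, h⟩ := h
  exact ⟨ψ, hψ, fun M hM a b c => (h' M hM a b c).trans (h M hM a b c)⟩

theorem not (h : IsFieldDefinable T R) : IsFieldDefinable T fun M a b c => ¬ R M a b c :=
  h.imp false

theorem and (h : IsFieldDefinable T R) (h' : IsFieldDefinable T R') :
    IsFieldDefinable T fun M a b c => R M a b c ∧ R' M a b c :=
  (h.imp h'.not).not.congr fun _ _ _ _ _ => by tauto

theorem exists_finite {κ : Type*} [Finite κ]
    {R : κ → ∀ M : QuadGeom.{u} w, (Fin k → M.K) → (Fin l → M.V) → (Fin m → M.Q) → Prop}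
    (h : ∀ i, IsFieldDefinable T (R i)) :
    IsFieldDefinable T fun M a b c => ∃ i, R i M a b c := by
  classical
  cases nonempty_fintype κ
  suffices ∀ s : Finset κ, IsFieldDefinable T fun M a b c => ∃ i ∈ s, R i M a b c from
    (this Finset.univ).congr fun _ _ _ _ _ => by simp
  intro s
  induction s using Finset.induction_on with
  | empty => exact false.congr fun _ _ _ _ _ => by simp
  | insert i s _ ih =>
    refine ((h i).not.and ih.not).not.congr fun _ _ _ _ _ => ?_
    rw [Finset.exists_mem_insert, not_and_or, not_not, not_not]

theorem forall_finite {κ : Type*} [Finite κ]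
    {R : κ → ∀ M : QuadGeom.{u} w, (Fin k → M.K) → (Fin l → M.V) → (Fin m → M.Q) → Prop}
    (h : ∀ i, IsFieldDefinable T (R i)) :
    IsFieldDefinable T fun M a b c => ∀ i, R i M a b c :=
  (exists_finite fun i => (h i).not).not.congr fun _ _ _ _ _ => by simp

theorem linearIndependent {n : ℕ} (x : Fin n → VTerm w k l m) :
    IsFieldDefinable T fun M a b c =>
      LinearIndependent M.K fun i => (x i).eval M a b c :=
  ⟨.indep n x, trivial, fun _ _ _ _ _ => Iff.rfl⟩

theorem isBase (S : Finset (Fin l ⊕ Fin m)) :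
    IsFieldDefinable T fun (M : QuadGeom.{u} w) (a : Fin k → M.K) b c => IsBase M a b c S :=
  ((linearIndependent (frameTerm S)).and (forall_finite fun _ => (linearIndependent _).not)).congr
    fun _ _ _ _ _ => isBase_iff_linearIndependent S

theorem ringSat {α : Type} (φ : RFml α) (τ : α → KTerm w k l m) :
    IsFieldDefinable T fun M a b c => RingSat M.K φ fun i => (τ i).eval M a b c :=
  ⟨Fml.ofRing φ (Sum.elim τ Fin.elim0), Fml.onlyFieldQuantifiers_ofRing _ _,
    fun _ _ _ _ _ => (Fml.sat_ofRing_iff_ringSat φ τ).symm⟩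

end IsFieldDefinable

theorem Fml.sat_iff_ringSat {M : QuadGeom.{u} w} (hM : M.IsRich) {ι : Type} [Fintype ι]
    {k l m : ℕ} {e : ι → M.V} {q : M.Q} {D : FrameVar ι k l m → M.K} {a : Fin k → M.K}
    {b : Fin l → M.V} {c : Fin m → M.Q} (h : Represents M e q D a b c) (φ : Fml w k l m) :
    φ.Sat M a b c ↔ RingSat M.K (φ.toRing Term.var) D :=
  let := Ring.compatibleRingOfRing M.K
  (φ.realize_toRing hM (v := D) (E := Term.var) h).symm

/-- Quantifiers are eliminated down to the field sort in every class of infinite-dimensional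
geometries over fields with square roots in which a fixed Witt defect `s` is attained. -/
theorem eliminatesToField_of_isRich {T : QuadGeom.{u} w → Prop} (s : Bool)
    (hT : ∀ M, T M → M.IsRich ∧ ∃ q, M.wittValue q = bif s then 1 else 0) :
    EliminatesToField T := by
  intro k l m φ
  refine IsFieldDefinable.congr (R := fun M a b c => ∃ S, IsBase M a b c S ∧
    RingSat M.K (φ.toRing Term.var) fun y => (dataTerm s S y).eval M a b c)
    (.exists_finite fun S => .and (.isBase S) (.ringSat _ _)) fun M hM a b c => ?_
  obtain ⟨hM, hs⟩ := hT M hM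
  constructor
  · intro h
    obtain ⟨S, hS⟩ := exists_isBase M a b c
    obtain ⟨q, hq⟩ := hS.exists_represents hM hs
    exact ⟨S, hS, (φ.sat_iff_ringSat hM hq).1 h⟩
  · rintro ⟨S, hS, h⟩
    obtain ⟨q, hq⟩ := hS.exists_represents hM hs
    exact (φ.sat_iff_ringSat hM hq).2 h

/-! ### Types of tuples in fields -/

section RingType

variable {K : Type u} {L : Type v} [Field K] [Field L] {α β : Type}

attribute [local instance] Ring.compatibleRingOfRing

/-- Saturation, for parameters indexed by an arbitrary finite type. -/
theorem RingAleph0Saturated.exists_forall_ringSat (hL : RingAleph0Saturated L) [Finite α]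
    (y : α → L) (p : Set (RFml (α ⊕ Unit)))
    (hp : ∀ p₀ ⊆ p, p₀.Finite → ∃ c : L, ∀ φ ∈ p₀, RingSat L φ (Sum.elim y fun _ => c)) :
    ∃ c : L, ∀ φ ∈ p, RingSat L φ (Sum.elim y fun _ => c) := by
  obtain ⟨n, ⟨g⟩⟩ := Finite.exists_equiv_fin α
  have key : ∀ (φ : RFml (α ⊕ Unit)) (c : L),
      RingSat L (Formula.relabel (Sum.map g id) φ) (Sum.elim (fun i => y (g.symm i)) fun _ => c) ↔
        RingSat L φ (Sum.elim y fun _ => c) := by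
    intro φ c
    refine Formula.realize_relabel.trans (iff_of_eq (congrArg φ.Realize (funext fun i => ?_)))
    cases i <;> simp
  obtain ⟨c, hc⟩ := hL n (fun i => y (g.symm i)) (Formula.relabel (Sum.map g id) '' p) (by
    intro p₀ hp₀ hfin
    obtain ⟨p₁, hp₁, hfin₁, rfl⟩ := (Set.exists_subset_image_finite_and
      (p := fun t => t = p₀)).1 ⟨p₀, hp₀, hfin, rfl⟩
    obtain ⟨c, hc⟩ := hp p₁ hp₁ hfin₁
    exact ⟨c, Set.forall_mem_image.2 fun φ hφ => (key φ c).2 (hc φ hφ)⟩)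
  exact ⟨c, fun φ hφ => (key φ c).1 (hc _ ⟨φ, hφ, rfl⟩)⟩

/-- The tuples `x` in `K` and `y` in `L` satisfy the same formulas of the language of rings. -/
def SameRingType (x : α → K) (y : α → L) : Prop :=
  ∀ φ : RFml α, RingSat K φ x ↔ RingSat L φ y

namespace SameRingType

variable {x : α → K} {y : α → L}

theorem symm (h : SameRingType x y) : SameRingType y x := fun φ => (h φ).symm

theorem of_imp (h : ∀ φ : RFml α, RingSat K φ x → RingSat L φ y) : SameRingType x y :=
  fun φ => ⟨h φ, fun hy => by_contra fun hx => h (∼φ) hx hy⟩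

theorem realize (h : SameRingType x y) (t : β → RTerm α) :
    SameRingType (fun i => (t i).realize x) (fun i => (t i).realize y) := by
  intro φ
  have := h (BoundedFormula.subst φ t)
  exact BoundedFormula.realize_subst.symm.trans (this.trans BoundedFormula.realize_subst)

theorem comp (h : SameRingType x y) (g : β → α) :
    SameRingType (fun i => x (g i)) (fun i => y (g i)) :=
  h.realize fun i => Term.var (g i)

/-- The type of `z` over `x`, transferred to `y`, is finitely satisfiable, hence realized. -/
theorem exists_unit [Finite α] (h : SameRingType x y) (hL : RingAleph0Saturated L) (z : K) :
    ∃ z' : L, SameRingType (Sum.elim x fun _ : Unit => z) (Sum.elim y fun _ => z') := by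
  obtain ⟨z', hz'⟩ := hL.exists_forall_ringSat y
    {φ | RingSat K φ (Sum.elim x fun _ => z)} (by
      intro p hp hfin
      have := hfin.to_subtype
      have key := h (Formula.iExs Unit (Formula.iInf fun φ : p => φ.1))
      simp only [RingSat, Formula.realize_iExs, Formula.realize_iInf] at key
      obtain ⟨c, hc⟩ := key.1 ⟨fun _ => z, fun φ => hp φ.2⟩
      exact ⟨c (), fun φ hφ => hc ⟨φ, hφ⟩⟩)
  exact ⟨z', of_imp hz'⟩

theorem exists_sum [Finite α] (h : SameRingType x y) (hL : RingAleph0Saturated L) [Finite β]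
    (z : β → K) : ∃ z' : β → L, SameRingType (Sum.elim x z) (Sum.elim y z') := by
  revert z
  refine Finite.induction_empty_option
    (P := fun β => ∀ z : β → K, ∃ z' : β → L, SameRingType (Sum.elim x z) (Sum.elim y z'))
    ?_ ?_ ?_ β
  · intro β γ e ih z
    obtain ⟨z', hz'⟩ := ih (z ∘ e)
    refine ⟨z' ∘ e.symm, ?_⟩
    convert hz'.comp (Sum.map id e.symm) using 1 <;>
    · funext i
      cases i <;> simp
  · refine fun z => ⟨PEmpty.elim, ?_⟩
    convert h.comp (Sum.elim id PEmpty.elim) using 1 <;>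
    · funext i
      rcases i with i | ⟨⟨⟩⟩
      rfl
  · intro β _ ih z
    obtain ⟨z', hz'⟩ := ih fun i => z (some i)
    obtain ⟨t, ht⟩ := hz'.exists_unit hL (z none)
    refine ⟨fun o : Option _ => o.elim t z', ?_⟩
    convert ht.comp (Sum.elim (fun i => Sum.inl (Sum.inl i))
      fun o : Option _ => o.elim (Sum.inr ()) fun i => Sum.inl (Sum.inr i)) using 1 <;>
    · funext i
      rcases i with i | _ | i <;> rfl

end SameRingType

theorem RingElemEquiv.sameRingType (h : RingElemEquiv K L) (x : Empty → K) (y : Empty → L) :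
    SameRingType x y := by
  intro φ
  rw [Subsingleton.elim x default, Subsingleton.elim y default]
  exact Language.ElementarilyEquivalent.realize_sentence h φ

/-! ### Tuples with matching frames -/

/-- The two tuples have frames relative to which they are described by tuples of scalars that
satisfy the same formulas of the language of rings. -/
def Matched (M : QuadGeom.{u} w) (N : QuadGeom.{v} w) {k l m : ℕ} (a : Fin k → M.K)
    (b : Fin l → M.V) (c : Fin m → M.Q) (a' : Fin k → N.K) (b' : Fin l → N.V)
    (c' : Fin m → N.Q) : Prop :=
  ∃ (ι : Type) (_ : Fintype ι) (e : ι → M.V) (q : M.Q) (D : FrameVar ι k l m → M.K)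
    (e' : ι → N.V) (q' : N.Q) (D' : FrameVar ι k l m → N.K),
    Represents M e q D a b c ∧ Represents N e' q' D' a' b' c' ∧ SameRingType D D'

namespace Matched

variable {M : QuadGeom.{u} w} {N : QuadGeom.{v} w} {k l m : ℕ} {a : Fin k → M.K}
    {b : Fin l → M.V} {c : Fin m → M.Q} {a' : Fin k → N.K} {b' : Fin l → N.V}
    {c' : Fin m → N.Q}

theorem symm (h : Matched M N a b c a' b' c') : Matched N M a' b' c' a b c := by
  obtain ⟨ι, _, e, q, D, e', q', D', h, h', hD⟩ := h
  exact ⟨ι, _, e', q', D', e, q, D, h', h, hD.symm⟩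

theorem sat_iff (h : Matched M N a b c a' b' c') (hM : M.IsRich) (hN : N.IsRich)
    (φ : Fml w k l m) : φ.Sat M a b c ↔ φ.Sat N a' b' c' := by
  obtain ⟨ι, _, e, q, D, e', q', D', h, h', hD⟩ := h
  rw [φ.sat_iff_ringSat hM h, φ.sat_iff_ringSat hN h', hD]

theorem exists_pushK (h : Matched M N a b c a' b' c') (hsat : RingAleph0Saturated N.K) (x : M.K) :
    ∃ x', Matched M N (Fin.snoc (α := fun _ => M.K) a x) b c
      (Fin.snoc (α := fun _ => N.K) a' x') b' c' := by
  obtain ⟨ι, _, e, q, D, e', q', D', h, h', hD⟩ := h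
  obtain ⟨x', hx'⟩ := hD.exists_unit hsat x
  refine ⟨x', ι, _, e, q, _, e', q', _, h.pushK x, h'.pushK x', ?_⟩
  have := hx'.realize (pushK (fun y => RTerm.up _ (Term.var y)) (.new _ ()))
  simpa only [realize_pushK, RTerm.realize_up, Term.realize_var, RTerm.realize_new] using this

/-- A matching vector: the scalars that describe `x` are transferred by saturation, and the new
scalars, if they concern a vector outside the frame, are realized geometrically. -/
theorem exists_pushV (h : Matched M N a b c a' b' c') (hN : N.IsRich)
    (hsat : RingAleph0Saturated N.K) (x : M.V) :
    ∃ x', Matched M N a (Fin.snoc (α := fun _ => M.V) b x) c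
      a' (Fin.snoc (α := fun _ => N.V) b' x') c' := by
  obtain ⟨ι, _, e, q, D, e', q', D', h, h', hD⟩ := h
  by_cases hx : x ∈ Submodule.span M.K (Set.range e)
  · obtain ⟨z, rfl⟩ := (Submodule.mem_span_range_iff_exists_fun M.K).1 hx
    obtain ⟨z', hz'⟩ := hD.exists_sum hsat z
    refine ⟨_, ι, _, e, q, _, e', q', _, h.pushV z, h'.pushV z', ?_⟩
    have := hz'.realize (pushV (fun y => RTerm.up _ (Term.var y)) (.new _))
    simpa only [realize_pushV, RTerm.realize_up, Term.realize_var, RTerm.realize_new] using this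
  · obtain ⟨z', hz'⟩ := hD.exists_sum hsat
      fun o : Option ι => o.elim (M.form q x) fun i => M.β x (e i)
    obtain ⟨x', hx', hα, hγ⟩ := hN.exists_notMem_span q' h'.indep (fun i => z' (some i)) (z' none)
    refine ⟨x', Option ι, _, _, q, _, _, q', _, h.pushV_newRow hx, h'.pushV_newRow hx', ?_⟩
    have := hz'.realize (pushV (pushFrame (fun y => RTerm.up _ (Term.var y))
      (fun i => .new _ (some i)) (.new _ none)) (newRow _ _))
    simp only [realize_pushV, realize_pushFrame, realize_newRow, RTerm.realize_up,
      Term.realize_var, RTerm.realize_new] at this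
    simp only [hα, hγ]
    exact this

theorem exists_pushQ (h : Matched M N a b c a' b' c') (hN : N.IsRich)
    (hsat : RingAleph0Saturated N.K) (p : M.Q) :
    ∃ p', Matched M N a b (Fin.snoc (α := fun _ => M.Q) c p)
      a' b' (Fin.snoc (α := fun _ => N.Q) c' p') := by
  obtain ⟨ι, _, e, q, D, e', q', D', h, h', hD⟩ := h
  obtain ⟨x, rfl⟩ : ∃ x, M.act q x = p := ⟨_, M.act_diff p q⟩
  by_cases hx : x ∈ Submodule.span M.K (Set.range e)
  · obtain ⟨z, rfl⟩ := (Submodule.mem_span_range_iff_exists_fun M.K).1 hx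
    obtain ⟨z', hz'⟩ := hD.exists_sum hsat z
    refine ⟨_, ι, _, e, q, _, e', q', _, h.pushQ z, h'.pushQ z', ?_⟩
    have := hz'.realize (pushQ (fun y => RTerm.up _ (Term.var y)) (.new _))
    simpa only [realize_pushQ, RTerm.realize_up, Term.realize_var, RTerm.realize_new] using this
  · obtain ⟨z', hz'⟩ := hD.exists_sum hsat
      fun o : Option ι => o.elim (M.form q x) fun i => M.β x (e i)
    obtain ⟨x', hx', hα, hγ⟩ := hN.exists_notMem_span q' h'.indep (fun i => z' (some i)) (z' none)
    refine ⟨N.act q' x', Option ι, _, _, q, _, _, q', _, h.pushQ_newRow hx, h'.pushQ_newRow hx', ?_⟩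
    have := hz'.realize (pushQ (pushFrame (fun y => RTerm.up _ (Term.var y))
      (fun i => .new _ (some i)) (.new _ none)) (newRow _ _))
    simp only [realize_pushQ, realize_pushFrame, realize_newRow, RTerm.realize_up,
      Term.realize_var, RTerm.realize_new] at this
    simp only [hα, hγ]
    exact this

/-- Empty tuples match, by frames that consist of a form only, both of the same Witt defect. -/
theorem of_ringElemEquiv (h : RingElemEquiv M.K N.K) {s : Bool}
    (hs : ∃ q, M.wittValue q = bif s then 1 else 0)
    (hs' : ∃ q, N.wittValue q = bif s then 1 else 0) :
    Matched M N (Fin.elim0 : Fin 0 → M.K) (Fin.elim0 : Fin 0 → M.V) (Fin.elim0 : Fin 0 → M.Q)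
      (Fin.elim0 : Fin 0 → N.K) (Fin.elim0 : Fin 0 → N.V) (Fin.elim0 : Fin 0 → N.Q) := by
  obtain ⟨q, hq⟩ := hs
  obtain ⟨q', hq'⟩ := hs'
  refine ⟨Empty, inferInstance, Empty.elim, q, fun _ => bif s then 1 else 0, Empty.elim, q',
    fun _ => bif s then 1 else 0, ?_, ?_, ?_⟩
  · exact ⟨linearIndependent_empty_type, nofun, nofun, hq, nofun, nofun, nofun⟩
  · exact ⟨linearIndependent_empty_type, nofun, nofun, hq', nofun, nofun, nofun⟩
  · have := (h.sameRingType Empty.elim Empty.elim).realize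
      (fun _ : FrameVar Empty 0 0 0 => (bif s then 1 else 0 : RTerm Empty))
    cases s <;> simpa using this

end Matched

end RingType

/-! ### Finitely generated substructures and their isomorphisms -/

section Generate

variable {k l m : ℕ}

/-- The substructure generated by a tuple: the values of all terms. -/
def Substructure.gen (M : QuadGeom.{u} w) (a : Fin k → M.K) (b : Fin l → M.V) (c : Fin m → M.Q) :
    Substructure M where
  K :=
    { carrier := Set.range fun t : KTerm w k l m => t.eval M a b c
      zero_mem' := ⟨.zero, rfl⟩
      one_mem' := ⟨.one, rfl⟩
      add_mem' := by
        rintro _ _ ⟨s, rfl⟩ ⟨t, rfl⟩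
        exact ⟨.add s t, rfl⟩
      mul_mem' := by
        rintro _ _ ⟨s, rfl⟩ ⟨t, rfl⟩
        exact ⟨.mul s t, rfl⟩
      neg_mem' := by
        rintro _ ⟨s, rfl⟩
        exact ⟨.neg s, rfl⟩ }
  V :=
    { carrier := Set.range fun t : VTerm w k l m => t.eval M a b c
      zero_mem' := ⟨.zero, rfl⟩
      add_mem' := by
        rintro _ _ ⟨s, rfl⟩ ⟨t, rfl⟩
        exact ⟨.add s t, rfl⟩
      neg_mem' := by
        rintro _ ⟨s, rfl⟩
        exact ⟨.neg s, rfl⟩ }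
  Q := Set.range fun t : QTerm w k l m => t.eval M a b c
  smul_mem := by
    rintro _ ⟨s, rfl⟩ _ ⟨t, rfl⟩
    exact ⟨.smul s t, rfl⟩
  coord_mem n x y i hx := by
    rintro ⟨t, rfl⟩
    choose s hs using hx
    obtain rfl : (fun j => (s j).eval M a b c) = x := funext hs
    exact ⟨.coord n s t i, rfl⟩
  β_mem := by
    rintro _ ⟨s, rfl⟩ _ ⟨t, rfl⟩
    exact ⟨.β s t, rfl⟩
  form_mem := by
    rintro _ ⟨s, rfl⟩ _ ⟨t, rfl⟩
    exact ⟨.form s t, rfl⟩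
  act_mem := by
    rintro _ ⟨s, rfl⟩ _ ⟨t, rfl⟩
    exact ⟨.act s t, rfl⟩
  diff_mem := by
    rintro _ ⟨s, rfl⟩ _ ⟨t, rfl⟩
    exact ⟨.diff s t, rfl⟩
  ω_mem := by
    rintro h _ ⟨s, rfl⟩
    exact ⟨.ω h s, rfl⟩

variable {M : QuadGeom.{u} w} {a : Fin k → M.K} {b : Fin l → M.V} {c : Fin m → M.Q}

mutual

theorem KTerm.eval_mem (B : Substructure M) (ha : ∀ i, a i ∈ B.K) (hb : ∀ i, b i ∈ B.V)
    (hc : ∀ i, c i ∈ B.Q) : ∀ t : KTerm w k l m, t.eval M a b c ∈ B.K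
  | .var i => ha i
  | .zero => B.K.zero_mem
  | .one => B.K.one_mem
  | .add t t' => B.K.add_mem (t.eval_mem B ha hb hc) (t'.eval_mem B ha hb hc)
  | .neg t => B.K.neg_mem (t.eval_mem B ha hb hc)
  | .mul t t' => B.K.mul_mem (t.eval_mem B ha hb hc) (t'.eval_mem B ha hb hc)
  | .coord n x y i => B.coord_mem n _ _ i (fun j => (x j).eval_mem B ha hb hc)
      (y.eval_mem B ha hb hc)
  | .β t t' => B.β_mem _ (t.eval_mem B ha hb hc) _ (t'.eval_mem B ha hb hc)
  | .form t t' => B.form_mem _ (t.eval_mem B ha hb hc) _ (t'.eval_mem B ha hb hc)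
  | .ω h t => B.ω_mem h _ (t.eval_mem B ha hb hc)

theorem VTerm.eval_mem (B : Substructure M) (ha : ∀ i, a i ∈ B.K) (hb : ∀ i, b i ∈ B.V)
    (hc : ∀ i, c i ∈ B.Q) : ∀ t : VTerm w k l m, t.eval M a b c ∈ B.V
  | .var i => hb i
  | .zero => B.V.zero_mem
  | .add t t' => B.V.add_mem (t.eval_mem B ha hb hc) (t'.eval_mem B ha hb hc)
  | .neg t => B.V.neg_mem (t.eval_mem B ha hb hc)
  | .smul t t' => B.smul_mem _ (t.eval_mem B ha hb hc) _ (t'.eval_mem B ha hb hc)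
  | .diff t t' => B.diff_mem _ (t.eval_mem B ha hb hc) _ (t'.eval_mem B ha hb hc)

theorem QTerm.eval_mem (B : Substructure M) (ha : ∀ i, a i ∈ B.K) (hb : ∀ i, b i ∈ B.V)
    (hc : ∀ i, c i ∈ B.Q) : ∀ t : QTerm w k l m, t.eval M a b c ∈ B.Q
  | .var i => hc i
  | .act t t' => B.act_mem _ (t.eval_mem B ha hb hc) _ (t'.eval_mem B ha hb hc)

end

theorem Substructure.fg_gen (M : QuadGeom.{u} w) (a : Fin k → M.K) (b : Fin l → M.V)
    (c : Fin m → M.Q) : (Substructure.gen M a b c).FG := by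
  refine ⟨Set.range a, Set.range b, Set.range c, Set.finite_range _, Set.finite_range _,
    Set.finite_range _, ⟨?_, ?_, ?_⟩, fun B ha hb hc => ?_⟩
  · rintro _ ⟨i, rfl⟩
    exact ⟨.var i, rfl⟩
  · rintro _ ⟨i, rfl⟩
    exact ⟨.var i, rfl⟩
  · rintro _ ⟨i, rfl⟩
    exact ⟨.var i, rfl⟩
  · have ha' := fun i => ha ⟨i, rfl⟩
    have hb' := fun i => hb ⟨i, rfl⟩
    have hc' := fun i => hc ⟨i, rfl⟩
    refine ⟨?_, ?_, ?_⟩ <;> rintro _ ⟨t, rfl⟩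
    exacts [t.eval_mem B ha' hb' hc', t.eval_mem B ha' hb' hc', t.eval_mem B ha' hb' hc']

theorem Substructure.FG.exists_tuple {A : Substructure M} (hA : A.FG) :
    ∃ (k l m : ℕ) (a : Fin k → A.K) (b : Fin l → A.V) (c : Fin m → A.Q),
      A.K ≤ (gen M (fun i => (a i : M.K)) (fun i => (b i : M.V)) fun i => (c i : M.Q)).K ∧
      A.V ≤ (gen M (fun i => (a i : M.K)) (fun i => (b i : M.V)) fun i => (c i : M.Q)).V ∧
      A.Q ⊆ (gen M (fun i => (a i : M.K)) (fun i => (b i : M.V)) fun i => (c i : M.Q)).Q := by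
  obtain ⟨s, t, r, hs, ht, hr, ⟨hsA, htA, hrA⟩, h⟩ := hA
  obtain ⟨k, a, -, rfl⟩ := hs.fin_param
  obtain ⟨l, b, -, rfl⟩ := ht.fin_param
  obtain ⟨m, c, -, rfl⟩ := hr.fin_param
  refine ⟨k, l, m, fun i => ⟨a i, hsA ⟨i, rfl⟩⟩, fun i => ⟨b i, htA ⟨i, rfl⟩⟩,
    fun i => ⟨c i, hrA ⟨i, rfl⟩⟩, h _ ?_ ?_ ?_⟩
  · rintro _ ⟨i, rfl⟩
    exact ⟨.var i, rfl⟩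
  · rintro _ ⟨i, rfl⟩
    exact ⟨.var i, rfl⟩
  · rintro _ ⟨i, rfl⟩
    exact ⟨.var i, rfl⟩

end Generate

/-- The bijection between the ranges of two functions with the same equality pattern. -/
def rangeEquiv {T X Y : Type*} (f : T → X) (g : T → Y) (h : ∀ s t, f s = f t ↔ g s = g t) :
    Set.range f ≃ Set.range g where
  toFun x := ⟨g x.2.choose, _, rfl⟩
  invFun y := ⟨f y.2.choose, _, rfl⟩
  left_inv x := Subtype.ext <| ((h _ _).2 (Exists.choose_spec (p := fun t => g t = g x.2.choose)
    ⟨_, rfl⟩)).trans x.2.choose_spec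
  right_inv y := Subtype.ext <| ((h _ _).1 (Exists.choose_spec (p := fun t => f t = f y.2.choose)
    ⟨_, rfl⟩)).trans y.2.choose_spec

theorem rangeEquiv_apply {T X Y : Type*} {f : T → X} {g : T → Y}
    (h : ∀ s t, f s = f t ↔ g s = g t) (t : T) (ht : f t ∈ Set.range f) :
    (rangeEquiv f g h ⟨f t, ht⟩ : Y) = g t :=
  (h _ _).1 ht.choose_spec

section PartialIso

variable {k l m : ℕ} {M : QuadGeom.{u} w} {N : QuadGeom.{v} w}

/-- The isomorphism between the substructures generated by two tuples that satisfy the same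
formulas. -/
def PartialIso.ofSameType {a : Fin k → M.K} {b : Fin l → M.V} {c : Fin m → M.Q}
    {a' : Fin k → N.K} {b' : Fin l → N.V} {c' : Fin m → N.Q}
    (h : ∀ φ : Fml w k l m, φ.Sat M a b c ↔ φ.Sat N a' b' c') : PartialIso M N where
  dom := .gen M a b c
  cod := .gen N a' b' c'
  toK :=
    { rangeEquiv (fun t : KTerm w k l m => t.eval M a b c) (fun t => t.eval N a' b' c')
        fun s t => h (.eqK s t) with
      map_mul' := by
        rintro ⟨_, s, rfl⟩ ⟨_, t, rfl⟩
        refine Subtype.ext ((rangeEquiv_apply (fun s t => h (.eqK s t)) (.mul s t) _).trans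
          (congrArg₂ (· * ·) ?_ ?_))
        · exact (rangeEquiv_apply (fun s t => h (.eqK s t)) s _).symm
        · exact (rangeEquiv_apply (fun s t => h (.eqK s t)) t _).symm
      map_add' := by
        rintro ⟨_, s, rfl⟩ ⟨_, t, rfl⟩
        refine Subtype.ext ((rangeEquiv_apply (fun s t => h (.eqK s t)) (.add s t) _).trans
          (congrArg₂ (· + ·) ?_ ?_))
        · exact (rangeEquiv_apply (fun s t => h (.eqK s t)) s _).symm
        · exact (rangeEquiv_apply (fun s t => h (.eqK s t)) t _).symm }
  toV :=
    { rangeEquiv (fun t : VTerm w k l m => t.eval M a b c) (fun t => t.eval N a' b' c')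
        fun s t => h (.eqV s t) with
      map_add' := by
        rintro ⟨_, s, rfl⟩ ⟨_, t, rfl⟩
        refine Subtype.ext ((rangeEquiv_apply (fun s t => h (.eqV s t)) (.add s t) _).trans
          (congrArg₂ (· + ·) ?_ ?_))
        · exact (rangeEquiv_apply (fun s t => h (.eqV s t)) s _).symm
        · exact (rangeEquiv_apply (fun s t => h (.eqV s t)) t _).symm }
  toQ := rangeEquiv (fun t : QTerm w k l m => t.eval M a b c) (fun t => t.eval N a' b' c')
    fun s t => h (.eqQ s t)
  map_smul := by
    rintro ⟨_, s, rfl⟩ ⟨_, t, rfl⟩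
    refine (rangeEquiv_apply (fun s t => h (.eqV s t)) (.smul s t) _).trans
      (congrArg₂ (· • ·) ?_ ?_)
    · exact (rangeEquiv_apply (fun s t => h (.eqK s t)) s _).symm
    · exact (rangeEquiv_apply (fun s t => h (.eqV s t)) t _).symm
  map_indep n x := by
    choose s hs using fun j => (x j).2
    obtain rfl : (fun j => ⟨(s j).eval M a b c, s j, rfl⟩) = x :=
      funext fun j => Subtype.ext (hs j)
    refine Iff.trans (b := LinearIndependent N.K fun j => (s j).eval N a' b' c') (h (.indep n s))
      (iff_of_eq (congrArg (fun x : Fin n → N.V => LinearIndependent N.K x)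
        (funext fun j => ?_)))
    exact (rangeEquiv_apply (fun s t => h (.eqV s t)) (s j) _).symm
  map_coord n x y i := by
    choose s hs using fun j => (x j).2
    obtain rfl : (fun j => ⟨(s j).eval M a b c, s j, rfl⟩) = x :=
      funext fun j => Subtype.ext (hs j)
    obtain ⟨_, t, rfl⟩ := y
    refine (rangeEquiv_apply (fun s t => h (.eqK s t)) (.coord n s t i) _).trans
      (congrArg₂ (fun x y => coord N.K x y i) (funext fun j => ?_) ?_)
    · exact (rangeEquiv_apply (fun s t => h (.eqV s t)) (s j) _).symm
    · exact (rangeEquiv_apply (fun s t => h (.eqV s t)) t _).symm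
  map_β := by
    rintro ⟨_, s, rfl⟩ ⟨_, t, rfl⟩
    refine (rangeEquiv_apply (fun s t => h (.eqK s t)) (.β s t) _).trans
      (congrArg₂ (fun x y => N.β x y) ?_ ?_)
    · exact (rangeEquiv_apply (fun s t => h (.eqV s t)) s _).symm
    · exact (rangeEquiv_apply (fun s t => h (.eqV s t)) t _).symm
  map_form := by
    rintro ⟨_, s, rfl⟩ ⟨_, t, rfl⟩
    refine (rangeEquiv_apply (fun s t => h (.eqK s t)) (.form s t) _).trans
      (congrArg₂ (fun x y => N.form x y) ?_ ?_)
    · exact (rangeEquiv_apply (fun s t => h (.eqQ s t)) s _).symm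
    · exact (rangeEquiv_apply (fun s t => h (.eqV s t)) t _).symm
  map_act := by
    rintro ⟨_, s, rfl⟩ ⟨_, t, rfl⟩
    refine (rangeEquiv_apply (fun s t => h (.eqQ s t)) (.act s t) _).trans
      (congrArg₂ N.act ?_ ?_)
    · exact (rangeEquiv_apply (fun s t => h (.eqQ s t)) s _).symm
    · exact (rangeEquiv_apply (fun s t => h (.eqV s t)) t _).symm
  map_diff := by
    rintro ⟨_, s, rfl⟩ ⟨_, t, rfl⟩
    refine (rangeEquiv_apply (fun s t => h (.eqV s t)) (.diff s t) _).trans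
      (congrArg₂ N.diff ?_ ?_)
    · exact (rangeEquiv_apply (fun s t => h (.eqQ s t)) s _).symm
    · exact (rangeEquiv_apply (fun s t => h (.eqQ s t)) t _).symm
  map_ω hw := by
    rintro ⟨_, s, rfl⟩
    refine (rangeEquiv_apply (fun s t => h (.eqK s t)) (.ω hw s) _).trans
      (congrArg (N.ω hw) ?_)
    exact (rangeEquiv_apply (fun s t => h (.eqQ s t)) s _).symm

theorem PartialIso.isElementaryOnField_ofSameType {a : Fin k → M.K} {b : Fin l → M.V}
    {c : Fin m → M.Q} {a' : Fin k → N.K} {b' : Fin l → N.V} {c' : Fin m → N.Q}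
    (h : ∀ φ : Fml w k l m, φ.Sat M a b c ↔ φ.Sat N a' b' c') :
    (PartialIso.ofSameType h).IsElementaryOnField := by
  intro n φ x
  choose s hs using fun j => (x j).2
  obtain rfl : (fun j => ⟨(s j).eval M a b c, s j, rfl⟩) = x :=
    funext fun j => Subtype.ext (hs j)
  refine (Fml.sat_ofRing_iff_ringSat φ s).symm.trans ((h _).trans
    ((Fml.sat_ofRing_iff_ringSat φ s).trans
      (iff_of_eq (congrArg (RingSat N.K φ) (funext fun j => ?_)))))
  exact (rangeEquiv_apply (fun s t => h (.eqK s t)) (s j) _).symm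

namespace PartialIso

variable (f : PartialIso M N) (a : Fin k → f.dom.K) (b : Fin l → f.dom.V) (c : Fin m → f.dom.Q)

mutual

/-- Isomorphisms commute with the evaluation of terms. -/
theorem toK_eval : ∀ t : KTerm w k l m,
    ∃ h : t.eval M (fun i => (a i : M.K)) (fun i => (b i : M.V)) (fun i => (c i : M.Q)) ∈ f.dom.K,
      (f.toK ⟨_, h⟩ : N.K) =
        t.eval N (fun i => (f.toK (a i) : N.K)) (fun i => (f.toV (b i) : N.V))
          (fun i => (f.toQ (c i) : N.Q))
  | .var i => ⟨(a i).2, rfl⟩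
  | .zero => ⟨f.dom.K.zero_mem, congrArg Subtype.val (map_zero f.toK)⟩
  | .one => ⟨f.dom.K.one_mem, congrArg Subtype.val (map_one f.toK)⟩
  | .add t t' => by
    obtain ⟨h, e⟩ := toK_eval t
    obtain ⟨h', e'⟩ := toK_eval t'
    exact ⟨f.dom.K.add_mem h h', (congrArg Subtype.val (map_add f.toK ⟨_, h⟩ ⟨_, h'⟩)).trans
      (congrArg₂ (· + ·) e e')⟩
  | .neg t => by
    obtain ⟨h, e⟩ := toK_eval t
    exact ⟨f.dom.K.neg_mem h, (congrArg Subtype.val (map_neg f.toK ⟨_, h⟩)).trans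
      (congrArg Neg.neg e)⟩
  | .mul t t' => by
    obtain ⟨h, e⟩ := toK_eval t
    obtain ⟨h', e'⟩ := toK_eval t'
    exact ⟨f.dom.K.mul_mem h h', (congrArg Subtype.val (map_mul f.toK ⟨_, h⟩ ⟨_, h'⟩)).trans
      (congrArg₂ (· * ·) e e')⟩
  | .coord n x y i => by
    choose h e using fun j => toV_eval (x j)
    obtain ⟨h', e'⟩ := toV_eval y
    exact ⟨f.dom.coord_mem n _ _ i h h', (f.map_coord n (fun j => ⟨_, h j⟩) ⟨_, h'⟩ i).trans
      (congrArg₂ (fun x y => coord N.K x y i) (funext e) e')⟩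
  | .β t t' => by
    obtain ⟨h, e⟩ := toV_eval t
    obtain ⟨h', e'⟩ := toV_eval t'
    exact ⟨f.dom.β_mem _ h _ h', (f.map_β ⟨_, h⟩ ⟨_, h'⟩).trans
      (congrArg₂ (fun x y => N.β x y) e e')⟩
  | .form t t' => by
    obtain ⟨h, e⟩ := toQ_eval t
    obtain ⟨h', e'⟩ := toV_eval t'
    exact ⟨f.dom.form_mem _ h _ h', (f.map_form ⟨_, h⟩ ⟨_, h'⟩).trans
      (congrArg₂ (fun x y => N.form x y) e e')⟩
  | .ω hw t => by
    obtain ⟨h, e⟩ := toQ_eval t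
    exact ⟨f.dom.ω_mem hw _ h, (f.map_ω hw ⟨_, h⟩).trans (congrArg (N.ω hw) e)⟩

theorem toV_eval : ∀ t : VTerm w k l m,
    ∃ h : t.eval M (fun i => (a i : M.K)) (fun i => (b i : M.V)) (fun i => (c i : M.Q)) ∈ f.dom.V,
      (f.toV ⟨_, h⟩ : N.V) =
        t.eval N (fun i => (f.toK (a i) : N.K)) (fun i => (f.toV (b i) : N.V))
          (fun i => (f.toQ (c i) : N.Q))
  | .var i => ⟨(b i).2, rfl⟩
  | .zero => ⟨f.dom.V.zero_mem, congrArg Subtype.val (map_zero f.toV)⟩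
  | .add t t' => by
    obtain ⟨h, e⟩ := toV_eval t
    obtain ⟨h', e'⟩ := toV_eval t'
    exact ⟨f.dom.V.add_mem h h', (congrArg Subtype.val (map_add f.toV ⟨_, h⟩ ⟨_, h'⟩)).trans
      (congrArg₂ (· + ·) e e')⟩
  | .neg t => by
    obtain ⟨h, e⟩ := toV_eval t
    exact ⟨f.dom.V.neg_mem h, (congrArg Subtype.val (map_neg f.toV ⟨_, h⟩)).trans
      (congrArg Neg.neg e)⟩
  | .smul t t' => by
    obtain ⟨h, e⟩ := toK_eval t
    obtain ⟨h', e'⟩ := toV_eval t'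
    exact ⟨f.dom.smul_mem _ h _ h', (f.map_smul ⟨_, h⟩ ⟨_, h'⟩).trans (congrArg₂ (· • ·) e e')⟩
  | .diff t t' => by
    obtain ⟨h, e⟩ := toQ_eval t
    obtain ⟨h', e'⟩ := toQ_eval t'
    exact ⟨f.dom.diff_mem _ h _ h', (f.map_diff ⟨_, h⟩ ⟨_, h'⟩).trans (congrArg₂ N.diff e e')⟩

theorem toQ_eval : ∀ t : QTerm w k l m,
    ∃ h : t.eval M (fun i => (a i : M.K)) (fun i => (b i : M.V)) (fun i => (c i : M.Q)) ∈ f.dom.Q,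
      (f.toQ ⟨_, h⟩ : N.Q) =
        t.eval N (fun i => (f.toK (a i) : N.K)) (fun i => (f.toV (b i) : N.V))
          (fun i => (f.toQ (c i) : N.Q))
  | .var i => ⟨(c i).2, rfl⟩
  | .act t t' => by
    obtain ⟨h, e⟩ := toQ_eval t
    obtain ⟨h', e'⟩ := toV_eval t'
    exact ⟨f.dom.act_mem _ h _ h', (f.map_act ⟨_, h⟩ ⟨_, h'⟩).trans (congrArg₂ N.act e e')⟩

end

variable {f}

theorem IsElementaryOnField.sameRingType (hf : f.IsElementaryOnField) {α : Type} [Finite α]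
    (x : α → f.dom.K) : SameRingType (fun i => (x i : M.K)) fun i => (f.toK (x i) : N.K) := by
  obtain ⟨n, ⟨g⟩⟩ := Finite.exists_equiv_fin α
  have : SameRingType (fun i => (x (g.symm i) : M.K)) fun i => (f.toK (x (g.symm i)) : N.K) :=
    fun φ => hf n φ _
  simpa using this.comp g

theorem linearIndependent_eval_iff {n : ℕ} (t : Fin n → VTerm w k l m) :
    LinearIndependent M.K (fun j => (t j).eval M (fun i => (a i : M.K)) (fun i => (b i : M.V))
      (fun i => (c i : M.Q))) ↔
    LinearIndependent N.K (fun j => (t j).eval N (fun i => (f.toK (a i) : N.K))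
      (fun i => (f.toV (b i) : N.V)) (fun i => (f.toQ (c i) : N.Q))) := by
  choose h e using fun j => f.toV_eval a b c (t j)
  rw [← funext e]
  exact f.map_indep n fun j => ⟨_, h j⟩

theorem isBase_iff (S : Finset (Fin l ⊕ Fin m)) :
    IsBase M (fun i => (a i : M.K)) (fun i => (b i : M.V)) (fun i => (c i : M.Q)) S ↔
    IsBase N (fun i => (f.toK (a i) : N.K)) (fun i => (f.toV (b i) : N.V))
      (fun i => (f.toQ (c i) : N.Q)) S := by
  simp only [isBase_iff_linearIndependent, linearIndependent_eval_iff]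

/-- A tuple and its image under an isomorphism that is elementary on the field sort have matching
frames. -/
theorem IsElementaryOnField.matched (hf : f.IsElementaryOnField) (hM : M.IsRich) (hN : N.IsRich)
    {s : Bool} (hs : ∃ q, M.wittValue q = bif s then 1 else 0)
    (hs' : ∃ q, N.wittValue q = bif s then 1 else 0) :
    Matched M N (fun i => (a i : M.K)) (fun i => (b i : M.V)) (fun i => (c i : M.Q))
      (fun i => (f.toK (a i) : N.K)) (fun i => (f.toV (b i) : N.V))
      (fun i => (f.toQ (c i) : N.Q)) := by
  obtain ⟨S, hS⟩ := exists_isBase M (fun i => (a i : M.K)) (fun i => (b i : M.V))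
    (fun i => (c i : M.Q))
  have hS' := (isBase_iff a b c S).1 hS
  obtain ⟨q, hq⟩ := hS.exists_represents hM hs
  obtain ⟨q', hq'⟩ := hS'.exists_represents hN hs'
  refine ⟨_, _, _, q, _, _, q', _, hq, hq', ?_⟩
  choose h e using fun y => f.toK_eval a b c (dataTerm s S y)
  rw [← funext e]
  exact hf.sameRingType fun y => ⟨_, h y⟩

end PartialIso

end PartialIso

/-! ### The back-and-forth system -/

section BackAndForth

variable {k l m : ℕ} {M : QuadGeom.{u} w} {N : QuadGeom.{v} w}

namespace PartialIso

/-- If `g` agrees with `f` on generators of the domain of `f`, then `g` extends `f`. -/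
theorem extends_of_forall {f g : PartialIso M N} {a : Fin k → f.dom.K} {b : Fin l → f.dom.V}
    {c : Fin m → f.dom.Q}
    (hK : f.dom.K ≤ (Substructure.gen M (fun i => (a i : M.K)) (fun i => (b i : M.V))
      fun i => (c i : M.Q)).K)
    (hV : f.dom.V ≤ (Substructure.gen M (fun i => (a i : M.K)) (fun i => (b i : M.V))
      fun i => (c i : M.Q)).V)
    (hQ : f.dom.Q ⊆ (Substructure.gen M (fun i => (a i : M.K)) (fun i => (b i : M.V))
      fun i => (c i : M.Q)).Q)
    (ha : ∀ i, ∃ h : (a i : M.K) ∈ g.dom.K, (g.toK ⟨_, h⟩ : N.K) = f.toK (a i))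
    (hb : ∀ i, ∃ h : (b i : M.V) ∈ g.dom.V, (g.toV ⟨_, h⟩ : N.V) = f.toV (b i))
    (hc : ∀ i, ∃ h : (c i : M.Q) ∈ g.dom.Q, (g.toQ ⟨_, h⟩ : N.Q) = f.toQ (c i)) :
    g.Extends f := by
  choose ha ha' using ha
  choose hb hb' using hb
  choose hc hc' using hc
  refine ⟨fun ⟨x, hx⟩ => ?_, fun ⟨x, hx⟩ => ?_, fun ⟨x, hx⟩ => ?_⟩
  · obtain ⟨t, rfl⟩ := hK hx
    obtain ⟨h, e⟩ := g.toK_eval (fun i => ⟨_, ha i⟩) (fun i => ⟨_, hb i⟩) (fun i => ⟨_, hc i⟩) t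
    obtain ⟨h', e'⟩ := f.toK_eval a b c t
    refine ⟨h, e.trans (Eq.trans ?_ e'.symm)⟩
    rw [funext ha', funext hb', funext hc']
  · obtain ⟨t, rfl⟩ := hV hx
    obtain ⟨h, e⟩ := g.toV_eval (fun i => ⟨_, ha i⟩) (fun i => ⟨_, hb i⟩) (fun i => ⟨_, hc i⟩) t
    obtain ⟨h', e'⟩ := f.toV_eval a b c t
    refine ⟨h, e.trans (Eq.trans ?_ e'.symm)⟩
    rw [funext ha', funext hb', funext hc']
  · obtain ⟨t, rfl⟩ := hQ hx
    obtain ⟨h, e⟩ := g.toQ_eval (fun i => ⟨_, ha i⟩) (fun i => ⟨_, hb i⟩) (fun i => ⟨_, hc i⟩) t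
    obtain ⟨h', e'⟩ := f.toQ_eval a b c t
    refine ⟨h, e.trans (Eq.trans ?_ e'.symm)⟩
    rw [funext ha', funext hb', funext hc']

/-- Matching tuples that include generators of the domain of `f` and their images give an extension
of `f`. -/
theorem exists_extends_of_matched (hM : M.IsRich) (hN : N.IsRich) {f : PartialIso M N}
    {k₀ l₀ m₀ : ℕ} {a₀ : Fin k₀ → f.dom.K} {b₀ : Fin l₀ → f.dom.V} {c₀ : Fin m₀ → f.dom.Q}
    (hgen : f.dom.K ≤ (Substructure.gen M (fun i => (a₀ i : M.K)) (fun i => (b₀ i : M.V))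
        fun i => (c₀ i : M.Q)).K ∧
      f.dom.V ≤ (Substructure.gen M (fun i => (a₀ i : M.K)) (fun i => (b₀ i : M.V))
        fun i => (c₀ i : M.Q)).V ∧
      f.dom.Q ⊆ (Substructure.gen M (fun i => (a₀ i : M.K)) (fun i => (b₀ i : M.V))
        fun i => (c₀ i : M.Q)).Q)
    {a : Fin k → M.K} {b : Fin l → M.V} {c : Fin m → M.Q}
    {a' : Fin k → N.K} {b' : Fin l → N.V} {c' : Fin m → N.Q}
    (h : Matched M N a b c a' b' c')
    (ha : ∀ i, ∃ j, a j = a₀ i ∧ a' j = f.toK (a₀ i))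
    (hb : ∀ i, ∃ j, b j = b₀ i ∧ b' j = f.toV (b₀ i))
    (hc : ∀ i, ∃ j, c j = c₀ i ∧ c' j = f.toQ (c₀ i)) :
    ∃ g : PartialIso M N, (g.dom.FG ∧ g.cod.FG ∧ g.IsElementaryOnField) ∧ g.Extends f ∧
      ((∀ j, a j ∈ g.dom.K) ∧ (∀ j, b j ∈ g.dom.V) ∧ ∀ j, c j ∈ g.dom.Q) ∧
      ((∀ j, a' j ∈ g.cod.K) ∧ (∀ j, b' j ∈ g.cod.V) ∧ ∀ j, c' j ∈ g.cod.Q) := by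
  have hφ := h.sat_iff hM hN
  refine ⟨ofSameType hφ, ⟨Substructure.fg_gen M a b c, Substructure.fg_gen N a' b' c',
    isElementaryOnField_ofSameType hφ⟩, extends_of_forall hgen.1 hgen.2.1 hgen.2.2 ?_ ?_ ?_,
    ⟨fun j => ⟨.var j, rfl⟩, fun j => ⟨.var j, rfl⟩, fun j => ⟨.var j, rfl⟩⟩,
    ⟨fun j => ⟨.var j, rfl⟩, fun j => ⟨.var j, rfl⟩, fun j => ⟨.var j, rfl⟩⟩⟩
  · intro i
    obtain ⟨j, hj, hj'⟩ := ha i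
    rw [← hj, ← hj']
    exact ⟨⟨.var j, rfl⟩, rangeEquiv_apply (fun s t => hφ (.eqK s t)) (.var j) _⟩
  · intro i
    obtain ⟨j, hj, hj'⟩ := hb i
    rw [← hj, ← hj']
    exact ⟨⟨.var j, rfl⟩, rangeEquiv_apply (fun s t => hφ (.eqV s t)) (.var j) _⟩
  · intro i
    obtain ⟨j, hj, hj'⟩ := hc i
    rw [← hj, ← hj']
    exact ⟨⟨.var j, rfl⟩, rangeEquiv_apply (fun s t => hφ (.eqQ s t)) (.var j) _⟩

end PartialIso

theorem exists_snoc_eq {n : ℕ} {X Y Z : Type*} (x : Fin n → Z) (f : Z → X) (g : Z → Y) (y : X)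
    (z : Y) (i : Fin n) :
    ∃ j, Fin.snoc (α := fun _ => X) (fun i => f (x i)) y j = f (x i) ∧
      Fin.snoc (α := fun _ => Y) (fun i => g (x i)) z j = g (x i) :=
  ⟨i.castSucc, by simp, by simp⟩

/-- The isomorphisms between finitely generated substructures that are elementary on the field
sort form a back-and-forth system, if a common value `s` of the Witt defect is attained. -/
theorem isBackAndForth_of_isRich (hM : M.IsRich) (hN : N.IsRich) (hMsat : RingAleph0Saturated M.K)
    (hNsat : RingAleph0Saturated N.K) {s : Bool} (hs : ∃ q, M.wittValue q = bif s then 1 else 0)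
    (hs' : ∃ q, N.wittValue q = bif s then 1 else 0) (hMN : RingElemEquiv M.K N.K) :
    IsBackAndForth {f : PartialIso M N | f.dom.FG ∧ f.cod.FG ∧ f.IsElementaryOnField} := by
  constructor
  · have h := (Matched.of_ringElemEquiv hMN hs hs').sat_iff hM hN
    exact ⟨.ofSameType h, Substructure.fg_gen M _ _ _, Substructure.fg_gen N _ _ _,
      PartialIso.isElementaryOnField_ofSameType h⟩
  rintro f ⟨hfg, -, hf⟩
  obtain ⟨k, l, m, a, b, c, hgen⟩ := hfg.exists_tuple
  have h := hf.matched a b c hM hN hs hs'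
  have hK : ∀ (x : M.K) (x' : N.K) (i : Fin k), ∃ j,
      Fin.snoc (α := fun _ => M.K) (fun i => (a i : M.K)) x j = a i ∧
      Fin.snoc (α := fun _ => N.K) (fun i => (f.toK (a i) : N.K)) x' j = f.toK (a i) :=
    exists_snoc_eq a (fun x => (x : M.K)) (fun x => (f.toK x : N.K))
  have hV : ∀ (x : M.V) (x' : N.V) (i : Fin l), ∃ j,
      Fin.snoc (α := fun _ => M.V) (fun i => (b i : M.V)) x j = b i ∧
      Fin.snoc (α := fun _ => N.V) (fun i => (f.toV (b i) : N.V)) x' j = f.toV (b i) :=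
    exists_snoc_eq b (fun x => (x : M.V)) (fun x => (f.toV x : N.V))
  have hQ : ∀ (x : M.Q) (x' : N.Q) (i : Fin m), ∃ j,
      Fin.snoc (α := fun _ => M.Q) (fun i => (c i : M.Q)) x j = c i ∧
      Fin.snoc (α := fun _ => N.Q) (fun i => (f.toQ (c i) : N.Q)) x' j = f.toQ (c i) :=
    exists_snoc_eq c (fun x => (x : M.Q)) (fun x => (f.toQ x : N.Q))
  have hK' : ∀ i, ∃ j, (a j : M.K) = a i ∧ (f.toK (a j) : N.K) = f.toK (a i) :=
    fun i => ⟨i, rfl, rfl⟩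
  have hV' : ∀ i, ∃ j, (b j : M.V) = b i ∧ (f.toV (b j) : N.V) = f.toV (b i) :=
    fun i => ⟨i, rfl, rfl⟩
  have hQ' : ∀ i, ∃ j, (c j : M.Q) = c i ∧ (f.toQ (c j) : N.Q) = f.toQ (c i) :=
    fun i => ⟨i, rfl, rfl⟩
  refine ⟨⟨fun x => ?_, fun x => ?_, fun x => ?_⟩, ⟨fun x => ?_, fun x => ?_, fun x => ?_⟩⟩
  · obtain ⟨x', h'⟩ := h.exists_pushK hNsat x
    obtain ⟨g, hg, hgf, hd, -⟩ :=
      PartialIso.exists_extends_of_matched hM hN hgen h' (hK x x') hV' hQ'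
    exact ⟨g, hg, hgf, by simpa using hd.1 (Fin.last k)⟩
  · obtain ⟨x', h'⟩ := h.exists_pushV hN hNsat x
    obtain ⟨g, hg, hgf, hd, -⟩ :=
      PartialIso.exists_extends_of_matched hM hN hgen h' hK' (hV x x') hQ'
    exact ⟨g, hg, hgf, by simpa using hd.2.1 (Fin.last l)⟩
  · obtain ⟨x', h'⟩ := h.exists_pushQ hN hNsat x
    obtain ⟨g, hg, hgf, hd, -⟩ :=
      PartialIso.exists_extends_of_matched hM hN hgen h' hK' hV' (hQ x x')
    exact ⟨g, hg, hgf, by simpa using hd.2.2 (Fin.last m)⟩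
  · obtain ⟨x', h'⟩ := h.symm.exists_pushK hMsat x
    obtain ⟨g, hg, hgf, -, hd⟩ :=
      PartialIso.exists_extends_of_matched hM hN hgen h'.symm (hK x' x) hV' hQ'
    exact ⟨g, hg, hgf, by simpa using hd.1 (Fin.last k)⟩
  · obtain ⟨x', h'⟩ := h.symm.exists_pushV hM hMsat x
    obtain ⟨g, hg, hgf, -, hd⟩ :=
      PartialIso.exists_extends_of_matched hM hN hgen h'.symm hK' (hV x' x) hQ'
    exact ⟨g, hg, hgf, by simpa using hd.2.1 (Fin.last l)⟩
  · obtain ⟨x', h'⟩ := h.symm.exists_pushQ hM hMsat x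
    obtain ⟨g, hg, hgf, -, hd⟩ :=
      PartialIso.exists_extends_of_matched hM hN hgen h'.symm hK' hV' (hQ x' x)
    exact ⟨g, hg, hgf, by simpa using hd.2.2 (Fin.last m)⟩

end BackAndForth

/-! ### Square roots and Artin–Schreier extensions -/

section Fields

variable {K : Type*} [Field K] [CharP K 2]

theorem exists_sq_eq_of_perfectField [PerfectField K] (x : K) : ∃ y, y ^ 2 = x := by
  have := PerfectField.toPerfectRing (K := K) 2
  exact surjective_frobenius K 2 x

/-- A sentence true in a pseudo-finite field of characteristic two is true in a finite field of
characteristic two, as the characteristic is expressed by a sentence. -/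
theorem IsPseudoFinite.exists_finite (hK : IsPseudoFinite K) (φ : RFml Empty)
    (hφ : RingSat K φ Empty.elim) :
    ∃ (F : Type) (_ : Field F), Finite F ∧ CharP F 2 ∧ RingSat F φ Empty.elim := by
  have h2 : RingSat K (φ ⊓ Term.equal (1 + 1) 0) Empty.elim := by
    let := Ring.compatibleRingOfRing K
    refine Formula.realize_inf.2 ⟨hφ, ?_⟩
    simp [CharTwo.add_self_eq_zero]
  obtain ⟨F, hF, hfin, h⟩ := hK.2 _ h2
  let := Ring.compatibleRingOfRing F
  obtain ⟨h, h'⟩ := Formula.realize_inf.1 h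
  simp only [Formula.realize_equal, Ring.realize_add, Ring.realize_one, Ring.realize_zero,
    one_add_one_eq_two] at h'
  exact ⟨F, hF, hfin, CharTwo.of_one_ne_zero_of_two_eq_zero one_ne_zero h', h⟩

/-- Squaring is injective, hence surjective, on finite fields of characteristic two. -/
theorem IsPseudoFinite.exists_sq_eq (hK : IsPseudoFinite K) (x : K) : ∃ y, y ^ 2 = x := by
  by_contra hx
  let φ : RFml Empty := ∼(Formula.iAlls Unit (Formula.iExs Unit
    (Term.equal ((RTerm.new Empty ()).up Unit) (RTerm.new _ () * RTerm.new _ ()))))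
  obtain ⟨F, _, _, _, h⟩ := hK.exists_finite φ (by
    let := Ring.compatibleRingOfRing K
    simp only [RingSat, φ, Formula.realize_not, Formula.realize_iAlls, Formula.realize_iExs,
      Formula.realize_equal, RTerm.realize_up, RTerm.realize_new, Ring.realize_mul]
    intro h
    obtain ⟨y, hy⟩ := h fun _ => x
    exact hx ⟨y (), by rw [pow_two, hy]⟩)
  let := Ring.compatibleRingOfRing F
  simp only [RingSat, φ, Formula.realize_not, Formula.realize_iAlls, Formula.realize_iExs,
    Formula.realize_equal, RTerm.realize_up, RTerm.realize_new, Ring.realize_mul] at h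
  refine h fun z => ?_
  obtain ⟨y, hy⟩ := Finite.surjective_of_injective (frobenius_inj F 2) (z ())
  exact ⟨fun _ => y, by rw [← hy, frobenius_def, pow_two]⟩

/-- On a finite field the map `y ↦ y ^ 2 - y` is not surjective, since it takes the value `0` at
both `0` and `1`. -/
theorem IsPseudoFinite.exists_ne_sq_sub (hK : IsPseudoFinite K) : ∃ c : K, ∀ y, c ≠ y ^ 2 - y := by
  by_contra! hc
  let φ : RFml Empty := Formula.iAlls Unit (RFml.artinSchreier (RTerm.new Empty ()))
  obtain ⟨F, _, _, _, h⟩ := hK.exists_finite φ (by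
    let := Ring.compatibleRingOfRing K
    simp only [RingSat, φ, Formula.realize_iAlls, RFml.realize_artinSchreier, RTerm.realize_new]
    exact fun z => hc _)
  let := Ring.compatibleRingOfRing F
  simp only [RingSat, φ, Formula.realize_iAlls, RFml.realize_artinSchreier,
    RTerm.realize_new] at h
  have hsurj : Function.Surjective fun y : F => y ^ 2 - y := fun c => by
    obtain ⟨y, hy⟩ := h fun _ => c
    exact ⟨y, hy.symm⟩
  exact zero_ne_one (Finite.injective_iff_surjective.2 hsurj
    (by simp : (0 : F) ^ 2 - 0 = 1 ^ 2 - 1))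

/-- In characteristic two, an open normal subgroup of index two of the absolute Galois group yields
an Artin–Schreier extension. -/
theorem exists_ne_sq_sub_of_hom [PerfectField K]
    (χ : (AlgebraicClosure K ≃ₐ[K] AlgebraicClosure K) →* Multiplicative (ZMod 2))
    (hχ : IsOpen (χ.ker : Set (AlgebraicClosure K ≃ₐ[K] AlgebraicClosure K)))
    (g : AlgebraicClosure K ≃ₐ[K] AlgebraicClosure K) (hg : χ g ≠ 1) :
    ∃ c : K, ∀ y, c ≠ y ^ 2 - y := by
  have : CharP (AlgebraicClosure K) 2 := charP_of_injective_algebraMap' K 2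
  have h2 : ∀ s t : Multiplicative (ZMod 2), s ≠ 1 → t ≠ 1 → s = t := by decide
  let H : ClosedSubgroup (AlgebraicClosure K ≃ₐ[K] AlgebraicClosure K) :=
    ⟨χ.ker, Subgroup.isClosed_of_isOpen _ hχ⟩
  have hfix := InfiniteGalois.fixingSubgroup_fixedField H
  obtain ⟨α, hα, hαK⟩ : ∃ α ∈ IntermediateField.fixedField H.1,
      α ∉ (⊥ : IntermediateField K (AlgebraicClosure K)) := by
    by_contra! h
    refine hg ?_
    have : g ∈ (IntermediateField.fixedField H.1).fixingSubgroup := by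
      rw [IntermediateField.mem_fixingSubgroup_iff]
      exact fun x hx => (InfiniteGalois.mem_bot_iff_fixed x).1 (h x hx) g
    rw [hfix] at this
    exact this
  have hker : ∀ f, χ f = 1 → f α = α := fun f hf => hα ⟨f, hf⟩
  -- The conjugate `f α` depends only on the class of `f`.
  have hclass : ∀ f f', χ f = χ f' → f α = f' α := by
    intro f f' hff
    have := hker (f'⁻¹ * f) (by rw [map_mul, map_inv, hff, inv_mul_cancel])
    rw [AlgEquiv.mul_apply] at this
    have h := congrArg f' this
    rwa [← AlgEquiv.mul_apply, mul_inv_cancel, AlgEquiv.one_apply] at h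
  have hgg : g (g α) = α := by
    rw [← AlgEquiv.mul_apply]
    refine hker _ ?_
    rw [map_mul]
    revert hg
    generalize χ g = s
    revert s
    decide
  have hcase : ∀ f : AlgebraicClosure K ≃ₐ[K] AlgebraicClosure K,
      (f α = α ∧ f (g α) = g α) ∨ (f α = g α ∧ f (g α) = α) := by
    intro f
    by_cases hf : χ f = 1
    · refine Or.inl ⟨hker f hf, ?_⟩
      rw [← AlgEquiv.mul_apply]
      exact hclass _ _ (by rw [map_mul, hf, one_mul])
    · have hfg := h2 _ _ hf hg
      refine Or.inr ⟨hclass _ _ hfg, ?_⟩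
      rw [← AlgEquiv.mul_apply]
      refine (hclass _ (g * g) (by rw [map_mul, map_mul, hfg])).trans ?_
      rw [AlgEquiv.mul_apply, hgg]
  have hgα : g α ≠ α := by
    intro h
    refine hαK ((InfiniteGalois.mem_bot_iff_fixed α).2 fun f => ?_)
    rcases hcase f with hf | hf
    exacts [hf.1, hf.1.trans h]
  have hs : α + g α ∈ (⊥ : IntermediateField K (AlgebraicClosure K)) := by
    refine (InfiniteGalois.mem_bot_iff_fixed _).2 fun f => ?_
    rcases hcase f with hf | hf
    · rw [map_add, hf.1, hf.2]
    · rw [map_add, hf.1, hf.2, add_comm]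
  have hs0 : α + g α ≠ 0 := fun h => hgα (CharTwo.add_eq_zero.1 h).symm
  -- The quotient `t` generates the quadratic extension, with conjugate `t + 1`.
  set t := α / (α + g α) with ht
  have hfix_s : ∀ f : AlgebraicClosure K ≃ₐ[K] AlgebraicClosure K, f (α + g α) = α + g α :=
    (InfiniteGalois.mem_bot_iff_fixed _).1 hs
  have hft : ∀ f : AlgebraicClosure K ≃ₐ[K] AlgebraicClosure K, f t = t ∨ f t = 1 - t := by
    intro f
    rw [ht, map_div₀, hfix_s]
    rcases hcase f with hf | hf
    · rw [hf.1]; exact Or.inl rfl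
    · rw [hf.1]; right; field_simp; ring
  obtain ⟨c, hc⟩ := IntermediateField.mem_bot.1
    ((InfiniteGalois.mem_bot_iff_fixed (t ^ 2 - t)).2 fun f => by
      rcases hft f with hf | hf <;> rw [map_sub, map_pow, hf]
      ring)
  refine ⟨c, fun y hy => hαK ?_⟩
  have hα' : α = t * (α + g α) := (div_mul_cancel₀ _ hs0).symm
  rw [hα']
  refine mul_mem ?_ hs
  have hprod : (t - algebraMap K (AlgebraicClosure K) y) *
      (t - (1 - algebraMap K (AlgebraicClosure K) y)) = 0 := by
    have : t ^ 2 - t = algebraMap K (AlgebraicClosure K) y ^ 2 -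
        algebraMap K (AlgebraicClosure K) y := by
      rw [← hc, hy, map_sub, map_pow]
    linear_combination this
  rcases mul_eq_zero.1 hprod with h | h
  · rw [sub_eq_zero.1 h]
    exact IntermediateField.algebraMap_mem _ _
  · rw [sub_eq_zero.1 h]
    exact sub_mem (one_mem _) (IntermediateField.algebraMap_mem _ _)

/-- The homomorphism used is reduction modulo two on the 2-adic integers. -/
theorem exists_ne_sq_sub_of_galois [PerfectField K]
    (e : Field.absoluteGaloisGroup K ≃ₜ* Multiplicative ℤ_[2]) : ∃ c : K, ∀ y, c ≠ y ^ 2 - y := by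
  let χ : Field.absoluteGaloisGroup K →* Multiplicative (ZMod 2) :=
    (AddMonoidHom.toMultiplicative (PadicInt.toZMod (p := 2)).toAddMonoidHom).comp
      e.toMulEquiv.toMonoidHom
  have hker : ∀ f, χ f = 1 ↔ ‖(e f).toAdd‖ < 1 := by
    intro f
    rw [← PadicInt.mem_nonunits, ← IsLocalRing.mem_maximalIdeal, ← PadicInt.ker_toZMod,
      RingHom.mem_ker]
    exact Iff.rfl
  refine exists_ne_sq_sub_of_hom χ ?_ (e.symm (Multiplicative.ofAdd 1)) ?_
  · have : IsOpen {f : Field.absoluteGaloisGroup K | ‖(e f).toAdd‖ < 1} :=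
      isOpen_lt (continuous_norm.comp (continuous_toAdd.comp e.continuous)) continuous_const
    have hset : {f : Field.absoluteGaloisGroup K | ‖(e f).toAdd‖ < 1} = χ.ker :=
      Set.ext fun f => (hker f).symm
    exact hset ▸ this
  · intro h
    have := (hker _).1 h
    simp at this

end Fields

/-! ### Saturated algebraically closed fields -/

section AlgClosed

attribute [local instance] Ring.compatibleRingOfRing

theorem map_realize {A B : Type*} [CommRing A] [CommRing B] (f : A →+* B) {α : Type}
    (t : RTerm α) (x : α → A) : f (t.realize x) = t.realize fun i => f (x i) := by
  induction t with
  | var => rfl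
  | func g ts ih =>
    cases g
    · exact (map_add f _ _).trans (congrArg₂ (· + ·) (ih 0) (ih 1))
    · exact (map_mul f _ _).trans (congrArg₂ (· * ·) (ih 0) (ih 1))
    · exact (map_neg f _).trans (congrArg Neg.neg (ih 0))
    · exact map_zero f
    · exact map_one f

variable {K : Type u} {L : Type v} [Field K] [Field L] {α β : Type}

/-- The tuples `x` in `K` and `y` in `L` satisfy the same polynomial equations over the integers. -/
def SameEquations (x : α → K) (y : α → L) : Prop :=
  ∀ t : RTerm α, t.realize x = 0 ↔ t.realize y = 0

namespace SameEquations

variable {x : α → K} {y : α → L}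

theorem symm (h : SameEquations x y) : SameEquations y x := fun t => (h t).symm

theorem realize_eq_iff (h : SameEquations x y) (s t : RTerm α) :
    s.realize x = t.realize x ↔ s.realize y = t.realize y := by
  have := h (s + -t)
  simpa only [Ring.realize_add, Ring.realize_neg, ← sub_eq_add_neg, sub_eq_zero] using this

theorem comp (h : SameEquations x y) (g : β → α) :
    SameEquations (fun i => x (g i)) (fun i => y (g i)) := by
  intro t
  have := h (t.relabel g)
  rwa [Term.realize_relabel, Term.realize_relabel] at this

/-- The subring generated by a tuple. -/
def termRing (x : α → K) : Subring K where
  carrier := Set.range fun t : RTerm α => t.realize x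
  zero_mem' := ⟨0, Ring.realize_zero _⟩
  one_mem' := ⟨1, Ring.realize_one _⟩
  add_mem' := by
    rintro _ _ ⟨s, rfl⟩ ⟨t, rfl⟩
    exact ⟨s + t, Ring.realize_add ..⟩
  mul_mem' := by
    rintro _ _ ⟨s, rfl⟩ ⟨t, rfl⟩
    exact ⟨s * t, Ring.realize_mul ..⟩
  neg_mem' := by
    rintro _ ⟨s, rfl⟩
    exact ⟨-s, Ring.realize_neg ..⟩

/-- The embedding of the subring generated by `x` that maps `x` to `y`. -/
def toHom (h : SameEquations x y) : termRing x →+* L where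
  toFun r := rangeEquiv (fun t : RTerm α => t.realize x) (fun t => t.realize y) h.realize_eq_iff r
  map_zero' := (congrArg (fun r => (rangeEquiv _ _ h.realize_eq_iff r : L))
    (Subtype.ext (Ring.realize_zero x).symm)).trans
      ((rangeEquiv_apply h.realize_eq_iff 0 ⟨0, rfl⟩).trans (Ring.realize_zero y))
  map_one' := (congrArg (fun r => (rangeEquiv _ _ h.realize_eq_iff r : L))
    (Subtype.ext (Ring.realize_one x).symm)).trans
      ((rangeEquiv_apply h.realize_eq_iff 1 ⟨1, rfl⟩).trans (Ring.realize_one y))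
  map_add' := by
    rintro ⟨_, s, rfl⟩ ⟨_, t, rfl⟩
    refine (congrArg (fun r => (rangeEquiv _ _ h.realize_eq_iff r : L))
      (Subtype.ext (Ring.realize_add s t x).symm)).trans
        ((rangeEquiv_apply h.realize_eq_iff (s + t) ⟨s + t, rfl⟩).trans
          ((Ring.realize_add s t y).trans (congrArg₂ (· + ·) ?_ ?_)))
    · exact (rangeEquiv_apply h.realize_eq_iff s _).symm
    · exact (rangeEquiv_apply h.realize_eq_iff t _).symm
  map_mul' := by
    rintro ⟨_, s, rfl⟩ ⟨_, t, rfl⟩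
    refine (congrArg (fun r => (rangeEquiv _ _ h.realize_eq_iff r : L))
      (Subtype.ext (Ring.realize_mul s t x).symm)).trans
        ((rangeEquiv_apply h.realize_eq_iff (s * t) ⟨s * t, rfl⟩).trans
          ((Ring.realize_mul s t y).trans (congrArg₂ (· * ·) ?_ ?_)))
    · exact (rangeEquiv_apply h.realize_eq_iff s _).symm
    · exact (rangeEquiv_apply h.realize_eq_iff t _).symm

theorem toHom_apply (h : SameEquations x y) (i : α) (hi : x i ∈ termRing x) :
    h.toHom ⟨x i, hi⟩ = y i :=
  rangeEquiv_apply h.realize_eq_iff (Term.var i) hi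

theorem toHom_injective (h : SameEquations x y) : Function.Injective h.toHom :=
  fun _ _ hrs => (rangeEquiv _ _ h.realize_eq_iff).injective (Subtype.ext hrs)

/-- Two tuples with the same equations are the images of a tuple in a common subfield. -/
theorem exists_field (h : SameEquations x y) : ∃ (F : Type u) (_ : Field F) (_ : Algebra F K)
    (_ : Algebra F L) (z : α → F), (∀ i, algebraMap F K (z i) = x i) ∧
      ∀ i, algebraMap F L (z i) = y i := by
  let f : FractionRing (termRing x) →+* K :=
    IsFractionRing.lift (g := (termRing x).subtype) Subtype.val_injective
  let g : FractionRing (termRing x) →+* L := IsFractionRing.lift h.toHom_injective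
  refine ⟨FractionRing (termRing x), inferInstance, f.toAlgebra, g.toAlgebra,
    fun i => algebraMap (termRing x) _ ⟨x i, Term.var i, rfl⟩, fun i => ?_, fun i => ?_⟩
  · exact IsFractionRing.lift_algebraMap _ _
  · exact (IsFractionRing.lift_algebraMap _ _).trans (h.toHom_apply i _)

theorem of_injective {A : Type*} [CommRing A] (f : A →+* K) (g : A →+* L)
    (hf : Function.Injective f) (hg : Function.Injective g) (z : α → A) :
    SameEquations (fun i => f (z i)) fun i => g (z i) := by
  intro t
  rw [← map_realize, ← map_realize, map_eq_zero_iff f hf, map_eq_zero_iff g hg]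

open Polynomial in
/-- Polynomial equations extend to one more element `c` of `K`. -/
theorem exists_unit [Finite α] (h : SameEquations x y) [IsAlgClosed L]
    (hL : RingAleph0Saturated L) (c : K) :
    ∃ c' : L, SameEquations (Sum.elim x fun _ : Unit => c) (Sum.elim y fun _ => c') := by
  obtain ⟨F, _, _, _, z, hzx, hzy⟩ := h.exists_field
  obtain rfl : (fun i => algebraMap F K (z i)) = x := funext hzx
  obtain rfl : (fun i => algebraMap F L (z i)) = y := funext hzy
  by_cases hc : IsAlgebraic F c
  · -- An algebraic element is moved by an embedding of the field that it generates.
    have : Algebra.IsAlgebraic F (IntermediateField.adjoin F {c}) :=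
      IntermediateField.isAlgebraic_adjoin (by simpa using hc.isIntegral)
    let σ : IntermediateField.adjoin F {c} →ₐ[F] L := IsAlgClosed.lift
    let c₀ : IntermediateField.adjoin F {c} := IntermediateField.AdjoinSimple.gen F c
    have := of_injective (algebraMap (IntermediateField.adjoin F {c}) K) σ.toRingHom
      (algebraMap (IntermediateField.adjoin F {c}) K).injective σ.toRingHom.injective
      (Sum.elim (fun i => algebraMap F _ (z i)) fun _ : Unit => c₀)
    refine ⟨σ c₀, ?_⟩
    convert this using 1 <;>
    · funext i
      rcases i with i | i
      · simp [← IsScalarTower.algebraMap_apply]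
      · simp [c₀]
  · -- By saturation `L` has an element that avoids the zeros of all nonzero polynomials over `F`.
    let P : RTerm (α ⊕ Unit) → L[X] := fun t =>
      t.realize (Sum.elim (fun i => C (algebraMap F L (z i))) fun _ => X)
    have hP : ∀ t c', (P t).eval c' =
        t.realize (Sum.elim (fun i => algebraMap F L (z i)) fun _ => c') := by
      intro t c'
      rw [← coe_evalRingHom, map_realize]
      congr 1
      funext i
      cases i <;> simp
    obtain ⟨c', hc'⟩ := hL.exists_forall_ringSat (fun i => algebraMap F L (z i))
      {φ | ∃ t, P t ≠ 0 ∧ φ = ∼(Term.equal t 0)} (by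
        intro p₀ hp₀ hfin
        have hp : ∀ φ : p₀, ∃ t, P t ≠ 0 ∧ φ.1 = ∼(Term.equal t 0) := fun φ => hp₀ φ.2
        choose t ht using hp
        have := hfin.to_subtype
        have : (⋃ φ : p₀, {c' | (P (t φ)).IsRoot c'}).Finite :=
          Set.finite_iUnion fun φ => Polynomial.finite_setOfPred_isRoot (ht φ).1
        obtain ⟨c', hc'⟩ := this.infinite_compl.nonempty
        refine ⟨c', fun φ hφ => ?_⟩
        rw [show φ = _ from (ht ⟨φ, hφ⟩).2, RingSat, Formula.realize_not, Formula.realize_equal,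
          Ring.realize_zero, ← hP]
        intro h0
        exact hc' (Set.mem_iUnion.2 ⟨⟨φ, hφ⟩, h0⟩))
    refine ⟨c', fun t => ?_⟩
    let Q : F[X] := t.realize (Sum.elim (fun i => C (z i)) fun _ => X)
    have hQ : aeval c Q = t.realize (Sum.elim (fun i => algebraMap F K (z i)) fun _ => c) := by
      change (aeval c : F[X] →ₐ[F] K).toRingHom Q = _
      rw [map_realize]
      congr 1
      funext i
      cases i <;> simp
    have hQP : Q.map (algebraMap F L) = P t := by
      rw [← coe_mapRingHom, map_realize]
      congr 1
      funext i
      cases i <;> simp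
    have h1 : aeval c Q = 0 ↔ Q = 0 :=
      map_eq_zero_iff _ (transcendental_iff_injective.1 hc)
    rw [← hQ, h1, ← Polynomial.map_eq_zero (algebraMap F L), hQP, ← hP]
    constructor
    · intro h0
      rw [h0, eval_zero]
    · intro h0
      by_contra hne
      have := hc' _ ⟨t, hne, rfl⟩
      rw [RingSat, Formula.realize_not, Formula.realize_equal, Ring.realize_zero, ← hP] at this
      exact this h0

/-- Tuples with the same equations satisfy the same formulas: `exists_unit`, in both directions,
handles the quantifiers. -/
theorem realize_iff [IsAlgClosed K] [IsAlgClosed L] (hK : RingAleph0Saturated K)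
    (hL : RingAleph0Saturated L) [Finite α] : ∀ {n : ℕ} (φ : Language.ring.BoundedFormula α n)
    {x : α → K} {y : α → L} {xs : Fin n → K} {ys : Fin n → L}
    (_ : SameEquations (Sum.elim x xs) (Sum.elim y ys)), φ.Realize x xs ↔ φ.Realize y ys
  | _, .falsum, _, _, _, _, _ => Iff.rfl
  | _, .equal t t', _, _, _, _, h => h.realize_eq_iff t t'
  | _, .rel r _, _, _, _, _, _ => nomatch r
  | _, .imp φ ψ, _, _, _, _, h => imp_congr (realize_iff hK hL φ h) (realize_iff hK hL ψ h)
  | n, .all φ, x, y, xs, ys, h => by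
    have key : ∀ {c : K} {c' : L}, SameEquations (Sum.elim (Sum.elim x xs) fun _ : Unit => c)
        (Sum.elim (Sum.elim y ys) fun _ => c') →
        (φ.Realize x (Fin.snoc xs c) ↔ φ.Realize y (Fin.snoc ys c')) := by
      intro c c' hc
      refine realize_iff hK hL φ ?_
      convert hc.comp (Sum.elim (fun i => Sum.inl (Sum.inl i))
        (Fin.snoc (α := fun _ => (α ⊕ Fin n) ⊕ Unit) (fun i => Sum.inl (Sum.inr i))
          (Sum.inr ()))) using 1 <;>
      · funext i
        rcases i with i | i
        · rfl
        · refine Fin.lastCases ?_ (fun i => ?_) i <;> simp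
    rw [BoundedFormula.realize_all, BoundedFormula.realize_all]
    constructor
    · intro hx c'
      obtain ⟨c, hc⟩ := h.symm.exists_unit hK c'
      exact (key hc.symm).1 (hx c)
    · intro hy c
      obtain ⟨c', hc⟩ := h.exists_unit hL c
      exact (key hc).2 (hy c')

theorem sameRingType [IsAlgClosed K] [IsAlgClosed L] (hK : RingAleph0Saturated K)
    (hL : RingAleph0Saturated L) [Finite α] (h : SameEquations x y) : SameRingType x y := by
  intro φ
  refine realize_iff hK hL φ ?_
  convert h.comp (Sum.elim id Fin.elim0) using 1 <;>
  · funext i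
    rcases i with i | i
    · rfl
    · exact i.elim0

end SameEquations

/-- The field part of a partial isomorphism is an isomorphism of subrings, which respects polynomial
equations. -/
theorem PartialIso.isElementaryOnField_of_isAlgClosed {M : QuadGeom.{u} w} {N : QuadGeom.{v} w}
    [IsAlgClosed M.K] [IsAlgClosed N.K] (hM : RingAleph0Saturated M.K)
    (hN : RingAleph0Saturated N.K) (f : PartialIso M N) : f.IsElementaryOnField := by
  intro n φ x
  refine SameEquations.sameRingType hM hN ?_ φ
  exact SameEquations.of_injective f.dom.K.subtype (f.cod.K.subtype.comp f.toK.toRingHom)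
    Subtype.val_injective (Subtype.val_injective.comp f.toK.injective) x

/-- The empty tuples have the same equations because both fields contain the prime field with two
elements. -/
theorem ringElemEquiv_of_isAlgClosed [CharP K 2] [CharP L 2] [IsAlgClosed K] [IsAlgClosed L]
    (hK : RingAleph0Saturated K) (hL : RingAleph0Saturated L) : RingElemEquiv K L := by
  have h := SameEquations.sameRingType hK hL (SameEquations.of_injective
    (ZMod.castHom (dvd_refl 2) K) (ZMod.castHom (dvd_refl 2) L) (RingHom.injective _)
    (RingHom.injective _) Empty.elim)
  refine Language.elementarilyEquivalent_iff.2 fun φ => ?_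
  have := h φ
  rwa [Subsingleton.elim (fun i : Empty => _) (default : Empty → K),
    Subsingleton.elim (fun i : Empty => _) (default : Empty → L)] at this

end AlgClosed

/-! ### The two classes of fields -/

section Classes

variable {M : QuadGeom.{u} w} {N : QuadGeom.{v} w}

theorem isRich_of_isAlgClosed (hM : M.IsInfiniteDimensional) [IsAlgClosed M.K] : M.IsRich :=
  ⟨hM, fun x => IsAlgClosed.exists_pow_nat_eq x two_pos⟩

theorem isRich_of_isPseudoFinite (hM : M.IsInfiniteDimensional) (hK : IsPseudoFinite M.K) :
    M.IsRich :=
  ⟨hM, hK.exists_sq_eq⟩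

theorem wittValue_eq_zero_iff
    (h : ∀ (h : w = true) (q : M.Q) (q' : N.Q), M.ω h q = 0 ↔ N.ω h q' = 0)
    (q : M.Q) (q' : N.Q) : M.wittValue q = 0 ↔ N.wittValue q' = 0 := by
  by_cases hw : w = true
  · rw [QuadGeom.wittValue_eq hw, QuadGeom.wittValue_eq hw, h hw q q']
  · rw [QuadGeom.wittValue, QuadGeom.wittValue, dif_neg hw, dif_neg hw]
    simp

theorem isBackAndForth_of_isAlgClosed (hM : M.IsInfiniteDimensional)
    (hN : N.IsInfiniteDimensional) (hMQ : Nonempty M.Q) (hNQ : Nonempty N.Q)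
    (hMs : RingAleph0Saturated M.K) (hNs : RingAleph0Saturated N.K) [IsAlgClosed M.K]
    [IsAlgClosed N.K]
    (hω : ∀ (h : w = true) (q : M.Q) (q' : N.Q), M.ω h q = 0 ↔ N.ω h q' = 0) :
    IsBackAndForth {f : PartialIso M N | f.dom.FG ∧ f.cod.FG} := by
  obtain ⟨q⟩ := hMQ
  obtain ⟨q'⟩ := hNQ
  have hset : {f : PartialIso M N | f.dom.FG ∧ f.cod.FG} =
      {f | f.dom.FG ∧ f.cod.FG ∧ f.IsElementaryOnField} := by
    ext f
    exact and_congr_right fun _ =>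
      (and_iff_left (f.isElementaryOnField_of_isAlgClosed hMs hNs)).symm
  rw [hset]
  have h := wittValue_eq_zero_iff hω q q'
  have hK := ringElemEquiv_of_isAlgClosed hMs hNs
  rcases M.wittValue_zero_or_one q with h0 | h1
  · exact isBackAndForth_of_isRich (isRich_of_isAlgClosed hM) (isRich_of_isAlgClosed hN) hMs hNs
      (s := false) ⟨q, h0⟩ ⟨q', h.1 h0⟩ hK
  · refine isBackAndForth_of_isRich (isRich_of_isAlgClosed hM) (isRich_of_isAlgClosed hN) hMs hNs
      (s := true) ⟨q, h1⟩ ⟨q', (N.wittValue_zero_or_one q').resolve_left fun h0 => ?_⟩ hK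
    exact one_ne_zero (h1.symm.trans (h.2 h0))

theorem isBackAndForth_of_isPseudoFinite (hM : M.IsInfiniteDimensional)
    (hN : N.IsInfiniteDimensional) (hMQ : Nonempty M.Q) (hNQ : Nonempty N.Q)
    (hMs : RingAleph0Saturated M.K) (hNs : RingAleph0Saturated N.K) (hMK : IsPseudoFinite M.K)
    (hNK : IsPseudoFinite N.K) (h : RingElemEquiv M.K N.K) :
    IsBackAndForth {f : PartialIso M N | f.dom.FG ∧ f.cod.FG ∧ f.IsElementaryOnField} :=
  have hM' := isRich_of_isPseudoFinite hM hMK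
  have hN' := isRich_of_isPseudoFinite hN hNK
  isBackAndForth_of_isRich hM' hN' hMs hNs (s := false)
    (hM'.exists_wittValue_eq hMQ hMK.exists_ne_sq_sub)
    (hN'.exists_wittValue_eq hNQ hNK.exists_ne_sq_sub) h

end Classes

theorem eliminatesToField_isModelTQ : EliminatesToField IsModelTQ.{u} :=
  eliminatesToField_of_isRich false fun _ ⟨hM, ⟨q⟩, _⟩ =>
    ⟨isRich_of_isAlgClosed hM, q, dif_neg Bool.false_ne_true⟩

theorem eliminatesToField_isModelTQω : EliminatesToField IsModelTQω.{u} :=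
  eliminatesToField_of_isRich false fun M ⟨hM, hQ, _, _, ⟨e⟩⟩ =>
    have hR : M.IsRich := ⟨hM, exists_sq_eq_of_perfectField⟩
    ⟨hR, hR.exists_wittValue_eq hQ (exists_ne_sq_sub_of_galois e)⟩

theorem eliminatesToField_of_isPseudoFinite (w : Bool) : EliminatesToField
    fun M : QuadGeom.{u} w => M.IsInfiniteDimensional ∧ Nonempty M.Q ∧ IsPseudoFinite M.K :=
  eliminatesToField_of_isRich false fun _ ⟨hM, hQ, hK⟩ =>
    have hR := isRich_of_isPseudoFinite hM hK
    ⟨hR, hR.exists_wittValue_eq hQ hK.exists_ne_sq_sub⟩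

theorem eliminatesToField_of_isAlgClosed (s : Bool) : EliminatesToField
    fun M : QuadGeom.{u} true =>
      M.IsInfiniteDimensional ∧ Nonempty M.Q ∧ IsAlgClosed M.K ∧
        ∀ q, M.ω rfl q = bif s then 1 else 0 :=
  eliminatesToField_of_isRich s fun _ ⟨hM, ⟨q⟩, _, hω⟩ =>
    ⟨isRich_of_isAlgClosed hM, q, (QuadGeom.wittValue_eq rfl q).trans (hω q)⟩

end

end QuadraticGeometry

theorem mainTheorem3 :
    (∀ (w : Bool) (M : QuadGeom.{u} w) (N : QuadGeom.{v} w),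
      M.IsInfiniteDimensional → N.IsInfiniteDimensional → Nonempty M.Q → Nonempty N.Q →
      RingAleph0Saturated M.K → RingAleph0Saturated N.K →
      (IsAlgClosed M.K → IsAlgClosed N.K →
        (∀ (h : w = true) (q : M.Q) (q' : N.Q), M.ω h q = 0 ↔ N.ω h q' = 0) →
        IsBackAndForth {f : PartialIso M N | f.dom.FG ∧ f.cod.FG}) ∧
      (IsPseudoFinite M.K → IsPseudoFinite N.K → RingElemEquiv M.K N.K →
        IsBackAndForth
          {f : PartialIso M N | f.dom.FG ∧ f.cod.FG ∧ f.IsElementaryOnField})) ∧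
    (EliminatesToField IsModelTQ.{u} ∧
      EliminatesToField IsModelTQω.{u} ∧
      (∀ w : Bool, EliminatesToField
        fun M : QuadGeom.{u} w => M.IsInfiniteDimensional ∧ Nonempty M.Q ∧ IsPseudoFinite M.K) ∧
      EliminatesToField
        (fun M : QuadGeom.{u} true =>
          M.IsInfiniteDimensional ∧ Nonempty M.Q ∧ IsAlgClosed M.K ∧ ∀ q, M.ω rfl q = 0) ∧
      EliminatesToField
        (fun M : QuadGeom.{u} true =>
          M.IsInfiniteDimensional ∧ Nonempty M.Q ∧ IsAlgClosed M.K ∧ ∀ q, M.ω rfl q = 1)) := by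
  refine ⟨fun w M N hM hN hMQ hNQ hMs hNs => ⟨fun hMK hNK hω => ?_, fun hMK hNK h => ?_⟩,
    eliminatesToField_isModelTQ, eliminatesToField_isModelTQω,
    eliminatesToField_of_isPseudoFinite, eliminatesToField_of_isAlgClosed false,
    eliminatesToField_of_isAlgClosed true⟩
  · exact isBackAndForth_of_isAlgClosed hM hN hMQ hNQ hMs hNs hω
  · exact isBackAndForth_of_isPseudoFinite hM hN hMQ hNQ hMs hNs hMK hNK h
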